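/- For a probability measure $p$ on $\mathbb{R}$ with density $\rho$ let $h(p)=-\int\rho\ln\rho$ be its differential entropy, let $*$ denote convolution, and let $\gamma_K$ be the centered Gaussian law with variance $K>0$. Let $\mathcal{P}_2(\mathbb{R})$ be the set of absolutely continuous probability measures on $\mathbb{R}$ with finite second moment. Given $u>0$ and $\lambda\ge 0$, define $$\Psi(p,q)=u\,h(p*q*\gamma_u)+h(p)-(1+u)\,h(p*\gamma_u),\qquad \Psi_\lambda(p,q)=\Psi(p,q)-\lambda\operatorname{var}(q).$$ Suppose $K>0$ and $L>0$ are such that $(K,L)$ is a stationary point (vanishing derivative) of the function $(K,L)\mapsto\Psi_\lambda(\gamma_K,\gamma_L)$. The Wasserstein-2 Hessian of a functional $f$ at $(p,q)$ is the symmetric bilinear form $\operatorname{Hess}f(p,q)$ on pairs of smooth compactly supported vector fields on $\mathbb{R}$ such that, for some gradient $(G_1,G_2)\in L^2(p)\times L^2(q)$ and all $U,V\in C_c^\infty(\mathbb{R})$, with $p_t=(\mathrm{id}+tU)_\#p$ and $q_t=(\mathrm{id}+tV)_\#q$, $$f(p_t,q_t)=f(p,q)+t\Big(\int G_1U\,dp+\int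 G_2V\,dq\Big)+\frac{t^2}{2}\operatorname{Hess}f(p,q)\big((U,V),(U,V)\big)+o(t^2),\qquad t\to 0.$$ Then $\operatorname{Hess}\Psi_\lambda(\gamma_K,\gamma_L)$ exists, and its restriction to the variance-preserving subspace $$\mathcal{C}=\Big\{(U,V):\int x\,V(x)\,\gamma_L(x)\,dx=0\Big\}$$ is negative semidefinite if and only if $$K\le\frac{u}{(1+u)^{1/3}-1}.$$ Moreover, if $K>\frac{u}{(1+u)^{1/3}-1}$, then $(\gamma_K,\gamma_L)$ is not a local maximum of $\Psi(p,q)$ subject to $\operatorname{var}(q)\le L$, locality being with respect to the Wasserstein-2 distance: for every $\varepsilon>0$ there are $p,q\in\mathcal{P}_2(\mathbb{R})$ with $h(p)$ finite, $\operatorname{var}(q)\le L$, $W_2(p,\gamma_K)<\varepsilon$, $W_2(q,\gamma_L)<\varepsilon$ and $\Psi(p,q)>\Psi(\gamma_K,\gamma_L)$. -/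

import Mathlib

open MeasureTheory ProbabilityTheory Filter Topology Asymptotics TopologicalSpace
open scoped ENNReal Distributions

namespace W2Flow

noncomputable section

/-- Differential entropy (in nats) `h(p) = - ∫ ρ ln ρ` of a law on `ℝ` with density `ρ`. -/
def diffEntropy (p : Measure ℝ) : ℝ :=
  ∫ x, Real.negMulLog (p.rnDeriv volume x).toReal

/-- The differential entropy integral converges absolutely. -/
def FiniteEntropy (p : Measure ℝ) : Prop :=
  Integrable (fun x : ℝ => Real.negMulLog (p.rnDeriv volume x).toReal) volume

/-- The centered Gaussian law on `ℝ` with variance `K` (used for `K > 0`). -/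
abbrev gauss (K : ℝ) : Measure ℝ := gaussianReal 0 K.toNNReal

/-- `Ψ(p,q) = u h(p * q * γ_u) + h(p) - (1+u) h(p * γ_u)`. -/
def Psi (u : ℝ) (p q : Measure ℝ) : ℝ :=
  u * diffEntropy ((p.conv q).conv (gauss u)) + diffEntropy p
    - (1 + u) * diffEntropy (p.conv (gauss u))

/-- `Ψ_λ(p,q) = Ψ(p,q) - λ var(q)`. -/
def PsiLam (u lam : ℝ) (p q : Measure ℝ) : ℝ :=
  Psi u p q - lam * variance id q

/-- `𝒫₂(ℝ)`: absolutely continuous probability measures with finite second moment. -/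
structure IsP2 (p : Measure ℝ) : Prop where
  isProb : IsProbabilityMeasure p
  absCont : p ≪ volume
  secondMoment : MemLp id 2 p

/-- The Wasserstein-2 distance: the infimum over couplings `π` of `p` and `q` of
`(∫ |x - y|² dπ(x,y))^{1/2}`. -/
def w2 (p q : Measure ℝ) : ℝ≥0∞ :=
  (⨅ π ∈ {π : Measure (ℝ × ℝ) | π.map Prod.fst = p ∧ π.map Prod.snd = q},
    ∫⁻ z, edist z.1 z.2 ^ 2 ∂π) ^ ((1 : ℝ) / 2)

/-- `(p, q)` is a local maximum of `f` over `S` for the (product) Wasserstein-2 topology. -/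
def IsW2LocalMaxOn (f : Measure ℝ → Measure ℝ → ℝ) (S : Set (Measure ℝ × Measure ℝ))
    (p q : Measure ℝ) : Prop :=
  ∃ ε : ℝ, 0 < ε ∧ ∀ p' q' : Measure ℝ, (p', q') ∈ S →
    w2 p' p < ENNReal.ofReal ε → w2 q' q < ENNReal.ofReal ε → f p' q' ≤ f p q

/-- The pairs `(p, q)` in `𝒫₂(ℝ) × 𝒫₂(ℝ)` with `var(q) ≤ L`. Finiteness of `h(p)` is required so
that `Ψ(p,q)` is a real number (on `𝒫₂(ℝ)` the only other possibility is `h(p) = -∞`, that is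
`Ψ(p,q) = -∞`; the entropies of the Gaussian-smoothed laws are always finite). -/
def feasible (L : ℝ) : Set (Measure ℝ × Measure ℝ) :=
  {x | IsP2 x.1 ∧ IsP2 x.2 ∧ FiniteEntropy x.1 ∧ variance id x.2 ≤ L}

/-- Smooth compactly supported vector fields on `ℝ`. -/
abbrev VField : Type := 𝓓((⊤ : Opens ℝ), ℝ)

/-- The constant speed geodesic `t ↦ (id + t U)_# p` with initial velocity `U` (it is an optimal
transport for small `|t|`). -/
def geodesic (p : Measure ℝ) (U : VField) (t : ℝ) : Measure ℝ :=
  p.map fun x => x + t * U x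

/-- The symmetric bilinear form `H` is the Wasserstein-2 Hessian of `f` at `(p, q)`: there is
a gradient `(G₁, G₂) ∈ L²(p) × L²(q)` such that along every pair of geodesics
`f(p_t, q_t) = f(p, q) + t ⟨(G₁, G₂), (U, V)⟩ + (t² / 2) H((U, V), (U, V)) + o(t²)` as `t → 0`.
Since `H` is symmetric, it is determined by `f`, `p` and `q`. -/
def IsW2Hessian (f : Measure ℝ → Measure ℝ → ℝ) (p q : Measure ℝ)
    (H : LinearMap.BilinForm ℝ (VField × VField)) : Prop :=
  H.IsSymm ∧ ∃ G₁ G₂ : ℝ → ℝ, MemLp G₁ 2 p ∧ MemLp G₂ 2 q ∧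
    ∀ U V : VField,
      (fun t : ℝ => f (geodesic p U t) (geodesic q V t) - f p q
          - t * ((∫ x, G₁ x * U x ∂p) + ∫ y, G₂ y * V y ∂q)
          - t ^ 2 / 2 * H (U, V) (U, V))
        =o[𝓝 0] fun t : ℝ => t ^ 2

theorem integrable_id_mul (q : Measure ℝ) [IsFiniteMeasure q] (V : VField) :
    Integrable (fun y : ℝ => y * V y) q :=
  (continuous_id.mul V.continuous).integrable_of_hasCompactSupport V.hasCompactSupport.mul_left

/-- The variance-preserving subspace `{(U, V) : ∫ y V(y) dq(y) = 0}` at a centered law `q`. -/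
def variancePreserving (q : Measure ℝ) [IsFiniteMeasure q] : Submodule ℝ (VField × VField) where
  carrier := {ξ | ∫ y, y * ξ.2 y ∂q = 0}
  zero_mem' := by simp
  add_mem' := by
    intro ξ η hξ hη
    have h := integral_add (integrable_id_mul q ξ.2) (integrable_id_mul q η.2)
    simp only [Set.mem_ofPred_eq] at hξ hη ⊢
    rw [hξ, hη] at h
    simpa [mul_add] using h
  smul_mem' := by
    intro c ξ hξ
    simp only [Set.mem_ofPred_eq] at hξ ⊢
    have h := integral_const_mul (μ := q) c (fun y : ℝ => y * ξ.2 y)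
    rw [hξ] at h
    simpa [mul_left_comm] using h

end

end W2Flow

/-!
Along the geodesics `p_t = (id + tU)_# γ_K`, `q_t = (id + tV)_# γ_L` every entropy in `Ψ` has a
second-order expansion. For a smoothed law, entropy is the Gaussian cross-entropy, which only
depends on the second moment, minus the relative entropy to a Gaussian, which is half the squared
`L²` norm of the relative density perturbation up to a third-order error (`entropy_expansion`); for
`h(p_t)` the change of variables formula gives `∫ log (1 + tU')` (`geodesic_entropy`). In
standardised coordinates the relative perturbation of `p * γ_u` is an Ornstein-Uhlenbeck average
`ou ρ (δU)` of the Gaussian divergence `δU(z) = z U(z) - U'(z)`, with `ρ = K / (K + u)`, and that of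
`p * q * γ_u` is `ou r (δU) + ou s (δV)` with `r = K / S`, `s = L / S`, `S = K + L + u`
(`densResponse_single`, `densResponse_pair`). At a stationary pair all remaining terms cancel except
for one involving the means, so the gradient is zero and the Hessian is `hessForm`, on the diagonal
`(1 + u) ‖ou ρ δU‖² - ‖δU‖² - u ‖ou r δU + ou s δV‖² + (u / S) (2 (∫ U) (∫ V) + (∫ V)²)`
(`hessForm_self`, `PsiLam_expansion`).

The operator `ou c` multiplies the Hermite mode of degree `n` by `√c ^ n`, so the form splits into
Hermite modes. In degree one, stationarity makes the contributions cancel against the mean terms. In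
degree two, the constraint on `V` removes its contribution, and stationarity `u r = (1 + u) ρ - 1`
gives the coefficient `(1 + u) ρ² - 1 - u r² = -(1 + u) (1 - ρ)² / u`. In degree `n ≥ 3` the form
is at most `((1 + u) ρ ^ n - 1)` times the squared mode of `δU`, and equality is attained by choosing
the mode of `δV` to cancel the third square. Hence negativity is equivalent to `(1 + u) ρ ^ 3 ≤ 1`,
which is the threshold on `K` (`le_threshold_iff`). The spectral decomposition itself is not needed:
Bessel's inequality for the two lowest modes (`bessel_hermite`) and the spectral gap
`ouNorm_gaussDiv_le` give the upper bound (`hessForm_nonpos`), and truncated Hermite polynomials of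
degree two, whose divergence tends to the third Hermite polynomial, give a positive direction above
the threshold (`exists_hessForm_pos`).

A positive direction on the variance-preserving subspace changes `var q_t` at order `t²`. Correcting
`V` by a term of order `t` brings the variance just below `L` and changes the Hessian term only at
order `t³`. As the remainder in the expansion is uniform over bounded families of fields, `Ψ`
increases along the corrected family (`not_isW2LocalMaxOn`).
-/

namespace W2Flow

noncomputable section

theorem integrable_fun_sub {α : Type*} {m : MeasurableSpace α} {μ : Measure α} {f g : α → ℝ}
    (hf : Integrable f μ) (hg : Integrable g μ) : Integrable (fun x => f x - g x) μ := hf.sub hg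

/-! ### Centred Gaussian densities -/

/-- The density of the centred Gaussian law of variance `v` (meaningful for `v > 0`). -/
def phi (v x : ℝ) : ℝ := (√(2 * Real.pi * v))⁻¹ * Real.exp (-x ^ 2 / (2 * v))

/-- The standard Gaussian law. -/
abbrev stdGauss : Measure ℝ := gaussianReal 0 1

theorem phi_pos {v : ℝ} (hv : 0 < v) (x : ℝ) : 0 < phi v x := by
  unfold phi; have := Real.pi_pos; positivity

theorem continuous_phi (v : ℝ) : Continuous (phi v) := by
  unfold phi; fun_prop

theorem gaussianPDFReal_eq_phi {v : ℝ} (hv : 0 < v) : gaussianPDFReal 0 v.toNNReal = phi v := by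
  ext x
  simp [gaussianPDFReal, phi, Real.coe_toNNReal v hv.le]

theorem gauss_eq_withDensity {v : ℝ} (hv : 0 < v) :
    gauss v = volume.withDensity fun x => ENNReal.ofReal (phi v x) := by
  rw [gauss, gaussianReal_of_var_ne_zero _ (by simpa using hv)]
  simp only [gaussianPDF_def, gaussianPDFReal_eq_phi hv]

theorem integral_gauss {v : ℝ} (hv : 0 < v) (f : ℝ → ℝ) :
    ∫ x, f x ∂gauss v = ∫ x, phi v x * f x := by
  rw [integral_gaussianReal_eq_integral_smul (by simpa using hv)]
  simp [gaussianPDFReal_eq_phi hv]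

theorem integrable_gauss_iff {v : ℝ} (hv : 0 < v) (f : ℝ → ℝ) :
    Integrable f (gauss v) ↔ Integrable fun x => phi v x * f x := by
  rw [gauss_eq_withDensity hv, integrable_withDensity_iff_integrable_smul']
  · simp [ENNReal.toReal_ofReal (phi_pos hv _).le]
  · exact (continuous_phi v).measurable.ennreal_ofReal
  · simp

theorem integral_phi {v : ℝ} (hv : 0 < v) : ∫ x, phi v x = 1 := by
  rw [← gaussianPDFReal_eq_phi hv]
  exact integral_gaussianPDFReal_eq_one 0 (by simpa using hv)

theorem integrable_phi {v : ℝ} (hv : 0 < v) : Integrable (phi v) := by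
  rw [← gaussianPDFReal_eq_phi hv]
  exact integrable_gaussianPDFReal _ _

theorem hasDerivAt_phi (v x : ℝ) : HasDerivAt (phi v) (-(x / v) * phi v x) x := by
  unfold phi
  have h : HasDerivAt (fun x : ℝ => -x ^ 2 / (2 * v)) (-(x / v)) x := by
    have h1 := ((hasDerivAt_pow 2 x).fun_neg).div_const (2 * v)
    refine h1.congr_deriv ?_
    rcases eq_or_ne v 0 with rfl | hv
    · simp
    · simp; field_simp
  refine (h.exp.const_mul (√(2 * Real.pi * v))⁻¹).congr_deriv ?_
  ring

theorem gauss_eq_map (K : ℝ) (hK : 0 ≤ K) : gauss K = stdGauss.map (fun z => √K * z) := by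
  rw [gaussianReal_map_const_mul, gauss, mul_zero]
  congr 1
  ext
  simp [Real.sq_sqrt hK, hK]

theorem integral_gauss_eq_std {K : ℝ} (hK : 0 ≤ K) {f : ℝ → ℝ} (hf : Measurable f) :
    ∫ x, f x ∂gauss K = ∫ z, f (√K * z) ∂stdGauss := by
  rw [gauss_eq_map K hK, integral_map (by fun_prop) hf.aestronglyMeasurable]

/-- Conjugacy of Gaussian densities: the joint density of `(X, X + Z)` factored as the density
of the sum times the conditional density of `X`. -/
theorem phi_mul_phi {K u : ℝ} (hK : 0 < K) (hu : 0 < u) (x y : ℝ) :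
    phi u (y - x) * phi K x
      = phi (K + u) y * phi (K * u / (K + u)) (x - K / (K + u) * y) := by
  unfold phi
  have hpi := Real.pi_pos
  have hS : 0 < K + u := by positivity
  rw [mul_mul_mul_comm, mul_mul_mul_comm (√(2 * Real.pi * (K + u)))⁻¹, ← Real.exp_add,
    ← Real.exp_add, ← mul_inv, ← mul_inv,
    ← Real.sqrt_mul (by positivity), ← Real.sqrt_mul (by positivity)]
  congr 2
  · congr 1
    field_simp
  · field_simp
    ring

/-- The Ornstein-Uhlenbeck (Mehler) operator with correlation `√c`,
`f ↦ 𝔼 f(√c z + √(1 - c) W)` for a standard Gaussian `W`; used for `0 ≤ c ≤ 1`. -/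
def ou (c : ℝ) (f : ℝ → ℝ) (z : ℝ) : ℝ := ∫ w, f (√c * z + √(1 - c) * w) ∂stdGauss

/-- In standardised coordinates the conditional expectation given `X + Z`, with `X` of variance
`K` and an independent `Z` of variance `u`, is the Ornstein-Uhlenbeck operator `ou (K / (K + u))`.
-/
theorem integral_phi_sub_mul {K u : ℝ} (hK : 0 < K) (hu : 0 < u) {f : ℝ → ℝ}
    (hf : Continuous f) (y : ℝ) :
    ∫ x, phi u (y - x) * f x ∂gauss K
      = phi (K + u) y * ou (K / (K + u)) (fun z => f (√K * z)) (y / √(K + u)) := by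
  have hS : 0 < K + u := by positivity
  have hk : 0 < K * u / (K + u) := by positivity
  rw [integral_gauss hK]
  have h1 : ∀ x, phi K x * (phi u (y - x) * f x)
      = phi (K + u) y * (phi (K * u / (K + u)) (x - K / (K + u) * y) * f x) := fun x => by
    rw [← mul_assoc, ← mul_assoc, ← phi_mul_phi hK hu, mul_comm (phi K x)]
  simp_rw [h1]
  rw [integral_const_mul, ← integral_add_right_eq_self _ (K / (K + u) * y)]
  simp only [add_sub_cancel_right]
  rw [← integral_gauss hk (fun x => f (x + K / (K + u) * y)),
    integral_gauss_eq_std hk.le (by fun_prop)]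
  unfold ou
  congr 1
  refine integral_congr_ae (.of_forall fun w => ?_)
  simp only
  congr 1
  have e1 : 1 - K / (K + u) = u / (K + u) := by field_simp; ring
  have e2 : √K * √(K / (K + u)) * (y / √(K + u)) = K / (K + u) * y := by
    rw [← Real.sqrt_mul hK.le, ← mul_div_assoc K K, Real.sqrt_div (by positivity),
      Real.sqrt_mul_self hK.le, div_mul_div_comm, Real.mul_self_sqrt hS.le, div_mul_eq_mul_div]
  rw [e1, mul_add, ← mul_assoc, ← mul_assoc, e2, ← Real.sqrt_mul hK.le (u / (K + u)),
    mul_div_assoc K u, add_comm]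

theorem integral_phi_sub {K u : ℝ} (hK : 0 < K) (hu : 0 < u) (y : ℝ) :
    ∫ x, phi u (y - x) ∂gauss K = phi (K + u) y := by
  have := integral_phi_sub_mul hK hu (f := fun _ => 1) continuous_const y
  simpa [ou] using this

/-! ### Taylor bounds for the Gaussian density -/

/-- Polynomial growth and a bounded shift of the argument are absorbed by enlarging the variance
by a quarter. The quarter is small enough for `integrable_phi_mul_ratio_cube`. -/
theorem phi_poly_bound {u : ℝ} (hu : 0 < u) (M : ℝ) : ∃ C, 0 < C ∧ ∀ z w : ℝ, |z - w| ≤ M →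
    (1 + w ^ 2) * phi u w ≤ C * phi (5 * u / 4) z := by
  have hpi := Real.pi_pos
  set D := Real.exp (18 * M ^ 2 / (5 * u)) * (1 + 20 * u) with hD
  refine ⟨D * ((√(2 * Real.pi * u))⁻¹ * √(2 * Real.pi * (5 * u / 4))), by positivity,
    fun z w h => ?_⟩
  have hd : (z - w) ^ 2 ≤ M ^ 2 := by
    rw [← sq_abs]; exact pow_le_pow_left₀ (abs_nonneg _) h 2
  have key : (1 + w ^ 2) * Real.exp (-w ^ 2 / (2 * u)) ≤
      D * Real.exp (-z ^ 2 / (2 * (5 * u / 4))) := by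
    have h1 : 1 + w ^ 2 ≤ (1 + 20 * u) * Real.exp (w ^ 2 / (20 * u)) := by
      have a1 := Real.add_one_le_exp (w ^ 2 / (20 * u))
      have a2 : 1 ≤ Real.exp (w ^ 2 / (20 * u)) := Real.one_le_exp (by positivity)
      have a3 : 20 * u * (w ^ 2 / (20 * u)) = w ^ 2 := by field_simp
      nlinarith [Real.exp_pos (w ^ 2 / (20 * u))]
    calc (1 + w ^ 2) * Real.exp (-w ^ 2 / (2 * u))
        ≤ ((1 + 20 * u) * Real.exp (w ^ 2 / (20 * u))) * Real.exp (-w ^ 2 / (2 * u)) := by gcongr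
      _ = (1 + 20 * u) * Real.exp (w ^ 2 / (20 * u) + -w ^ 2 / (2 * u)) := by
          rw [Real.exp_add]; ring
      _ ≤ (1 + 20 * u) *
            Real.exp (18 * M ^ 2 / (5 * u) + -z ^ 2 / (2 * (5 * u / 4))) := by
          refine mul_le_mul_of_nonneg_left (Real.exp_le_exp.2 ?_) (by positivity)
          have e : 18 * M ^ 2 / (5 * u) + -z ^ 2 / (2 * (5 * u / 4))
              - (w ^ 2 / (20 * u) + -w ^ 2 / (2 * u))
              = (18 / 5 * M ^ 2 - 2 / 5 * z ^ 2 + 9 / 20 * w ^ 2) / u := by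
            field_simp; ring
          have : 0 ≤ (18 / 5 * M ^ 2 - 2 / 5 * z ^ 2 + 9 / 20 * w ^ 2) / u := by
            apply div_nonneg _ hu.le
            nlinarith [sq_nonneg (8 * (z - w) - w)]
          linarith
      _ = _ := by rw [Real.exp_add, hD]; ring
  unfold phi
  have hq : 0 < √(2 * Real.pi * (5 * u / 4)) := by positivity
  calc _ = (√(2 * Real.pi * u))⁻¹ * ((1 + w ^ 2) * Real.exp (-w ^ 2 / (2 * u))) := by ring
    _ ≤ (√(2 * Real.pi * u))⁻¹ * (D * Real.exp (-z ^ 2 / (2 * (5 * u / 4)))) := by gcongr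
    _ = _ := by field_simp

/-- First-order Taylor expansion of `phi u` under a bounded shift, with the remainder dominated by a
Gaussian density of slightly larger variance. -/
theorem phi_taylor {u : ℝ} (hu : 0 < u) (M : ℝ) : ∃ C, 0 < C ∧ ∀ z δ : ℝ, |δ| ≤ M →
    |phi u (z - δ) - phi u z - δ * (z / u * phi u z)| ≤ C * δ ^ 2 * phi (5 * u / 4) z ∧
    |z / u * phi u z| ≤ C * phi (5 * u / 4) z := by
  obtain ⟨C, hC, hb⟩ := phi_poly_bound hu M
  refine ⟨C * (1 / u + 1 / u ^ 2), by positivity, fun z δ hδ => ?_⟩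
  have hM : 0 ≤ M := (abs_nonneg _).trans hδ
  have hφ := fun w => phi_pos hu w
  have hdom : ∀ w, |z - w| ≤ M → (1 + w ^ 2) * (1 / u + 1 / u ^ 2) * phi u w
      ≤ C * (1 / u + 1 / u ^ 2) * phi (5 * u / 4) z := fun w hw => by
    have := mul_le_mul_of_nonneg_left (hb z w hw) (by positivity : 0 ≤ 1 / u + 1 / u ^ 2)
    linarith
  constructor
  · set B := C * (1 / u + 1 / u ^ 2) * phi (5 * u / 4) z with hB
    have hd1 : ∀ τ, HasDerivAt (fun τ => z - τ * δ) (-δ) τ := fun τ => by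
      simpa using ((hasDerivAt_id τ).mul_const δ).const_sub z
    have hk : ∀ τ, HasDerivAt (fun τ => phi u (z - τ * δ))
        (δ * ((z - τ * δ) / u * phi u (z - τ * δ))) τ := fun τ =>
      (HasDerivAt.comp (h₂ := phi u) τ (hasDerivAt_phi u (z - τ * δ)) (hd1 τ)).congr_deriv (by ring)
    have hk2 : ∀ τ, HasDerivAt (fun τ => (z - τ * δ) / u * phi u (z - τ * δ))
        (δ * (((z - τ * δ) ^ 2 / u ^ 2 - 1 / u) * phi u (z - τ * δ))) τ := fun τ =>
      (((hd1 τ).div_const u).mul (hk τ)).congr_deriv (by field_simp; ring)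
    have hbd : ∀ τ ∈ Set.Icc (0:ℝ) 1,
        |(z - τ * δ) / u * phi u (z - τ * δ) - z / u * phi u z| ≤ |δ| * B := by
      intro τ hτ
      have h2 := norm_image_sub_le_of_norm_deriv_le_segment' (a := 0) (b := τ) (C := |δ| * B)
        (f := fun τ => (z - τ * δ) / u * phi u (z - τ * δ)) (fun x _ => (hk2 x).hasDerivWithinAt)
        (fun x hx => ?_) τ ⟨hτ.1, le_rfl⟩
      · simp only [zero_mul, sub_zero, Real.norm_eq_abs] at h2
        refine h2.trans ?_
        have : 0 ≤ |δ| * B := by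
          have := phi_pos (v := 5 * u / 4) (by positivity) z
          positivity
        nlinarith [hτ.2]
      · rw [norm_mul, Real.norm_eq_abs, Real.norm_eq_abs]
        gcongr
        rw [hB]
        refine le_trans ?_ (hdom (z - x * δ) ?_)
        · rw [abs_mul, abs_of_pos (hφ _)]
          refine mul_le_mul_of_nonneg_right ?_ (hφ _).le
          generalize z - x * δ = w
          have p1 : 0 ≤ w ^ 2 / u ^ 2 := by positivity
          have p2 : 0 ≤ 1 / u := by positivity
          have p3 : 0 ≤ w ^ 2 * (1 / u) := by positivity
          have p4 : 0 ≤ 1 / u ^ 2 := by positivity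
          have p5 : (1 + w ^ 2) * (1 / u + 1 / u ^ 2)
            = 1 / u + w ^ 2 * (1 / u) + 1 / u ^ 2 + w ^ 2 / u ^ 2 := by ring
          rw [p5, abs_le]
          constructor <;> linarith
        · rw [sub_sub_cancel, abs_mul, abs_of_nonneg hx.1]
          have : x ≤ 1 := hx.2.le.trans hτ.2
          nlinarith [abs_nonneg δ]
    have h3 := norm_image_sub_le_of_norm_deriv_le_segment_01' (C := |δ| * (|δ| * B))
      (f := fun τ => phi u (z - τ * δ) - τ * (δ * (z / u * phi u z)))
      (f' := fun τ => δ * ((z - τ * δ) / u * phi u (z - τ * δ)) - δ * (z / u * phi u z))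
      (fun x _ => ((hk x).sub ((hasDerivAt_id x).mul_const _)).hasDerivWithinAt.congr_deriv
        (by simp))
      (fun x hx => by
        rw [← mul_sub, norm_mul, Real.norm_eq_abs, Real.norm_eq_abs]
        gcongr
        exact hbd x ⟨hx.1, hx.2.le⟩)
    simp only [one_mul, zero_mul, sub_zero, Real.norm_eq_abs] at h3
    rw [sub_right_comm]
    refine h3.trans (le_of_eq ?_)
    rw [← mul_assoc, abs_mul_abs_self, hB]
    ring
  · refine le_trans ?_ (hdom z (by simpa using hM))
    rw [abs_mul, abs_of_pos (hφ z), abs_div, abs_of_pos hu]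
    have h1 : |z| ≤ 1 + z ^ 2 := by nlinarith [abs_nonneg z, sq_abs z, sq_nonneg (|z| - 1)]
    have h2 : 0 ≤ (1 + z ^ 2) * (1 / u ^ 2) := by positivity
    have h3 : |z| / u ≤ (1 + z ^ 2) / u := by gcongr
    refine mul_le_mul_of_nonneg_right ?_ (hφ z).le
    rw [mul_add, mul_one_div]
    linarith

/-! ### Laws smoothed by a Gaussian, and their entropy -/

section Smooth

variable {Ω : Type*} [MeasurableSpace Ω]

/-- The density of `Y + Z` with `Z` an independent centred Gaussian of variance `u`. -/
def smoothDens (P : Measure Ω) (u : ℝ) (Y : Ω → ℝ) (y : ℝ) : ℝ := ∫ ω, phi u (y - Y ω) ∂P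

theorem phi_le {u : ℝ} (hu : 0 < u) (x : ℝ) : phi u x ≤ (√(2 * Real.pi * u))⁻¹ := by
  unfold phi
  refine mul_le_of_le_one_right (by positivity) (Real.exp_le_one_iff.2 ?_)
  rw [neg_div]
  exact neg_nonpos.2 (by positivity)

theorem integrable_phi_sub (P : Measure Ω) [IsProbabilityMeasure P] {u : ℝ} (hu : 0 < u)
    {Y : Ω → ℝ} (hY : Measurable Y) (y : ℝ) : Integrable (fun ω => phi u (y - Y ω)) P := by
  refine Integrable.of_bound (C := (√(2 * Real.pi * u))⁻¹)
    ((continuous_phi u).measurable.comp (by fun_prop)).aestronglyMeasurable (.of_forall fun ω => ?_)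
  rw [Real.norm_eq_abs, abs_of_pos (phi_pos hu _)]
  exact phi_le hu _

theorem measurable_smoothDens (P : Measure Ω) [IsProbabilityMeasure P] (u : ℝ)
    {Y : Ω → ℝ} (hY : Measurable Y) : Measurable (smoothDens P u Y) := by
  have : StronglyMeasurable fun p : ℝ × Ω => phi u (p.1 - Y p.2) :=
    ((continuous_phi u).measurable.comp (by fun_prop)).stronglyMeasurable
  exact this.integral_prod_right'.measurable

theorem smoothDens_nonneg (P : Measure Ω) {u : ℝ} (hu : 0 < u) (Y : Ω → ℝ) (y : ℝ) :
    0 ≤ smoothDens P u Y y :=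
  integral_nonneg fun _ => (phi_pos hu _).le

theorem conv_gauss_eq_withDensity (P : Measure Ω) [IsProbabilityMeasure P] {u : ℝ} (hu : 0 < u)
    {Y : Ω → ℝ} (hY : Measurable Y) :
    (P.map Y).conv (gauss u)
      = volume.withDensity fun y => ENNReal.ofReal (smoothDens P u Y y) := by
  have hm := (continuous_phi u).measurable
  refine Measure.ext_of_lintegral _ fun f hf => ?_
  have : IsProbabilityMeasure (P.map Y) := Measure.isProbabilityMeasure_map hY.aemeasurable
  rw [Measure.lintegral_conv hf, lintegral_map (by fun_prop) hY,
    lintegral_withDensity_eq_lintegral_mul _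
      (measurable_smoothDens P u hY).ennreal_ofReal hf, gauss_eq_withDensity hu]
  have e1 : ∀ ω, ∫⁻ z, f (Y ω + z) ∂(volume.withDensity fun x => ENNReal.ofReal (phi u x))
      = ∫⁻ y, ENNReal.ofReal (phi u (y - Y ω)) * f y := fun ω => by
    rw [lintegral_withDensity_eq_lintegral_mul _ hm.ennreal_ofReal (by fun_prop)]
    conv_rhs => rw [← lintegral_add_left_eq_self _ (Y ω)]
    simp
  simp_rw [e1]
  rw [lintegral_lintegral_swap]
  · refine lintegral_congr fun y => ?_
    have hmy : Measurable fun ω => ENNReal.ofReal (phi u (y - Y ω)) :=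
      (hm.comp (by fun_prop : Measurable fun ω => y - Y ω)).ennreal_ofReal
    rw [lintegral_mul_const _ hmy, Pi.mul_apply, smoothDens,
      ofReal_integral_eq_lintegral_ofReal (integrable_phi_sub P hu hY y)
        (.of_forall fun _ => (phi_pos hu _).le)]
  · exact ((hm.comp (by fun_prop)).ennreal_ofReal.mul (by fun_prop)).aemeasurable

theorem rnDeriv_withDensity_ofReal {ρ : ℝ → ℝ} (hρ : Measurable ρ) (h0 : ∀ x, 0 ≤ ρ x) :
    (fun x => Real.negMulLog
      ((volume.withDensity fun x => ENNReal.ofReal (ρ x)).rnDeriv volume x).toReal)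
      =ᵐ[volume] fun x => Real.negMulLog (ρ x) := by
  filter_upwards [Measure.rnDeriv_withDensity volume hρ.ennreal_ofReal] with x hx
  rw [hx, ENNReal.toReal_ofReal (h0 x)]

theorem diffEntropy_withDensity {ρ : ℝ → ℝ} (hρ : Measurable ρ) (h0 : ∀ x, 0 ≤ ρ x) :
    diffEntropy (volume.withDensity fun x => ENNReal.ofReal (ρ x))
      = ∫ x, Real.negMulLog (ρ x) :=
  integral_congr_ae (rnDeriv_withDensity_ofReal hρ h0)

theorem finiteEntropy_withDensity_iff {ρ : ℝ → ℝ} (hρ : Measurable ρ) (h0 : ∀ x, 0 ≤ ρ x) :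
    FiniteEntropy (volume.withDensity fun x => ENNReal.ofReal (ρ x))
      ↔ Integrable fun x => Real.negMulLog (ρ x) :=
  integrable_congr (rnDeriv_withDensity_ofReal hρ h0)

/-- The second-order Taylor bound for `x log x` at `1`, valid on the whole half-line. -/
theorem abs_klFun_sub_le {x : ℝ} (hx : 0 ≤ x) :
    |InformationTheory.klFun x - (x - 1) ^ 2 / 2| ≤ |x - 1| ^ 3 := by
  rw [InformationTheory.klFun_apply]
  rcases hx.eq_or_lt with rfl | hx
  · norm_num
  have hs : Real.sinh (Real.log x) = (x - x⁻¹) / 2 := Real.sinh_log hx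
  have hxx : x * x⁻¹ = 1 := mul_inv_cancel₀ hx.ne'
  rcases le_total 1 x with h | h
  · rw [abs_of_nonneg (sub_nonneg.2 h)]
    have h1 : Real.log x ≤ (x - x⁻¹) / 2 :=
      hs ▸ Real.self_le_sinh_iff.2 (Real.log_nonneg h)
    have h2 := Real.le_log_one_add_of_nonneg (sub_nonneg.2 h)
    rw [add_sub_cancel, show x - 1 + 2 = x + 1 by ring, div_le_iff₀ (by linarith)] at h2
    rw [abs_le]
    constructor
    · have hp : 0 ≤ (x - 1) ^ 3 := pow_nonneg (sub_nonneg.2 h) 3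
      have : 0 ≤ (x + 1) * (x * Real.log x + 1 - x - (x - 1) ^ 2 / 2 + (x - 1) ^ 3) := by
        nlinarith [mul_le_mul_of_nonneg_left h2 hx.le, pow_nonneg (sub_nonneg.2 h) 4]
      linarith [nonneg_of_mul_nonneg_right this (by linarith : 0 < x + 1)]
    · nlinarith [mul_le_mul_of_nonneg_left h1 hx.le, pow_nonneg (sub_nonneg.2 h) 3]
  · rw [abs_of_nonpos (sub_nonpos.2 h)]
    have hy : 0 ≤ x⁻¹ - 1 := sub_nonneg.2 ((one_le_inv₀ hx).2 h)
    have h1 : (x - x⁻¹) / 2 ≤ Real.log x :=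
      hs ▸ Real.sinh_le_self_iff.2 (Real.log_nonpos hx.le h)
    have h2 := Real.le_log_one_add_of_nonneg hy
    rw [add_sub_cancel, Real.log_inv, show x⁻¹ - 1 + 2 = x⁻¹ + 1 by ring,
      div_le_iff₀ (by positivity)] at h2
    have h3 : 2 * (1 - x) ≤ -Real.log x * (1 + x) := by
      have := mul_le_mul_of_nonneg_left h2 hx.le
      nlinarith
    rw [abs_le]
    have hp : 0 ≤ (1 - x) ^ 3 := pow_nonneg (sub_nonneg.2 h) 3
    constructor
    · nlinarith [mul_le_mul_of_nonneg_left h1 hx.le]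
    · have : 0 ≤ (1 + x) * ((-(x - 1)) ^ 3 - (x * Real.log x + 1 - x - (x - 1) ^ 2 / 2)) := by
        nlinarith [mul_le_mul_of_nonneg_left h3 hx.le, mul_nonneg hp hx.le]
      linarith [nonneg_of_mul_nonneg_right this (by linarith : 0 < 1 + x)]

/-- Pointwise form of the second-order expansion of the relative entropy. Here `d` is the relative
perturbation of the density, `g` its linear response, `k = klFun (1 + d)`, and `G` the ratio of
Gaussian densities that dominates both errors. -/
theorem second_order_remainder {k d g t G a b : ℝ} (hG : 0 ≤ G) (ha : 0 ≤ a) (hb : 0 ≤ b)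
    (ht : |t| ≤ 1) (hd : |d - t * g| ≤ a * t ^ 2 * G) (hg : |g| ≤ b * G)
    (hk : |k - d ^ 2 / 2| ≤ |d| ^ 3) :
    |k - t ^ 2 / 2 * g ^ 2| ≤ (a * (a + 2 * b) + (a + b) ^ 3) * |t| ^ 3 * (1 + G ^ 3) := by
  have ht0 := abs_nonneg t
  have htt : t ^ 2 = |t| ^ 2 := (sq_abs t).symm
  have ht2 : t ^ 2 ≤ |t| := by rw [htt]; nlinarith
  have hd' : |d - t * g| ≤ a * |t| * G := hd.trans (by gcongr)
  have htg : |t * g| ≤ |t| * (b * G) := by rw [abs_mul]; gcongr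
  have hd1 : |d| ≤ |t| * ((a + b) * G) := by
    calc |d| = |(d - t * g) + t * g| := by ring_nf
      _ ≤ _ := (abs_add_le _ _).trans (by linarith)
  have hd2 : |d + t * g| ≤ |t| * ((a + 2 * b) * G) := by
    calc |d + t * g| = |d + t * g| := rfl
      _ ≤ _ := (abs_add_le _ _).trans (by linarith)
  have h1 : |d ^ 2 / 2 - t ^ 2 / 2 * g ^ 2| ≤ a * (a + 2 * b) * |t| ^ 3 * G ^ 2 := by
    have : d ^ 2 / 2 - t ^ 2 / 2 * g ^ 2 = (d - t * g) * (d + t * g) / 2 := by ring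
    rw [this, abs_div, abs_mul, abs_of_pos (by norm_num : (0:ℝ) < 2)]
    have := mul_le_mul hd hd2 (abs_nonneg _) (by positivity)
    have e : a * t ^ 2 * G * (|t| * ((a + 2 * b) * G)) = a * (a + 2 * b) * |t| ^ 3 * G ^ 2 := by
      rw [htt]; ring
    have : 0 ≤ a * (a + 2 * b) * |t| ^ 3 * G ^ 2 := by positivity
    linarith
  have h2 : |d| ^ 3 ≤ (a + b) ^ 3 * |t| ^ 3 * G ^ 3 := by
    calc |d| ^ 3 ≤ (|t| * ((a + b) * G)) ^ 3 := pow_le_pow_left₀ (abs_nonneg _) hd1 3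
      _ = _ := by ring
  have h3 : G ^ 2 ≤ 1 + G ^ 3 := by nlinarith [mul_nonneg hG (sq_nonneg (G - 1)), sq_nonneg (G - 1)]
  calc |k - t ^ 2 / 2 * g ^ 2|
      = |(k - d ^ 2 / 2) + (d ^ 2 / 2 - t ^ 2 / 2 * g ^ 2)| := by ring_nf
    _ ≤ (a + b) ^ 3 * |t| ^ 3 * G ^ 3 + a * (a + 2 * b) * |t| ^ 3 * G ^ 2 :=
        (abs_add_le _ _).trans (by linarith)
    _ ≤ (a + b) ^ 3 * |t| ^ 3 * (1 + G ^ 3) + a * (a + 2 * b) * |t| ^ 3 * (1 + G ^ 3) := by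
        gcongr; linarith
    _ = _ := by ring

/-- The exponent `3 / (2 (v + 5u/4)) - 1 / (v + u)` of the product is positive, so the cube of the
ratio of the two densities is integrable against the narrower one. -/
theorem integrable_phi_mul_ratio_cube {v u : ℝ} (hv : 0 < v) (hu : 0 < u) :
    Integrable fun y => phi (v + u) y * (1 + (phi (v + 5 * u / 4) y / phi (v + u) y) ^ 3) := by
  have hpi := Real.pi_pos
  have hS : 0 < v + u := by positivity
  have hS' : 0 < v + 5 * u / 4 := by positivity
  simp_rw [mul_add, mul_one]
  refine (integrable_phi hS).add ?_
  have hpos : 0 < 3 / (2 * (v + 5 * u / 4)) - 1 / (v + u) := by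
    rw [sub_pos, div_lt_div_iff₀ hS (by positivity)]; nlinarith
  have h := (integrable_exp_neg_mul_sq hpos).const_mul
    ((√(2 * Real.pi * (v + 5 * u / 4)))⁻¹ ^ 3 / (√(2 * Real.pi * (v + u)))⁻¹ ^ 2)
  refine h.congr (.of_forall fun y => ?_)
  have e : Real.exp (-(3 / (2 * (v + 5 * u / 4)) - 1 / (v + u)) * y ^ 2)
      = Real.exp (-y ^ 2 / (2 * (v + 5 * u / 4))) ^ 3 / Real.exp (-y ^ 2 / (2 * (v + u))) ^ 2 := by
    rw [← Real.exp_nat_mul, ← Real.exp_nat_mul, ← Real.exp_sub]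
    congr 1
    push_cast
    field_simp
    ring
  simp only [e, phi]
  have := Real.exp_pos (-y ^ 2 / (2 * (v + u)))
  field_simp

theorem negMulLog_density {S ρ y : ℝ} (hS : 0 < S) :
    Real.negMulLog ρ = ρ * (Real.log (2 * Real.pi * S) / 2) + ρ * y ^ 2 / (2 * S)
      - phi S y * InformationTheory.klFun (ρ / phi S y) - ρ + phi S y := by
  have hp := phi_pos hS y
  have hlog : Real.log (phi S y) = -(Real.log (2 * Real.pi * S) / 2) - y ^ 2 / (2 * S) := by
    have hpi := Real.pi_pos
    rw [phi, Real.log_mul (by positivity) (Real.exp_ne_zero _), Real.log_exp, Real.log_inv,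
      Real.log_sqrt (by positivity)]
    ring
  have h : ρ = phi S y * (ρ / phi S y) := by field_simp
  conv_lhs => rw [h]
  rw [Real.negMulLog_mul, Real.negMulLog, Real.negMulLog, hlog, InformationTheory.klFun_apply]
  field_simp
  ring

theorem integrable_sq_of_map_eq_gauss {P : Measure Ω} {A : Ω → ℝ} (hA : Measurable A) {v : ℝ}
    (h : P.map A = gauss v) : MemLp A 2 P := by
  have h2 : MemLp id 2 (P.map A) := by
    rw [h]; exact memLp_id_gaussianReal' 2 (by simp)
  exact (memLp_map_measure_iff h2.1 hA.aemeasurable).1 h2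

/-- Zeroth and second moments of a smoothed law, in terms of its density. -/
theorem smoothDens_moments (P : Measure Ω) [IsProbabilityMeasure P] {u : ℝ} (hu : 0 < u)
    {Y : Ω → ℝ} (hY : Measurable Y) (hY2 : MemLp Y 2 P) :
    (Integrable (smoothDens P u Y) ∧ ∫ y, smoothDens P u Y y = 1) ∧
    (Integrable (fun y => smoothDens P u Y y * y ^ 2) ∧
      ∫ y, smoothDens P u Y y * y ^ 2 = (∫ ω, Y ω ^ 2 ∂P) + u) := by
  have hm := measurable_smoothDens P u hY
  have h0 := smoothDens_nonneg P hu Y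
  have : IsProbabilityMeasure (P.map Y) := Measure.isProbabilityMeasure_map hY.aemeasurable
  have hint : ∀ f : ℝ → ℝ, Integrable f ((P.map Y).conv (gauss u)) ↔
      Integrable fun y => smoothDens P u Y y * f y := fun f => by
    rw [conv_gauss_eq_withDensity P hu hY, integrable_withDensity_iff_integrable_smul'
      hm.ennreal_ofReal (by simp)]
    simp [ENNReal.toReal_ofReal (h0 _)]
  have hval : ∀ f : ℝ → ℝ, ∫ y, f y ∂((P.map Y).conv (gauss u)) =
      ∫ y, smoothDens P u Y y * f y := fun f => by
    rw [conv_gauss_eq_withDensity P hu hY, integral_withDensity_eq_integral_toReal_smul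
      hm.ennreal_ofReal (by simp)]
    simp [ENNReal.toReal_ofReal (h0 _)]
  refine ⟨⟨?_, ?_⟩, ?_⟩
  · simpa using (hint fun _ => 1).1 (integrable_const _)
  · simpa using (hval fun _ => 1).symm
  have hconv : (P.map Y).conv (gauss u) = (P.prod (gauss u)).map (fun p => Y p.1 + p.2) := by
    conv_lhs => rw [Measure.conv, ← Measure.map_id (μ := gauss u)]
    rw [Measure.map_prod_map _ _ hY measurable_id,
      Measure.map_map (by fun_prop) (hY.prodMap measurable_id)]
    rfl
  have hz2 : MemLp id 2 (gauss u) := memLp_id_gaussianReal' 2 (by simp)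
  have i1 : Integrable (fun p : Ω × ℝ => Y p.1 ^ 2) (P.prod (gauss u)) :=
    hY2.integrable_sq.comp_fst _
  have i2 : Integrable (fun p : Ω × ℝ => Y p.1 * p.2) (P.prod (gauss u)) :=
    (hY2.integrable (by norm_num)).mul_prod (hz2.integrable (by norm_num))
  have i3 : Integrable (fun p : Ω × ℝ => p.2 ^ 2) (P.prod (gauss u)) :=
    hz2.integrable_sq.comp_snd _
  have i4 : Integrable (fun p : Ω × ℝ => (Y p.1 + p.2) ^ 2) (P.prod (gauss u)) := by
    refine ((i1.add (i2.const_mul 2)).add i3).congr (.of_forall fun p => ?_)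
    simp only [Pi.add_apply]
    ring
  have hgm : Measurable fun p : Ω × ℝ => Y p.1 + p.2 := by fun_prop
  have hsq : AEStronglyMeasurable (fun y : ℝ => y ^ 2)
      ((P.prod (gauss u)).map fun p => Y p.1 + p.2) := by fun_prop
  refine ⟨?_, ?_⟩
  · rw [← hint, hconv, integrable_map_measure hsq hgm.aemeasurable]
    exact i4
  · rw [← hval, hconv, integral_map hgm.aemeasurable hsq]
    have e : ∀ p : Ω × ℝ, (Y p.1 + p.2) ^ 2 = Y p.1 ^ 2 + 2 * (Y p.1 * p.2) + p.2 ^ 2 :=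
      fun p => by ring
    simp_rw [e]
    rw [integral_add (i1.fun_add (i2.const_mul 2)) i3, integral_add i1 (i2.const_mul 2),
      integral_const_mul, integral_prod_mul (f := Y) (g := fun z : ℝ => z),
      integral_fun_fst (f := fun ω => Y ω ^ 2), integral_fun_snd (f := fun z : ℝ => z ^ 2)]
    have hmean : ∫ z, z ∂gauss u = 0 := integral_id_gaussianReal
    have hvar : ∫ z, z ^ 2 ∂gauss u = u := by
      have := variance_fun_id_gaussianReal (μ := 0) (v := u.toNNReal)
      rw [variance_of_integral_eq_zero (by fun_prop) integral_id_gaussianReal] at this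
      simpa [hu.le] using this
    simp [hmean, hvar]

/-- The linear response of the density of `A + t B + Z` at `t = 0`, for `Z` of variance `u`. -/
def densResponse (P : Measure Ω) (u : ℝ) (A B : Ω → ℝ) (y : ℝ) : ℝ :=
  ∫ ω, (y - A ω) / u * phi u (y - A ω) * B ω ∂P

/-- First-order expansion of the density of `A + t B + Z`. The constant depends only on `v`, `u` and
the bound `M` on `B`. -/
theorem smoothDens_taylor {v u : ℝ} (hv : 0 < v) (hu : 0 < u) (M : ℝ) (hM : 0 ≤ M) :
    ∃ C, 0 < C ∧ ∀ (P : Measure Ω) [IsProbabilityMeasure P] (A B : Ω → ℝ),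
      Measurable A → Measurable B → P.map A = gauss v → (∀ ω, |B ω| ≤ M) → ∀ t y : ℝ, |t| ≤ 1 →
      |smoothDens P u (fun ω => A ω + t * B ω) y - phi (v + u) y - t * densResponse P u A B y|
        ≤ C * t ^ 2 * phi (v + 5 * u / 4) y ∧
      |densResponse P u A B y| ≤ C * phi (v + 5 * u / 4) y := by
  obtain ⟨C, hC, hb⟩ := phi_taylor hu M
  refine ⟨C * M ^ 2 + C * M + 1, by positivity, fun P _ A B hA hB hAv hBM t y ht => ?_⟩
  have hu' : 0 < 5 * u / 4 := by positivity
  have hgen : ∀ w : ℝ, 0 < w → ∫ ω, phi w (y - A ω) ∂P = phi (v + w) y := fun w hw => by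
    rw [← integral_phi_sub hv hw, ← hAv, integral_map hA.aemeasurable]
    exact ((continuous_phi w).comp (by fun_prop)).aestronglyMeasurable
  have hS' := hgen _ hu'
  have hp' := phi_pos (v := v + 5 * u / 4) (by positivity) y
  have iA := integrable_phi_sub P hu hA y
  have iA' := integrable_phi_sub P hu' hA y
  have iY := integrable_phi_sub P hu (Y := fun ω => A ω + t * B ω) (by fun_prop) y
  have hbn : ∀ ω, |(y - A ω) / u * phi u (y - A ω) * B ω| ≤ C * M * phi (5 * u / 4) (y - A ω) :=
    fun ω => by
      rw [abs_mul]
      have := mul_le_mul (hb (y - A ω) 0 (by simpa using hM)).2 (hBM ω) (abs_nonneg _)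
        (mul_nonneg hC.le (phi_pos hu' _).le)
      linarith
  have hphim := (continuous_phi u).measurable.comp (by fun_prop : Measurable fun ω => y - A ω)
  have inn : Integrable (fun ω => (y - A ω) / u * phi u (y - A ω) * B ω) P := by
    refine (iA'.const_mul (C * M)).mono' ?_ (.of_forall hbn)
    refine Measurable.aestronglyMeasurable ?_
    exact (((measurable_const.sub hA).div_const u).mul hphim).mul hB
  constructor
  · rw [smoothDens, ← hgen u hu, densResponse, ← integral_const_mul, ← integral_sub iY iA,
      ← integral_sub (integrable_fun_sub iY iA) (inn.const_mul t)]
    rw [← Real.norm_eq_abs]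
    refine (norm_integral_le_of_norm_le (iA'.const_mul (C * M ^ 2 * t ^ 2))
      (.of_forall fun ω => ?_)).trans ?_
    · have hδ : |t * B ω| ≤ M := by
        rw [abs_mul]; nlinarith [hBM ω, abs_nonneg (B ω), abs_nonneg t]
      have h1 := (hb (y - A ω) (t * B ω) hδ).1
      rw [sub_sub] at h1
      have e : t * B ω * ((y - A ω) / u * phi u (y - A ω))
        = t * ((y - A ω) / u * phi u (y - A ω) * B ω) := by ring
      rw [e] at h1
      rw [Real.norm_eq_abs, sub_sub, ← sub_sub y]
      refine h1.trans ?_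
      have hB2 : B ω ^ 2 ≤ M ^ 2 := by
        rw [← sq_abs]; exact pow_le_pow_left₀ (abs_nonneg _) (hBM ω) 2
      refine mul_le_mul_of_nonneg_right ?_ (phi_pos hu' _).le
      rw [mul_pow]
      have := mul_le_mul_of_nonneg_left hB2 (by positivity : 0 ≤ C * t ^ 2)
      linarith
    · rw [integral_const_mul, hS']
      refine mul_le_mul_of_nonneg_right ?_ hp'.le
      refine mul_le_mul_of_nonneg_right ?_ (sq_nonneg t)
      have : 0 ≤ C * M := by positivity
      linarith
  · rw [densResponse, ← Real.norm_eq_abs]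
    refine (norm_integral_le_of_norm_le (iA'.const_mul (C * M)) (.of_forall fun ω =>
      (Real.norm_eq_abs _).trans_le (hbn ω))).trans ?_
    rw [integral_const_mul, hS']
    refine mul_le_mul_of_nonneg_right ?_ hp'.le
    have : 0 ≤ C * M ^ 2 := by positivity
    linarith

theorem measurable_densResponse (P : Measure Ω) [IsProbabilityMeasure P] (u : ℝ)
    {A B : Ω → ℝ} (hA : Measurable A) (hB : Measurable B) :
    Measurable (densResponse P u A B) := by
  have : StronglyMeasurable fun p : ℝ × Ω => (p.1 - A p.2) / u * phi u (p.1 - A p.2) * B p.2 := by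
    have h := (continuous_phi u).measurable.comp
      (by fun_prop : Measurable fun p : ℝ × Ω => p.1 - A p.2)
    exact ((Measurable.mul (by fun_prop) h).mul (by fun_prop)).stronglyMeasurable
  exact this.integral_prod_right'.measurable

/-- Second-order expansion of the entropy along `A + t B + Z`, with `A` Gaussian of variance `v`,
`B` bounded by `M` and `Z` an independent Gaussian of variance `u`. The entropy equals the Gaussian
cross-entropy, which only sees the second moment, minus the relative entropy to the Gaussian,
which is quadratic in the perturbation of the density. The remainder is uniform over `B`. -/
theorem entropy_expansion {v u : ℝ} (hv : 0 < v) (hu : 0 < u) (M : ℝ) (hM : 0 ≤ M) :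
    ∃ C, 0 < C ∧ ∀ (P : Measure Ω) [IsProbabilityMeasure P] (A B : Ω → ℝ),
      Measurable A → Measurable B → P.map A = gauss v → (∀ ω, |B ω| ≤ M) → ∀ t : ℝ, |t| ≤ 1 →
      |diffEntropy ((P.map fun ω => A ω + t * B ω).conv (gauss u))
        - (Real.log (2 * Real.pi * (v + u)) / 2
          + ((∫ ω, (A ω + t * B ω) ^ 2 ∂P) + u) / (2 * (v + u))
          - t ^ 2 / 2 * ∫ y, (densResponse P u A B y / phi (v + u) y) ^ 2 ∂gauss (v + u))|
        ≤ C * |t| ^ 3 := by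
  obtain ⟨C, hC, hb⟩ := smoothDens_taylor (Ω := Ω) hv hu M hM
  have hS : 0 < v + u := by positivity
  have hS' : 0 < v + 5 * u / 4 := by positivity
  set W : ℝ → ℝ := fun y => phi (v + u) y * (1 + (phi (v + 5 * u / 4) y / phi (v + u) y) ^ 3)
    with hW
  have hWi : Integrable W := integrable_phi_mul_ratio_cube hv hu
  have hW0 : 0 ≤ ∫ y, W y := integral_nonneg fun y => by
    have := phi_pos hS y; have := phi_pos hS' y; simp only [hW, Pi.zero_apply]; positivity
  set D := C * (C + 2 * C) + (C + C) ^ 3 with hD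
  have hD0 : 0 < D := by positivity
  refine ⟨D * ((∫ y, W y) + 1), by positivity, fun P _ A B hA hB hAv hBM t ht => ?_⟩
  have hY : Measurable fun ω => A ω + t * B ω := by fun_prop
  have hA2 : MemLp A 2 P := integrable_sq_of_map_eq_gauss hA hAv
  have hB2 : MemLp B 2 P := MemLp.of_bound hB.aestronglyMeasurable M (.of_forall hBM)
  have hY2 : MemLp (fun ω => A ω + t * B ω) 2 P := hA2.add (hB2.const_mul t)
  obtain ⟨⟨m0, m0'⟩, m2, m2'⟩ := smoothDens_moments P hu hY hY2
  rw [conv_gauss_eq_withDensity P hu hY, diffEntropy_withDensity (measurable_smoothDens P u hY)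
    (smoothDens_nonneg P hu _)]
  set ρ := smoothDens P u (fun ω => A ω + t * B ω) with hρ
  set g : ℝ → ℝ := fun y => densResponse P u A B y / phi (v + u) y with hg
  have hρm : Measurable ρ := measurable_smoothDens P u hY
  have hgm : Measurable g :=
    (measurable_densResponse P u hA hB).div (continuous_phi _).measurable
  have hgb : ∀ y, |g y| ≤ C * (phi (v + 5 * u / 4) y / phi (v + u) y) := fun y => by
    have hp := phi_pos hS y
    have := (hb P A B hA hB hAv hBM t y ht).2
    rw [hg, abs_div, abs_of_pos hp, ← mul_div_assoc]
    gcongr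
  have hpt : ∀ y, |phi (v + u) y * InformationTheory.klFun (ρ y / phi (v + u) y)
      - t ^ 2 / 2 * (phi (v + u) y * g y ^ 2)| ≤ D * |t| ^ 3 * W y := fun y => by
    have hp := phi_pos hS y
    have hp' := phi_pos hS' y
    have h1 := (hb P A B hA hB hAv hBM t y ht).1
    have h3 := second_order_remainder (G := phi (v + 5 * u / 4) y / phi (v + u) y) (a := C) (b := C)
      (d := ρ y / phi (v + u) y - 1) (g := g y) (by positivity) hC.le hC.le ht ?_ (hgb y)
      (abs_klFun_sub_le (div_nonneg (smoothDens_nonneg P hu _ y) hp.le))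
    · calc _ = phi (v + u) y * |InformationTheory.klFun (ρ y / phi (v + u) y)
            - t ^ 2 / 2 * g y ^ 2| := by
            rw [← abs_of_pos hp, ← abs_mul, abs_of_pos hp]; ring_nf
        _ ≤ phi (v + u) y * (D * |t| ^ 3 *
            (1 + (phi (v + 5 * u / 4) y / phi (v + u) y) ^ 3)) := by gcongr
        _ = _ := by rw [hW]; ring
    · have e : ρ y / phi (v + u) y - 1 - t * g y
        = (ρ y - phi (v + u) y - t * densResponse P u A B y) / phi (v + u) y := by
        rw [hg]; field_simp
      rw [e, abs_div, abs_of_pos hp, div_le_iff₀ hp]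
      refine h1.trans (le_of_eq ?_)
      field_simp
  have hgi : Integrable fun y => phi (v + u) y * g y ^ 2 := by
    refine (hWi.const_mul (C ^ 2)).mono'
      (((continuous_phi _).measurable.mul (hgm.pow_const 2)).aestronglyMeasurable)
      (.of_forall fun y => ?_)
    have hp := phi_pos hS y
    have hp' := phi_pos hS' y
    set G := phi (v + 5 * u / 4) y / phi (v + u) y with hG
    have hG0 : 0 ≤ G := by positivity
    rw [Real.norm_eq_abs, abs_of_nonneg (by positivity)]
    have h1 : g y ^ 2 ≤ (C * G) ^ 2 := by
      rw [← sq_abs]; exact pow_le_pow_left₀ (abs_nonneg _) (hgb y) 2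
    have h3 : G ^ 2 ≤ 1 + G ^ 3 := by
      nlinarith [mul_nonneg hG0 (sq_nonneg (G - 1)), sq_nonneg (G - 1)]
    calc phi (v + u) y * g y ^ 2 ≤ phi (v + u) y * (C ^ 2 * (1 + G ^ 3)) := by
          gcongr
          rw [mul_pow] at h1
          exact h1.trans (by gcongr)
      _ = C ^ 2 * W y := by simp only [hW, ← hG]; ring
  have hkm : Measurable fun y =>
      phi (v + u) y * InformationTheory.klFun (ρ y / phi (v + u) y) :=
    (continuous_phi _).measurable.mul
      (InformationTheory.measurable_klFun.comp (hρm.div (continuous_phi _).measurable))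
  have hdi : Integrable fun y => phi (v + u) y * InformationTheory.klFun (ρ y / phi (v + u) y)
      - t ^ 2 / 2 * (phi (v + u) y * g y ^ 2) :=
    (hWi.const_mul (D * |t| ^ 3)).mono'
      (hkm.aestronglyMeasurable.sub (hgi.const_mul _).aestronglyMeasurable) (.of_forall hpt)
  have hki : Integrable fun y =>
      phi (v + u) y * InformationTheory.klFun (ρ y / phi (v + u) y) := by
    refine (hdi.add (hgi.const_mul (t ^ 2 / 2))).congr (.of_forall fun y => ?_)
    simp
  -- entropy is Gaussian cross-entropy minus relative entropy
  have hent : ∫ y, Real.negMulLog (ρ y) = Real.log (2 * Real.pi * (v + u)) / 2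
      + ((∫ ω, (A ω + t * B ω) ^ 2 ∂P) + u) / (2 * (v + u))
      - ∫ y, phi (v + u) y * InformationTheory.klFun (ρ y / phi (v + u) y) := by
    have j1 := m0.mul_const (Real.log (2 * Real.pi * (v + u)) / 2)
    have j2 := m2.div_const (2 * (v + u))
    have j3 := integrable_phi hS
    rw [integral_congr_ae (.of_forall fun y => negMulLog_density (ρ := ρ y) (y := y) hS)]
    rw [integral_add (integrable_fun_sub (integrable_fun_sub (j1.fun_add j2) hki) m0) j3,
      integral_sub (integrable_fun_sub (j1.fun_add j2) hki) m0, integral_sub (j1.fun_add j2) hki,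
      integral_add j1 j2, integral_mul_const, integral_div, m0', m2', integral_phi hS]
    ring
  rw [hent, integral_gauss hS, ← integral_const_mul]
  have := (norm_integral_le_of_norm_le (hWi.const_mul (D * |t| ^ 3)) (.of_forall fun y =>
    (Real.norm_eq_abs _).trans_le (hpt y)))
  rw [integral_sub hki (hgi.const_mul _), integral_const_mul (D * |t| ^ 3), Real.norm_eq_abs,
    abs_sub_comm] at this
  rw [sub_sub_sub_cancel_left]
  refine this.trans ?_
  have : 0 ≤ D * |t| ^ 3 := by positivity
  nlinarith

end Smooth

/-! ### Test functions and Gaussian integration by parts -/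

/-- Smooth compactly supported real functions on the line, as a predicate. -/
structure IsTest (f : ℝ → ℝ) : Prop where
  contDiff : ContDiff ℝ (⊤ : ℕ∞) f
  compact : HasCompactSupport f

namespace IsTest

variable {f g : ℝ → ℝ}

theorem continuous (hf : IsTest f) : Continuous f := hf.contDiff.continuous

theorem deriv (hf : IsTest f) : IsTest (deriv f) :=
  ⟨(contDiff_infty_iff_deriv.1 hf.contDiff).2, hf.compact.deriv⟩

theorem hasDerivAt (hf : IsTest f) (x : ℝ) : HasDerivAt f (_root_.deriv f x) x :=
  ((contDiff_infty_iff_deriv.1 hf.contDiff).1 x).hasDerivAt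

theorem bounded (hf : IsTest f) : ∃ C, 0 ≤ C ∧ ∀ x, |f x| ≤ C := by
  obtain ⟨C, hC⟩ := hf.continuous.bounded_above_of_compact_support hf.compact
  exact ⟨C, (norm_nonneg _).trans (hC 0), hC⟩

theorem sub (hf : IsTest f) (hg : IsTest g) : IsTest fun x => f x - g x :=
  ⟨hf.contDiff.sub hg.contDiff, hf.compact.sub hg.compact⟩

theorem contDiff_mul (hf : IsTest f) (hg : ContDiff ℝ (⊤ : ℕ∞) g) : IsTest fun x => g x * f x :=
  ⟨hg.mul hf.contDiff, hf.compact.mul_left⟩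

theorem id_mul (hf : IsTest f) : IsTest fun x => x * f x :=
  hf.contDiff_mul contDiff_id

theorem comp_mul (hf : IsTest f) {c : ℝ} (hc : c ≠ 0) : IsTest fun x => f (c * x) :=
  ⟨hf.contDiff.comp (contDiff_const.mul contDiff_id),
    hf.compact.comp_homeomorph (Homeomorph.mulLeft₀ c hc)⟩

theorem integrable (hf : IsTest f) (μ : Measure ℝ) [IsFiniteMeasure μ] : Integrable f μ :=
  hf.continuous.integrable_of_hasCompactSupport hf.compact

end IsTest

theorem integrable_of_bdd {f : ℝ → ℝ} (hf : Continuous f) {C : ℝ} (hC : ∀ x, |f x| ≤ C)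
    (μ : Measure ℝ) [IsFiniteMeasure μ] : Integrable f μ :=
  Integrable.of_bound hf.aestronglyMeasurable C (.of_forall hC)

theorem integrable_pow_gauss (n : ℕ) (K : ℝ) : Integrable (fun z : ℝ => z ^ n) (gauss K) := by
  have h := (memLp_id_gaussianReal' (μ := 0) (v := K.toNNReal) n (by simp)).integrable_norm_pow'
  refine (integrable_norm_iff (by fun_prop)).1 (h.congr (.of_forall fun z => ?_))
  simp

theorem gauss_one : gauss 1 = stdGauss := by simp [gauss]

theorem integrable_pow_std (n : ℕ) : Integrable (fun z : ℝ => z ^ n) stdGauss := by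
  simpa [gauss_one] using integrable_pow_gauss n 1

theorem integrable_id_std : Integrable (fun z : ℝ => z) stdGauss := by
  simpa using integrable_pow_std 1

theorem integrable_id_mul_bdd {f : ℝ → ℝ} (hf : Continuous f) {C : ℝ} (hC : ∀ x, |f x| ≤ C) :
    Integrable (fun z : ℝ => z * f z) stdGauss :=
  integrable_id_std.mul_bdd (c := C) hf.aestronglyMeasurable (.of_forall hC)

/-- Gaussian integration by parts (Stein's identity). -/
theorem stein {g g' : ℝ → ℝ} (hg : ∀ x, HasDerivAt g (g' x) x)
    (h1 : Integrable (fun z => z * g z) stdGauss) (h2 : Integrable g' stdGauss)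
    (h3 : Integrable g stdGauss) : ∫ z, z * g z ∂stdGauss = ∫ z, g' z ∂stdGauss := by
  rw [← gauss_one] at *
  rw [integrable_gauss_iff one_pos] at h1 h2 h3
  rw [integral_gauss one_pos, integral_gauss one_pos]
  have := integral_mul_deriv_eq_deriv_mul_of_integrable (u := g) (v := phi 1) (fun x _ => hg x)
    (fun x _ => hasDerivAt_phi 1 x) ?_ ?_ ?_
  · have e1 : ∀ z, phi 1 z * (z * g z) = -(g z * (-(z / 1) * phi 1 z)) := fun z => by ring
    simp_rw [e1, integral_neg, this, neg_neg, mul_comm]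
  · exact h1.neg.congr (.of_forall fun z => by simp; ring)
  · exact h2.congr (.of_forall fun z => by simp [mul_comm])
  · exact h3.congr (.of_forall fun z => by simp [mul_comm])

theorem stein_bdd {g g' : ℝ → ℝ} (hg : ∀ x, HasDerivAt g (g' x) x) (hg' : Continuous g')
    {C C' : ℝ} (hC : ∀ x, |g x| ≤ C) (hC' : ∀ x, |g' x| ≤ C') :
    ∫ z, z * g z ∂stdGauss = ∫ z, g' z ∂stdGauss := by
  have hc : Continuous g := continuous_iff_continuousAt.2 fun x => (hg x).continuousAt
  exact stein hg (integrable_id_mul_bdd hc hC) (integrable_of_bdd hg' hC' _)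
    (integrable_of_bdd hc hC _)

/-! ### The Ornstein-Uhlenbeck semigroup -/

section OU

variable {f : ℝ → ℝ}

theorem ou_bdd {C : ℝ} (hC : ∀ x, |f x| ≤ C) (c z : ℝ) : |ou c f z| ≤ C := by
  have := norm_integral_le_of_norm_le_const (μ := stdGauss)
    (f := fun w => f (√c * z + √(1 - c) * w)) (.of_forall fun w => hC _)
  simpa [ou] using this

theorem continuous_ou_uncurry (hf : Continuous f) {C : ℝ} (hC : ∀ x, |f x| ≤ C) :
    Continuous fun p : ℝ × ℝ => ou p.1 f p.2 := by
  refine continuous_of_dominated (bound := fun _ => C) (fun p => ?_) (fun p => ?_)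
    (integrable_const _) (.of_forall fun w => ?_)
  · exact (by fun_prop : Continuous fun w => f (√p.1 * p.2 + √(1 - p.1) * w)).aestronglyMeasurable
  · exact .of_forall fun w => hC _
  · fun_prop

theorem continuous_ou (hf : Continuous f) {C : ℝ} (hC : ∀ x, |f x| ≤ C) (c : ℝ) :
    Continuous (ou c f) :=
  (continuous_ou_uncurry hf hC).comp (by fun_prop : Continuous fun z : ℝ => (c, z))

theorem ou_one (f : ℝ → ℝ) : ou 1 f = f := by ext; simp [ou]

theorem ou_zero (f : ℝ → ℝ) (z : ℝ) : ou 0 f z = ∫ w, f w ∂stdGauss := by simp [ou]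

/-- The standard Gaussian law is invariant under the Ornstein-Uhlenbeck operators. -/
theorem integral_ou (hf : Continuous f) {C : ℝ} (hC : ∀ x, |f x| ≤ C) {c : ℝ} (h0 : 0 ≤ c)
    (h1 : c ≤ 1) : ∫ z, ou c f z ∂stdGauss = ∫ z, f z ∂stdGauss := by
  have hmap : (stdGauss.prod stdGauss).map (fun p : ℝ × ℝ => √c * p.1 + √(1 - c) * p.2)
      = stdGauss := by
    have h := gaussianReal_conv_gaussianReal (m₁ := 0) (m₂ := 0) (v₁ := c.toNNReal)
      (v₂ := (1 - c).toNNReal)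
    have hs : c.toNNReal + (1 - c).toNNReal = 1 := by
      rw [← Real.toNNReal_add h0 (sub_nonneg.2 h1)]; simp
    rw [hs, add_zero] at h
    have e1 := gauss_eq_map c h0
    have e2 := gauss_eq_map (1 - c) (sub_nonneg.2 h1)
    rw [gauss] at e1 e2
    rw [e1, e2, Measure.conv, Measure.map_prod_map _ _ (by fun_prop) (by fun_prop),
      Measure.map_map (by fun_prop) (by fun_prop)] at h
    exact h
  conv_rhs => rw [← hmap]
  rw [integral_map (by fun_prop) hf.aestronglyMeasurable, integral_prod]
  · rfl
  · exact Integrable.of_bound (by fun_prop) C (.of_forall fun _ => hC _)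

theorem hasDerivAt_ou {f' : ℝ → ℝ} (hf : ∀ x, HasDerivAt f (f' x) x) (hf' : Continuous f')
    {C C' : ℝ} (hC : ∀ x, |f x| ≤ C) (hC' : ∀ x, |f' x| ≤ C') (c z : ℝ) :
    HasDerivAt (ou c f) (√c * ou c f' z) z := by
  have hc : Continuous f := continuous_iff_continuousAt.2 fun x => (hf x).continuousAt
  have := hasDerivAt_integral_of_dominated_loc_of_deriv_le (μ := stdGauss) (x₀ := z)
    (F := fun z w => f (√c * z + √(1 - c) * w))
    (F' := fun z w => √c * f' (√c * z + √(1 - c) * w)) (bound := fun _ => √c * C') univ_mem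
    (.of_forall fun x => (by fun_prop : Continuous _).aestronglyMeasurable)
    (integrable_of_bdd (by fun_prop) (fun _ => hC _) _)
    (by fun_prop : Continuous _).aestronglyMeasurable
    (.of_forall fun w x _ => by
      rw [norm_mul, Real.norm_eq_abs, Real.norm_eq_abs, abs_of_nonneg (Real.sqrt_nonneg c)]
      gcongr
      exact hC' _)
    (integrable_const _)
    (.of_forall fun w x _ => by
      have h1 : HasDerivAt (fun z => √c * z + √(1 - c) * w) (√c) x := by
        simpa using ((hasDerivAt_id x).const_mul √c).add_const (√(1 - c) * w)
      exact (HasDerivAt.comp (h₂ := f) x (hf _) h1).congr_deriv (mul_comm _ _))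
  refine this.2.congr_deriv ?_
  rw [integral_const_mul]
  rfl

/-- The generator of the semigroup in the correlation parameter. Differentiating `√(1 - c)` produces
a factor `w`, which integration by parts turns into a second derivative. -/
theorem hasDerivAt_ou_param {f' f'' : ℝ → ℝ} (hf : ∀ x, HasDerivAt f (f' x) x)
    (hf' : ∀ x, HasDerivAt f' (f'' x) x) (hf'' : Continuous f'')
    {C C' C'' : ℝ} (hC : ∀ x, |f x| ≤ C) (hC' : ∀ x, |f' x| ≤ C') (hC'' : ∀ x, |f'' x| ≤ C'')
    {c : ℝ} (h0 : 0 < c) (h1 : c < 1) (z : ℝ) :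
    HasDerivAt (fun c => ou c f z) (z / (2 * √c) * ou c f' z - ou c f'' z / 2) c := by
  have hc : Continuous f := continuous_iff_continuousAt.2 fun x => (hf x).continuousAt
  have hc' : Continuous f' := continuous_iff_continuousAt.2 fun x => (hf' x).continuousAt
  have hC0 : 0 ≤ C' := (abs_nonneg _).trans (hC' 0)
  have hs : Set.Ioo (c / 2) ((1 + c) / 2) ∈ 𝓝 c := Ioo_mem_nhds (by linarith) (by linarith)
  have := hasDerivAt_integral_of_dominated_loc_of_deriv_le (μ := stdGauss) (x₀ := c)
    (F := fun c w => f (√c * z + √(1 - c) * w))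
    (F' := fun c w => f' (√c * z + √(1 - c) * w) * (z / (2 * √c) - w / (2 * √(1 - c))))
    (bound := fun w => C' * (|z| / (2 * √(c / 2)) + |w| / (2 * √((1 - c) / 2)))) hs
    (.of_forall fun x => (by fun_prop : Continuous _).aestronglyMeasurable)
    (integrable_of_bdd (by fun_prop) (fun _ => hC _) _)
    (by fun_prop : Continuous _).aestronglyMeasurable
    (.of_forall fun w x hx => by
      have := hx.1
      have := hx.2
      rw [norm_mul]
      refine mul_le_mul (hC' _) ?_ (norm_nonneg _) hC0
      refine (norm_sub_le _ _).trans ?_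
      rw [norm_div, norm_div, Real.norm_of_nonneg (by positivity : 0 ≤ 2 * √x),
        Real.norm_of_nonneg (by positivity : 0 ≤ 2 * √(1 - x))]
      refine add_le_add ?_ ?_
      · exact div_le_div_of_nonneg_left (abs_nonneg _) (by positivity)
          (mul_le_mul_of_nonneg_left (Real.sqrt_le_sqrt (by linarith)) zero_le_two)
      · exact div_le_div_of_nonneg_left (abs_nonneg _)
          (mul_pos two_pos (Real.sqrt_pos.2 (by linarith)))
          (mul_le_mul_of_nonneg_left (Real.sqrt_le_sqrt (by linarith)) zero_le_two))
    (((integrable_const _).add ((integrable_id_std.abs).div_const _)).const_mul _)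
    (.of_forall fun w x hx => by
      have h3 : x ≠ 0 := by have := hx.1; intro h; linarith
      have h4 : 1 - x ≠ 0 := by have := hx.2; intro h; linarith
      have h5 : HasDerivAt (fun c => √c * z + √(1 - c) * w)
          (z / (2 * √x) - w / (2 * √(1 - x))) x := by
        have a1 := (Real.hasDerivAt_sqrt h3).mul_const z
        have a2 := (((hasDerivAt_id x).const_sub 1).sqrt h4).mul_const w
        refine (a1.add a2).congr_deriv ?_
        simp only [id]
        ring
      exact HasDerivAt.comp (h₂ := f) x (hf _) h5)
  refine this.2.congr_deriv ?_
  have hq : 0 < √(1 - c) := Real.sqrt_pos.2 (by linarith)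
  have hst := stein_bdd (g := fun w => f' (√c * z + √(1 - c) * w))
    (g' := fun w => √(1 - c) * f'' (√c * z + √(1 - c) * w)) (C := C') (C' := √(1 - c) * C'')
    (fun w => by
      have h1 : HasDerivAt (fun w => √c * z + √(1 - c) * w) (√(1 - c)) w := by
        simpa using ((hasDerivAt_id w).const_mul √(1 - c)).const_add (√c * z)
      exact (HasDerivAt.comp (h₂ := f') w (hf' _) h1).congr_deriv (mul_comm _ _))
    (by fun_prop) (fun _ => hC' _)
    (fun w => by rw [abs_mul, abs_of_pos hq]; gcongr; exact hC'' _)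
  rw [integral_const_mul] at hst
  have i1 : Integrable (fun w => f' (√c * z + √(1 - c) * w)) stdGauss :=
    integrable_of_bdd (by fun_prop) (fun _ => hC' _) _
  have i2 : Integrable (fun w => w * f' (√c * z + √(1 - c) * w)) stdGauss :=
    integrable_id_mul_bdd (by fun_prop) (fun _ => hC' _)
  have e : ∀ w, f' (√c * z + √(1 - c) * w) * (z / (2 * √c) - w / (2 * √(1 - c)))
      = z / (2 * √c) * f' (√c * z + √(1 - c) * w)
        - 1 / (2 * √(1 - c)) * (w * f' (√c * z + √(1 - c) * w)) := fun w => by ring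
  simp_rw [e]
  rw [integral_sub (i1.const_mul _) (i2.const_mul _), integral_const_mul, integral_const_mul, hst]
  simp only [ou]
  field_simp

/-- The squared `L²` norm of `ou c f`. -/
def ouNorm (f : ℝ → ℝ) (c : ℝ) : ℝ := ∫ z, ou c f z ^ 2 ∂stdGauss

theorem ouNorm_nonneg (f : ℝ → ℝ) (c : ℝ) : 0 ≤ ouNorm f c :=
  integral_nonneg fun _ => sq_nonneg _

theorem ouNorm_zero (f : ℝ → ℝ) : ouNorm f 0 = (∫ z, f z ∂stdGauss) ^ 2 := by
  simp [ouNorm, ou_zero]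

theorem continuous_ouNorm (hf : Continuous f) {C : ℝ} (hC : ∀ x, |f x| ≤ C) :
    Continuous (ouNorm f) := by
  have hj := continuous_ou_uncurry hf hC
  refine continuous_of_dominated (bound := fun _ => C ^ 2) (fun c => ?_) (fun c => ?_)
    (integrable_const _) (.of_forall fun z => ?_)
  · exact ((continuous_ou hf hC c).pow 2).aestronglyMeasurable
  · refine .of_forall fun z => ?_
    rw [norm_pow]
    exact pow_le_pow_left₀ (norm_nonneg _) (ou_bdd hC c z) 2
  · exact (hj.comp (by fun_prop : Continuous fun c : ℝ => (c, z))).pow 2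

/-- The carré du champ identity along the semigroup, in the correlation parameter. -/
theorem hasDerivAt_ouNorm (hf : IsTest f) {c : ℝ} (h0 : 0 < c) (h1 : c < 1) :
    HasDerivAt (ouNorm f) (ouNorm (deriv f) c) c := by
  obtain ⟨C, hC0, hC⟩ := hf.bounded
  obtain ⟨C', hC0', hC'⟩ := hf.deriv.bounded
  obtain ⟨C'', hC0'', hC''⟩ := hf.deriv.deriv.bounded
  have hc := continuous_ou hf.continuous hC
  have hc' := continuous_ou hf.deriv.continuous hC'
  have hc'' := continuous_ou hf.deriv.deriv.continuous hC''
  have hs : Set.Ioo (c / 2) ((1 + c) / 2) ∈ 𝓝 c := Ioo_mem_nhds (by linarith) (by linarith)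
  have hD := fun (x : ℝ) (hx : x ∈ Set.Ioo (c / 2) ((1 + c) / 2)) (z : ℝ) =>
    hasDerivAt_ou_param hf.hasDerivAt hf.deriv.hasDerivAt hf.deriv.deriv.continuous hC hC' hC''
      (by have := hx.1; linarith : 0 < x) (by have := hx.2; linarith) z
  have := hasDerivAt_integral_of_dominated_loc_of_deriv_le (μ := stdGauss) (x₀ := c)
    (F := fun c z => ou c f z ^ 2)
    (F' := fun c z => 2 * ou c f z * (z / (2 * √c) * ou c (deriv f) z - ou c (deriv (deriv f)) z / 2))
    (bound := fun z => 2 * C * (|z| / (2 * √(c / 2)) * C' + C'' / 2)) hs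
    (.of_forall fun x => ((hc x).pow 2).aestronglyMeasurable)
    (integrable_of_bdd ((hc c).pow 2) (C := C ^ 2) (fun z => by
      simp only [Pi.pow_apply, abs_pow]; exact pow_le_pow_left₀ (abs_nonneg _) (ou_bdd hC c z) 2) _)
    (by have := hc c; have := hc' c; have := hc'' c; fun_prop : Continuous _).aestronglyMeasurable
    (.of_forall fun z x hx => by
      have := hx.1
      rw [norm_mul, norm_mul, Real.norm_of_nonneg (zero_le_two (α := ℝ))]
      refine mul_le_mul ?_ ?_ (norm_nonneg _) (by positivity)
      · gcongr; exact ou_bdd hC x z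
      · refine (norm_sub_le _ _).trans (add_le_add ?_ ?_)
        · rw [norm_mul, norm_div, Real.norm_of_nonneg (by positivity : 0 ≤ 2 * √x)]
          refine mul_le_mul ?_ (ou_bdd hC' x z) (norm_nonneg _) (by positivity)
          exact div_le_div_of_nonneg_left (abs_nonneg _) (by positivity)
            (mul_le_mul_of_nonneg_left (Real.sqrt_le_sqrt (by linarith)) zero_le_two)
        · rw [norm_div, Real.norm_of_nonneg (zero_le_two (α := ℝ))]
          gcongr; exact ou_bdd hC'' x z)
    ((((integrable_id_std.abs.div_const _).mul_const _).add (integrable_const _)).const_mul _)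
    (.of_forall fun z x hx => by
      simpa using (hD x hx z).fun_pow 2)
  refine this.2.congr_deriv ?_
  have hsc : 0 < √c := Real.sqrt_pos.2 h0
  have hst := stein_bdd (g := fun z => ou c f z * ou c (deriv f) z)
    (g' := fun z => √c * ou c (deriv f) z * ou c (deriv f) z
      + ou c f z * (√c * ou c (deriv (deriv f)) z)) (C := C * C')
    (C' := √c * C' * C' + C * (√c * C''))
    (fun z => (hasDerivAt_ou hf.hasDerivAt hf.deriv.continuous hC hC' c z).mul
      (hasDerivAt_ou hf.deriv.hasDerivAt hf.deriv.deriv.continuous hC' hC'' c z))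
    (by have := hc c; have := hc' c; have := hc'' c; fun_prop)
    (fun z => by
      rw [abs_mul]; exact mul_le_mul (ou_bdd hC c z) (ou_bdd hC' c z) (abs_nonneg _) hC0)
    (fun z => by
      refine (abs_add_le _ _).trans ?_
      rw [abs_mul, abs_mul, abs_mul, abs_mul, abs_of_pos hsc]
      have b0 := ou_bdd hC c z
      have b1 := ou_bdd hC' c z
      have b2 := ou_bdd hC'' c z
      gcongr)
  have j1 : Integrable (fun z => z * (ou c f z * ou c (deriv f) z)) stdGauss :=
    integrable_id_mul_bdd ((hc c).mul (hc' c)) (C := C * C') fun z => by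
      rw [abs_mul]; exact mul_le_mul (ou_bdd hC c z) (ou_bdd hC' c z) (abs_nonneg _) hC0
  have j2 : Integrable (fun z => ou c f z * ou c (deriv (deriv f)) z) stdGauss :=
    integrable_of_bdd ((hc c).mul (hc'' c)) (C := C * C'') (fun z => by
      simp only [Pi.mul_apply, abs_mul]
      exact mul_le_mul (ou_bdd hC c z) (ou_bdd hC'' c z) (abs_nonneg _) hC0) _
  have j3 : Integrable (fun z => ou c (deriv f) z ^ 2) stdGauss :=
    integrable_of_bdd ((hc' c).pow 2) (C := C' ^ 2) (fun z => by
      simp only [Pi.pow_apply, abs_pow]; exact pow_le_pow_left₀ (abs_nonneg _) (ou_bdd hC' c z) 2) _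
  have e1 : ∀ z, 2 * ou c f z * (z / (2 * √c) * ou c (deriv f) z - ou c (deriv (deriv f)) z / 2)
      = 1 / √c * (z * (ou c f z * ou c (deriv f) z)) - ou c f z * ou c (deriv (deriv f)) z :=
    fun z => by field_simp
  have e2 : ∀ z, √c * ou c (deriv f) z * ou c (deriv f) z
      + ou c f z * (√c * ou c (deriv (deriv f)) z)
      = √c * (ou c (deriv f) z ^ 2 + ou c f z * ou c (deriv (deriv f)) z) := fun z => by ring
  simp_rw [e2] at hst
  rw [integral_const_mul, integral_add j3 j2] at hst
  simp_rw [e1]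
  rw [integral_sub (j1.const_mul _) j2, integral_const_mul, hst, ouNorm]
  field_simp
  ring

theorem nonneg_of_hasDerivAt_nonneg {g g' : ℝ → ℝ} (hg : Continuous g) (h0 : g 0 = 0)
    (hd : ∀ x, 0 < x → x < 1 → HasDerivAt g (g' x) x) (hn : ∀ x, 0 < x → x < 1 → 0 ≤ g' x)
    {x : ℝ} (hx0 : 0 ≤ x) (hx1 : x ≤ 1) : 0 ≤ g x := by
  have hm : MonotoneOn g (Set.Icc 0 1) := by
    refine monotoneOn_of_deriv_nonneg (convex_Icc 0 1) hg.continuousOn ?_ ?_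
    · rw [interior_Icc]
      exact fun y hy => (hd y hy.1 hy.2).differentiableAt.differentiableWithinAt
    · rw [interior_Icc]
      intro y hy
      rw [(hd y hy.1 hy.2).deriv]
      exact hn y hy.1 hy.2
  rw [← h0]
  exact hm (by simp) ⟨hx0, hx1⟩ hx0

/-- Spectral gap for the part of `f` orthogonal to the Hermite polynomials of degree at most two:
it is contracted by `c ^ 3`. The Taylor expansion of `ouNorm f` at `c = 0` has coefficients
`(𝔼 f⁽ᵏ⁾)² / k!`, and as all derivatives of `ouNorm f` are nonnegative on `[0, 1]`, the
third-order remainder divided by `c ^ 3` is monotone. -/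
theorem ouNorm_le (hf : IsTest f) {c : ℝ} (h0 : 0 ≤ c) (h1 : c ≤ 1) :
    ouNorm f c ≤ (∫ z, f z ∂stdGauss) ^ 2 + c * (∫ z, deriv f z ∂stdGauss) ^ 2
      + c ^ 2 / 2 * (∫ z, deriv (deriv f) z ∂stdGauss) ^ 2
      + c ^ 3 * (ouNorm f 1 - (∫ z, f z ∂stdGauss) ^ 2 - (∫ z, deriv f z ∂stdGauss) ^ 2
        - (∫ z, deriv (deriv f) z ∂stdGauss) ^ 2 / 2) := by
  have cont : ∀ g, IsTest g → Continuous (ouNorm g) := fun g hg => by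
    obtain ⟨C, _, hC⟩ := hg.bounded
    exact continuous_ouNorm hg.continuous hC
  simp only [← ouNorm_zero]
  set N0 := ouNorm f with hN0
  set N1 := ouNorm (deriv f) with hN1
  set N2 := ouNorm (deriv (deriv f)) with hN2
  set N3 := ouNorm (deriv (deriv (deriv f))) with hN3
  have c0 : Continuous N0 := cont _ hf
  have c1 : Continuous N1 := cont _ hf.deriv
  have c2 : Continuous N2 := cont _ hf.deriv.deriv
  have c3 : Continuous N3 := cont _ hf.deriv.deriv.deriv
  have d0 : ∀ x, 0 < x → x < 1 → HasDerivAt N0 (N1 x) x := fun x h h' => hasDerivAt_ouNorm hf h h'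
  have d1 : ∀ x, 0 < x → x < 1 → HasDerivAt N1 (N2 x) x :=
    fun x h h' => hasDerivAt_ouNorm hf.deriv h h'
  have d2 : ∀ x, 0 < x → x < 1 → HasDerivAt N2 (N3 x) x :=
    fun x h h' => hasDerivAt_ouNorm hf.deriv.deriv h h'
  have d3 : ∀ x, 0 < x → x < 1 → HasDerivAt N3
      (ouNorm (deriv (deriv (deriv (deriv f)))) x) x :=
    fun x h h' => hasDerivAt_ouNorm hf.deriv.deriv.deriv h h'
  -- the numerator of the derivative of the divided remainder is `A0`; differentiating it three
  -- times leads down to the nonnegative quantity `x * ouNorm f⁗ x`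
  have A2 : ∀ x, 0 ≤ x → x ≤ 1 → 0 ≤ x * N3 x - (N2 x - N2 0) := fun x hx hx' =>
    nonneg_of_hasDerivAt_nonneg (g := fun x => x * N3 x - (N2 x - N2 0))
      (g' := fun x => x * ouNorm (deriv (deriv (deriv (deriv f)))) x) (by fun_prop) (by simp)
      (fun x h h' => (((hasDerivAt_id x).mul (d3 x h h')).sub
        ((d2 x h h').sub_const (N2 0))).congr_deriv (by simp))
      (fun x h _ => mul_nonneg h.le (ouNorm_nonneg _ _)) hx hx'
  have A1 : ∀ x, 0 ≤ x → x ≤ 1 → 0 ≤ x * (N2 x - N2 0) - 2 * (N1 x - N1 0 - x * N2 0) :=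
    fun x hx hx' =>
    nonneg_of_hasDerivAt_nonneg (g := fun x => x * (N2 x - N2 0) - 2 * (N1 x - N1 0 - x * N2 0))
      (by fun_prop) (by simp)
      (fun x h h' => (((hasDerivAt_id x).mul ((d2 x h h').sub_const (N2 0))).sub
        ((((d1 x h h').sub_const (N1 0)).sub
          ((hasDerivAt_id x).mul_const (N2 0))).const_mul 2)).congr_deriv
        (by simp only [id]; ring : _ = x * N3 x - (N2 x - N2 0)))
      (fun x h h' => A2 x h.le h'.le) hx hx'
  have A0 : ∀ x, 0 ≤ x → x ≤ 1 →
      0 ≤ x * (N1 x - N1 0 - x * N2 0) - 3 * (N0 x - N0 0 - x * N1 0 - x ^ 2 / 2 * N2 0) :=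
    fun x hx hx' =>
    nonneg_of_hasDerivAt_nonneg
      (g := fun x => x * (N1 x - N1 0 - x * N2 0)
        - 3 * (N0 x - N0 0 - x * N1 0 - x ^ 2 / 2 * N2 0))
      (by fun_prop) (by simp)
      (fun x h h' => (((hasDerivAt_id x).mul (((d1 x h h').sub_const (N1 0)).sub
          ((hasDerivAt_id x).mul_const (N2 0)))).sub
        (((((d0 x h h').sub_const (N0 0)).sub ((hasDerivAt_id x).mul_const (N1 0))).sub
          (((hasDerivAt_pow 2 x).div_const 2).mul_const (N2 0))).const_mul 3)).congr_deriv
        (by simp; ring : _ = x * (N2 x - N2 0) - 2 * (N1 x - N1 0 - x * N2 0)))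
      (fun x h h' => A1 x h.le h'.le) hx hx'
  rcases h0.eq_or_lt with rfl | h0
  · simp
  have hm : MonotoneOn (fun x => (N0 x - N0 0 - x * N1 0 - x ^ 2 / 2 * N2 0) / x ^ 3)
      (Set.Icc c 1) := by
    have hd : ∀ x ∈ interior (Set.Icc c 1), HasDerivAt
        (fun x => (N0 x - N0 0 - x * N1 0 - x ^ 2 / 2 * N2 0) / x ^ 3)
        ((x * (N1 x - N1 0 - x * N2 0) - 3 * (N0 x - N0 0 - x * N1 0 - x ^ 2 / 2 * N2 0))
          / x ^ 4) x := by
      rw [interior_Icc]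
      rintro x ⟨hx, hx'⟩
      have hx0 : 0 < x := h0.trans hx
      refine ((((((d0 x hx0 hx').sub_const (N0 0)).sub
        ((hasDerivAt_id x).mul_const (N1 0))).sub
          (((hasDerivAt_pow 2 x).div_const 2).mul_const (N2 0)))).div (hasDerivAt_pow 3 x)
          (by positivity)).congr_deriv ?_
      simp
      field_simp
    refine monotoneOn_of_deriv_nonneg (convex_Icc c 1) ?_
      (fun x hx => (hd x hx).differentiableAt.differentiableWithinAt) fun x hx => ?_
    · refine ContinuousOn.div (by fun_prop) (by fun_prop) fun x hx => ?_
      have : 0 < x := h0.trans_le hx.1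
      positivity
    · rw [(hd x hx).deriv]
      rw [interior_Icc] at hx
      have hx0 : 0 < x := h0.trans hx.1
      exact div_nonneg (A0 x hx0.le hx.2.le) (by positivity)
  have := hm ⟨le_rfl, h1⟩ ⟨h1, le_rfl⟩ h1
  simp only [one_pow, div_one, one_mul] at this
  rw [div_le_iff₀ (by positivity)] at this
  linarith

/-- The Gaussian divergence `z g - g'`, the adjoint of differentiation in `L²` of the standard
Gaussian law. -/
def gaussDiv (g : ℝ → ℝ) (z : ℝ) : ℝ := z * g z - deriv g z

theorem IsTest.gaussDiv {g : ℝ → ℝ} (hg : IsTest g) : IsTest (gaussDiv g) :=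
  hg.id_mul.sub hg.deriv

theorem IsTest.stein {g : ℝ → ℝ} (hg : IsTest g) :
    ∫ z, z * g z ∂stdGauss = ∫ z, _root_.deriv g z ∂stdGauss :=
  W2Flow.stein hg.hasDerivAt (hg.id_mul.integrable _) (hg.deriv.integrable _) (hg.integrable _)

theorem integral_gaussDiv {g : ℝ → ℝ} (hg : IsTest g) : ∫ z, gaussDiv g z ∂stdGauss = 0 := by
  simp only [gaussDiv]
  rw [integral_sub (hg.id_mul.integrable _) (hg.deriv.integrable _), hg.stein, sub_self]

theorem deriv_gaussDiv {g : ℝ → ℝ} (hg : IsTest g) (z : ℝ) :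
    deriv (gaussDiv g) z = g z + gaussDiv (deriv g) z := by
  have : HasDerivAt (gaussDiv g) (1 * g z + z * deriv g z - deriv (deriv g) z) z :=
    ((hasDerivAt_id z).mul (hg.hasDerivAt z)).sub (hg.deriv.hasDerivAt z)
  rw [this.deriv, gaussDiv]
  ring

theorem integral_deriv_gaussDiv {g : ℝ → ℝ} (hg : IsTest g) :
    ∫ z, deriv (gaussDiv g) z ∂stdGauss = ∫ z, g z ∂stdGauss := by
  simp_rw [deriv_gaussDiv hg]
  rw [integral_add (hg.integrable _) (hg.deriv.gaussDiv.integrable _),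
    integral_gaussDiv hg.deriv, add_zero]

theorem integral_deriv_deriv_gaussDiv {g : ℝ → ℝ} (hg : IsTest g) :
    ∫ z, deriv (deriv (gaussDiv g)) z ∂stdGauss = 2 * ∫ z, z * g z ∂stdGauss := by
  have e : deriv (gaussDiv g) = fun z => g z + gaussDiv (deriv g) z :=
    funext fun z => deriv_gaussDiv hg z
  have e2 : ∀ z, deriv (deriv (gaussDiv g)) z
      = 2 * deriv g z + gaussDiv (deriv (deriv g)) z := fun z => by
    rw [e, ((hg.hasDerivAt z).fun_add (hg.deriv.gaussDiv.hasDerivAt z)).deriv,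
      deriv_gaussDiv hg.deriv]
    ring
  simp_rw [e2]
  rw [integral_add ((hg.deriv.integrable _).const_mul _)
    (hg.deriv.deriv.gaussDiv.integrable _), integral_gaussDiv hg.deriv.deriv, add_zero,
    integral_const_mul, hg.stein]

/-- `ouNorm_le` for a Gaussian divergence, whose mean vanishes and whose next two Hermite
coefficients are moments of `g`. -/
theorem ouNorm_gaussDiv_le {g : ℝ → ℝ} (hg : IsTest g) {c : ℝ} (h0 : 0 ≤ c) (h1 : c ≤ 1) :
    ouNorm (gaussDiv g) c ≤ c * (∫ z, g z ∂stdGauss) ^ 2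
      + 2 * c ^ 2 * (∫ z, z * g z ∂stdGauss) ^ 2
      + c ^ 3 * (ouNorm (gaussDiv g) 1 - (∫ z, g z ∂stdGauss) ^ 2
        - 2 * (∫ z, z * g z ∂stdGauss) ^ 2) := by
  have := ouNorm_le hg.gaussDiv h0 h1
  rw [integral_gaussDiv hg, integral_deriv_gaussDiv hg, integral_deriv_deriv_gaussDiv hg] at this
  linarith

/-- The first and second Hermite coefficients of `ou c f`. -/
theorem ou_hermite_coeff (hf : IsTest f) {c : ℝ} (h0 : 0 ≤ c) (h1 : c ≤ 1) :
    ∫ z, z * ou c f z ∂stdGauss = √c * ∫ z, deriv f z ∂stdGauss ∧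
    ∫ z, (z ^ 2 - 1) * ou c f z ∂stdGauss = c * ∫ z, deriv (deriv f) z ∂stdGauss := by
  obtain ⟨C, hC0, hC⟩ := hf.bounded
  obtain ⟨C', hC0', hC'⟩ := hf.deriv.bounded
  obtain ⟨C'', hC0'', hC''⟩ := hf.deriv.deriv.bounded
  have hc := continuous_ou hf.continuous hC c
  have hc' := continuous_ou hf.deriv.continuous hC' c
  have hc'' := continuous_ou hf.deriv.deriv.continuous hC'' c
  have b0 := ou_bdd hC c
  have b1 := ou_bdd hC' c
  have b2 := ou_bdd hC'' c
  have hsc := Real.sqrt_nonneg c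
  have key : ∀ {g g' : ℝ → ℝ} {D D' : ℝ}, (∀ x, HasDerivAt g (g' x) x) → Continuous g' →
      (∀ x, |g x| ≤ D) → (∀ x, |g' x| ≤ D') →
      ∫ z, z * ou c g z ∂stdGauss = √c * ∫ z, g' z ∂stdGauss := by
    intro g g' D D' hg hg' hD hD'
    rw [stein_bdd (hasDerivAt_ou hg hg' hD hD' c)
      ((continuous_ou hg' hD' c).const_mul _) (ou_bdd hD c) (C' := √c * D') (fun x => by
        rw [abs_mul, abs_of_nonneg hsc]
        exact mul_le_mul_of_nonneg_left (ou_bdd hD' c x) hsc), integral_const_mul,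
      integral_ou hg' hD' h0 h1]
  refine ⟨key hf.hasDerivAt hf.deriv.continuous hC hC', ?_⟩
  have hd := hasDerivAt_ou hf.hasDerivAt hf.deriv.continuous hC hC' c
  have i1 : Integrable (fun z => z ^ 2 * ou c f z) stdGauss :=
    (integrable_pow_std 2).mul_bdd (c := C) hc.aestronglyMeasurable (.of_forall b0)
  have i0 : Integrable (ou c f) stdGauss := integrable_of_bdd hc b0 _
  have i2 : Integrable (fun z => z * (√c * ou c (deriv f) z)) stdGauss :=
    integrable_id_mul_bdd (hc'.const_mul _) (C := √c * C') (fun x => by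
      rw [abs_mul, abs_of_nonneg hsc]
      exact mul_le_mul_of_nonneg_left (b1 x) hsc)
  have hst := stein (g := fun z => z * ou c f z)
    (g' := fun z => 1 * ou c f z + z * (√c * ou c (deriv f) z))
    (fun z => (hasDerivAt_id z).mul (hd z))
    (i1.congr (.of_forall fun z => by simp only; ring))
    ((i0.const_mul 1).add i2) (integrable_id_mul_bdd hc b0)
  simp_rw [sub_mul, one_mul, pow_two, mul_assoc]
  rw [integral_sub (i1.congr (.of_forall fun z => by simp only; ring)) i0, hst]
  simp_rw [one_mul]
  rw [integral_add i0 i2, add_sub_cancel_left]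
  simp_rw [mul_left_comm _ √c]
  rw [integral_const_mul, key hf.deriv.hasDerivAt hf.deriv.deriv.continuous hC' hC'', ← mul_assoc,
    Real.mul_self_sqrt h0]

theorem integral_sq_std : ∫ z, z ^ 2 ∂stdGauss = 1 := by
  have := stein (g := fun z => z) (g' := fun _ => 1) (fun x => hasDerivAt_id x)
    ((integrable_pow_std 2).congr (.of_forall fun z => by simp only; ring))
    (integrable_const _) integrable_id_std
  simpa [pow_two] using this

theorem integral_pow_add_two_std (n : ℕ) :
    ∫ z, z ^ (n + 2) ∂stdGauss = (n + 1) * ∫ z, z ^ n ∂stdGauss := by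
  have := stein (g := fun z => z ^ (n + 1)) (g' := fun z => (n + 1 : ℝ) * z ^ n)
    (fun x => by simpa using hasDerivAt_pow (n + 1) x)
    ((integrable_pow_std (n + 2)).congr (.of_forall fun z => by simp only; ring))
    ((integrable_pow_std n).const_mul _) (integrable_pow_std _)
  rw [integral_const_mul] at this
  rw [← this]
  exact integral_congr_ae (.of_forall fun z => by simp only; ring)

theorem integral_id_std : ∫ z, z ∂stdGauss = 0 := integral_id_gaussianReal

/-- Bessel's inequality for the Hermite polynomials of degrees one and two. -/
theorem bessel_hermite {G : ℝ → ℝ} (hG : Continuous G) {C : ℝ} (hC : ∀ x, |G x| ≤ C) :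
    (∫ z, z * G z ∂stdGauss) ^ 2 + (∫ z, (z ^ 2 - 1) * G z ∂stdGauss) ^ 2 / 2
      ≤ ∫ z, G z ^ 2 ∂stdGauss := by
  set p := ∫ z, z * G z ∂stdGauss with hp
  set q := ∫ z, (z ^ 2 - 1) * G z ∂stdGauss with hq
  have m2 := integral_sq_std
  have m3 : ∫ z, z ^ 3 ∂stdGauss = 0 := by
    rw [integral_pow_add_two_std 1]; simp
  have m4 : ∫ z, z ^ 4 ∂stdGauss = 3 := by
    rw [integral_pow_add_two_std 2, m2]; norm_num
  have i1 := integrable_id_mul_bdd hG hC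
  have i2 : Integrable (fun z => (z ^ 2 - 1) * G z) stdGauss :=
    ((integrable_pow_std 2).sub (integrable_const 1)).mul_bdd (c := C) hG.aestronglyMeasurable
      (.of_forall hC)
  have i0 : Integrable (fun z => G z ^ 2) stdGauss :=
    integrable_of_bdd (by fun_prop) (C := C ^ 2) (fun x => by
      rw [abs_pow]; exact pow_le_pow_left₀ (abs_nonneg _) (hC x) 2) _
  have j1 := integrable_id_std
  have j2 := integrable_pow_std 2
  have j3 := integrable_pow_std 3
  have j4 := integrable_pow_std 4
  have hnn : 0 ≤ ∫ z, (G z - p * z - q / 2 * (z ^ 2 - 1)) ^ 2 ∂stdGauss :=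
    integral_nonneg fun _ => sq_nonneg _
  have e : ∀ z, (G z - p * z - q / 2 * (z ^ 2 - 1)) ^ 2
      = G z ^ 2 - 2 * p * (z * G z) - q * ((z ^ 2 - 1) * G z)
        + (q ^ 2 / 4 * z ^ 4 + p * q * z ^ 3 + (p ^ 2 - q ^ 2 / 2) * z ^ 2 - p * q * z
          + q ^ 2 / 4) := fun z => by ring
  simp_rw [e] at hnn
  rw [integral_add (integrable_fun_sub (integrable_fun_sub i0 (i1.const_mul _)) (i2.const_mul _))
      ((integrable_fun_sub (((j4.const_mul _).fun_add (j3.const_mul _)).fun_add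
        (j2.const_mul _)) (j1.const_mul _)).fun_add (integrable_const _)),
    integral_sub (integrable_fun_sub i0 (i1.const_mul _)) (i2.const_mul _),
    integral_sub i0 (i1.const_mul _),
    integral_add (integrable_fun_sub (((j4.const_mul _).fun_add (j3.const_mul _)).fun_add
        (j2.const_mul _)) (j1.const_mul _)) (integrable_const _),
    integral_sub (((j4.const_mul _).fun_add (j3.const_mul _)).fun_add
        (j2.const_mul _)) (j1.const_mul _),
    integral_add ((j4.const_mul _).fun_add (j3.const_mul _)) (j2.const_mul _),
    integral_add (j4.const_mul _) (j3.const_mul _)] at hnn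
  have m1 : ∫ z, p * q * z ∂stdGauss = 0 := by rw [integral_const_mul, integral_id_std, mul_zero]
  simp only [integral_const_mul, m1, m2, m3, m4, ← hp, ← hq, integral_const,
    probReal_univ, smul_eq_mul] at hnn
  linarith

end OU

/-! ### Entropy along geodesics from a Gaussian law -/

theorem VField.isTest (U : VField) : IsTest U := ⟨U.contDiff, U.hasCompactSupport⟩

theorem abs_log_one_add_sub_le {x : ℝ} (hx : |x| ≤ 1 / 2) :
    |Real.log (1 + x) - x + x ^ 2 / 2| ≤ 2 * |x| ^ 3 := by
  have h := Real.abs_log_sub_add_sum_range_le (x := -x) (by rw [abs_neg]; linarith) 2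
  rw [abs_neg, sub_neg_eq_add] at h
  have e : (∑ i ∈ Finset.range 2, (-x) ^ (i + 1) / ((i : ℝ) + 1)) + Real.log (1 + x)
      = Real.log (1 + x) - x + x ^ 2 / 2 := by
    simp [Finset.sum_range_succ]; ring
  rw [e] at h
  refine h.trans ?_
  rw [div_le_iff₀ (by linarith)]
  have : 0 ≤ |x| ^ 3 * (1 / 2 - |x|) := mul_nonneg (pow_nonneg (abs_nonneg x) 3) (by linarith)
  norm_num
  linarith

section Geodesic

variable {U : VField} {t : ℝ}

theorem hasDerivAt_geodesicMap (U : VField) (t x : ℝ) :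
    HasDerivAt (fun x => x + t * U x) (1 + t * deriv U x) x :=
  (hasDerivAt_id x).add ((U.isTest.hasDerivAt x).const_mul t)

/-- For small `t` the map `x ↦ x + t U x` is a homeomorphism of the line. -/
def geodesicHomeo (U : VField) (t : ℝ) (h : ∀ x, |t * deriv U x| ≤ 1 / 2) : ℝ ≃ₜ ℝ :=
  (StrictMono.orderIsoOfSurjective (fun x => x + t * U x)
    (strictMono_of_deriv_pos fun x => by
      rw [(hasDerivAt_geodesicMap U t x).deriv]
      have := (abs_le.1 (h x)).1
      linarith)
    (by
      obtain ⟨C, _, hC⟩ := U.isTest.bounded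
      have hb : ∀ x, |t * U x| ≤ |t| * C := fun x => by rw [abs_mul]; gcongr; exact hC x
      refine Continuous.surjective (by fun_prop) ?_ ?_
      · exact tendsto_atTop_mono (fun x => by have := (abs_le.1 (hb x)).1; simp only [id]; linarith)
          (tendsto_atTop_add_const_right _ (-(|t| * C)) tendsto_id)
      · exact tendsto_atBot_mono (fun x => by have := (abs_le.1 (hb x)).2; simp only [id]; linarith)
          (tendsto_atBot_add_const_right _ (|t| * C) tendsto_id))).toHomeomorph

theorem geodesicHomeo_apply (h : ∀ x, |t * deriv U x| ≤ 1 / 2) (x : ℝ) :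
    geodesicHomeo U t h x = x + t * U x := rfl

/-- The density of `geodesic (gauss K) U t`. -/
def geodesicDens (K : ℝ) (U : VField) (t : ℝ) (h : ∀ x, |t * deriv U x| ≤ 1 / 2) (y : ℝ) : ℝ :=
  phi K ((geodesicHomeo U t h).symm y) / (1 + t * deriv U ((geodesicHomeo U t h).symm y))

theorem one_add_pos (h : ∀ x, |t * deriv U x| ≤ 1 / 2) (x : ℝ) : 0 < 1 + t * deriv U x := by
  have := (abs_le.1 (h x)).1
  linarith

theorem geodesicDens_nonneg (h : ∀ x, |t * deriv U x| ≤ 1 / 2)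
    {K : ℝ} (hK : 0 < K) (y : ℝ) : 0 ≤ geodesicDens K U t h y :=
  div_nonneg (phi_pos hK _).le (one_add_pos h _).le

theorem measurable_geodesicDens (h : ∀ x, |t * deriv U x| ≤ 1 / 2)
    (K : ℝ) : Measurable (geodesicDens K U t h) := by
  have h1 := (continuous_phi K).comp (geodesicHomeo U t h).symm.continuous
  have h2 := U.isTest.deriv.continuous.comp (geodesicHomeo U t h).symm.continuous
  exact h1.measurable.div ((h2.const_mul t).const_add 1).measurable

theorem geodesicDens_apply (h : ∀ x, |t * deriv U x| ≤ 1 / 2)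
    (K x : ℝ) :
    geodesicDens K U t h (x + t * U x) = phi K x / (1 + t * deriv U x) := by
  have : (geodesicHomeo U t h).symm (x + t * U x) = x := by
    rw [← geodesicHomeo_apply h, Homeomorph.symm_apply_apply]
  rw [geodesicDens, this]

theorem image_geodesicMap (h : ∀ x, |t * deriv U x| ≤ 1 / 2)
    : (fun x => x + t * U x) '' Set.univ = Set.univ :=
  Set.image_univ.trans (geodesicHomeo U t h).surjective.range_eq

theorem injOn_geodesicMap (h : ∀ x, |t * deriv U x| ≤ 1 / 2)
    : Set.InjOn (fun x => x + t * U x) Set.univ :=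
  (geodesicHomeo U t h).injective.injOn

theorem geodesic_eq_withDensity (h : ∀ x, |t * deriv U x| ≤ 1 / 2)
    {K : ℝ} (hK : 0 < K) :
    geodesic (gauss K) U t
      = volume.withDensity fun y => ENNReal.ofReal (geodesicDens K U t h y) := by
  refine Measure.ext_of_lintegral _ fun f hf => ?_
  have hT : Measurable fun x => x + t * U x := by fun_prop
  rw [geodesic, lintegral_map hf hT, gauss_eq_withDensity hK,
    lintegral_withDensity_eq_lintegral_mul _ (continuous_phi K).measurable.ennreal_ofReal
      (by fun_prop),
    lintegral_withDensity_eq_lintegral_mul _ (measurable_geodesicDens h K).ennreal_ofReal hf]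
  conv_rhs => rw [← setLIntegral_univ, ← image_geodesicMap h]
  rw [lintegral_image_eq_lintegral_abs_deriv_mul MeasurableSet.univ
    (fun x _ => (hasDerivAt_geodesicMap U t x).hasDerivWithinAt) (injOn_geodesicMap h),
    setLIntegral_univ]
  refine lintegral_congr fun x => ?_
  have hp := one_add_pos h x
  simp only [Pi.mul_apply, geodesicDens_apply]
  rw [← mul_assoc, ← ENNReal.ofReal_mul (abs_nonneg _), abs_of_pos hp, mul_div_cancel₀ _ hp.ne']

theorem geodesic_isP2 (h : ∀ x, |t * deriv U x| ≤ 1 / 2) {K : ℝ} (hK : 0 < K) :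
    IsP2 (geodesic (gauss K) U t) := by
  have hT : Measurable fun x => x + t * U x := by fun_prop
  refine ⟨Measure.isProbabilityMeasure_map hT.aemeasurable, ?_, ?_⟩
  · rw [geodesic_eq_withDensity h hK]
    exact withDensity_absolutelyContinuous _ _
  · rw [geodesic, memLp_map_measure_iff (by fun_prop) hT.aemeasurable]
    obtain ⟨C, _, hC⟩ := U.isTest.bounded
    have h1 : MemLp id 2 (gauss K) := memLp_id_gaussianReal' 2 (by simp)
    have h2 : MemLp (fun x => t * U x) 2 (gauss K) :=
      (MemLp.of_bound U.continuous.aestronglyMeasurable C (.of_forall hC)).const_mul t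
    exact h1.add h2

/-- Change of variables for the entropy along a geodesic: `h((id + tU)_# γ_K)` exceeds `h(γ_K)` by
the mean of `log (1 + t U')`. -/
theorem geodesic_entropy (h : ∀ x, |t * deriv U x| ≤ 1 / 2)
    {K : ℝ} (hK : 0 < K) :
    FiniteEntropy (geodesic (gauss K) U t) ∧
    diffEntropy (geodesic (gauss K) U t)
      = Real.log (2 * Real.pi * K) / 2 + 1 / 2 + ∫ x, Real.log (1 + t * deriv U x) ∂gauss K := by
  have hm := measurable_geodesicDens h K
  have h0 := geodesicDens_nonneg h hK
  have hlc : Continuous fun x => Real.log (1 + t * deriv U x) :=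
    ((U.isTest.deriv.continuous.const_mul t).const_add 1).log fun x => (one_add_pos h x).ne'
  have i1 : Integrable (fun x => Real.log (1 + t * deriv U x)) (gauss K) := by
    refine integrable_of_bdd hlc (C := 1) (fun x => ?_) _
    have h1 := abs_le.1 (h x)
    rw [abs_le]
    constructor
    · have := Real.one_sub_inv_le_log_of_pos (one_add_pos h x)
      have h2 : (1 + t * deriv U x)⁻¹ ≤ 2 := by
        rw [inv_le_comm₀ (one_add_pos h x) two_pos]; linarith
      linarith
    · have := Real.log_le_sub_one_of_pos (one_add_pos h x)
      linarith
  have i2 : Integrable (fun x : ℝ => x ^ 2 / (2 * K)) (gauss K) :=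
    (integrable_pow_gauss 2 K).div_const _
  have key : ∀ x, |1 + t * deriv U x| • Real.negMulLog (geodesicDens K U t h (x + t * U x))
      = phi K x * (Real.log (2 * Real.pi * K) / 2 + x ^ 2 / (2 * K)
        + Real.log (1 + t * deriv U x)) := fun x => by
    have hp := one_add_pos h x
    have hφ := phi_pos hK x
    have hlog : Real.log (phi K x) = -(Real.log (2 * Real.pi * K) / 2) - x ^ 2 / (2 * K) := by
      have hpi := Real.pi_pos
      rw [phi, Real.log_mul (by positivity) (Real.exp_ne_zero _), Real.log_exp, Real.log_inv,
        Real.log_sqrt (by positivity)]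
      ring
    rw [geodesicDens_apply, abs_of_pos hp, Real.negMulLog, Real.log_div hφ.ne' hp.ne', hlog,
      smul_eq_mul]
    field_simp
    ring
  have itot := ((integrable_const (Real.log (2 * Real.pi * K) / 2)).fun_add i2).fun_add i1
  rw [geodesic_eq_withDensity h hK, finiteEntropy_withDensity_iff hm h0,
    diffEntropy_withDensity hm h0]
  have hd := fun x (_ : x ∈ Set.univ) => (hasDerivAt_geodesicMap U t x).hasDerivWithinAt
    (s := Set.univ)
  constructor
  · rw [← integrableOn_univ, ← image_geodesicMap h,
      integrableOn_image_iff_integrableOn_abs_deriv_smul MeasurableSet.univ hd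
        (injOn_geodesicMap h), integrableOn_univ]
    simp_rw [key]
    exact (integrable_gauss_iff hK _).1 itot
  · rw [← setIntegral_univ, ← image_geodesicMap h,
      integral_image_eq_integral_abs_deriv_smul MeasurableSet.univ hd
        (injOn_geodesicMap h), setIntegral_univ]
    simp_rw [key]
    have hsq : ∫ x, x ^ 2 ∂gauss K = K := by
      rw [integral_gauss_eq_std hK.le (by fun_prop)]
      simp_rw [mul_pow, Real.sq_sqrt hK.le]
      rw [integral_const_mul, integral_sq_std, mul_one]
    have hsq' : ∫ x, x ^ 2 / (2 * K) ∂gauss K = K / (2 * K) := by rw [integral_div, hsq]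
    rw [← integral_gauss hK (fun x => Real.log (2 * Real.pi * K) / 2 + x ^ 2 / (2 * K)
        + Real.log (1 + t * deriv U x)),
      integral_add ((integrable_const _).fun_add i2) i1, integral_add (integrable_const _) i2,
      hsq', integral_const, probReal_univ, one_smul]
    field_simp

end Geodesic

/-- Second-order expansion of the entropy along a geodesic, uniform over fields with
`|U'| ≤ M`. -/
theorem geodesic_entropy_expansion {K M : ℝ} (hK : 0 < K) (U : VField)
    (hU : ∀ x, |deriv U x| ≤ M) {t : ℝ} (ht : |t| * M ≤ 1 / 2) :
    |diffEntropy (geodesic (gauss K) U t) - (Real.log (2 * Real.pi * K) / 2 + 1 / 2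
      + t * ∫ x, deriv U x ∂gauss K - t ^ 2 / 2 * ∫ x, deriv U x ^ 2 ∂gauss K)|
      ≤ 2 * M ^ 3 * |t| ^ 3 := by
  have hM : 0 ≤ M := (abs_nonneg _).trans (hU 0)
  have hb : ∀ x, |t * deriv U x| ≤ |t| * M := fun x => by rw [abs_mul]; gcongr; exact hU x
  have h : ∀ x, |t * deriv U x| ≤ 1 / 2 := fun x => (hb x).trans ht
  have hc := U.isTest.deriv.continuous
  have i1 : Integrable (fun x => deriv U x) (gauss K) := integrable_of_bdd hc hU _
  have i2 : Integrable (fun x => deriv U x ^ 2) (gauss K) :=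
    integrable_of_bdd (by fun_prop) (C := M ^ 2) (fun x => by
      rw [abs_pow]; exact pow_le_pow_left₀ (abs_nonneg _) (hU x) 2) _
  have hlc : Continuous fun x => Real.log (1 + t * deriv U x) :=
    ((hc.const_mul t).const_add 1).log fun x => (one_add_pos h x).ne'
  have hpt : ∀ x, |Real.log (1 + t * deriv U x) - t * deriv U x + t ^ 2 / 2 * deriv U x ^ 2|
      ≤ 2 * M ^ 3 * |t| ^ 3 := fun x => by
    have := abs_log_one_add_sub_le (h x)
    rw [mul_pow, mul_div_right_comm] at this
    refine this.trans ?_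
    have := pow_le_pow_left₀ (abs_nonneg _) (hb x) 3
    rw [mul_pow] at this
    linarith
  have i3 : Integrable (fun x => Real.log (1 + t * deriv U x) - t * deriv U x
      + t ^ 2 / 2 * deriv U x ^ 2) (gauss K) := integrable_of_bdd (by fun_prop) hpt _
  have i0 : Integrable (fun x => Real.log (1 + t * deriv U x)) (gauss K) := by
    refine ((i3.add (i1.const_mul t)).sub (i2.const_mul (t ^ 2 / 2))).congr
      (.of_forall fun x => ?_)
    simp only [Pi.add_apply, Pi.sub_apply]
    ring
  rw [(geodesic_entropy h hK).2]
  have hn := norm_integral_le_of_norm_le_const (μ := gauss K)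
    (f := fun x => Real.log (1 + t * deriv U x) - t * deriv U x + t ^ 2 / 2 * deriv U x ^ 2)
    (.of_forall hpt)
  rw [integral_add (integrable_fun_sub i0 (i1.const_mul t)) (i2.const_mul _),
    integral_sub i0 (i1.const_mul t), integral_const_mul, integral_const_mul, probReal_univ,
    mul_one, Real.norm_eq_abs] at hn
  refine le_trans (le_of_eq ?_) hn
  congr 1
  ring

/-! ### Linear response of smoothed Gaussian laws -/

/-- The vector field `U` on the line carrying the Gaussian law of variance `K`, read in the
standardised coordinate `z = x / √K`. -/
def stdz (K : ℝ) (U : ℝ → ℝ) (z : ℝ) : ℝ := U (√K * z) / √K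

section Response

variable {K L u : ℝ} {U V : ℝ → ℝ}

theorem IsTest.stdz (hU : IsTest U) (hK : 0 < K) : IsTest (stdz K U) := by
  have h := (hU.comp_mul (Real.sqrt_pos.2 hK).ne').contDiff_mul
    (contDiff_const (c := (√K)⁻¹) (n := (⊤ : ℕ∞)))
  convert h using 1
  ext z
  rw [W2Flow.stdz, div_eq_inv_mul]

theorem deriv_stdz (hU : IsTest U) (hK : 0 < K) (z : ℝ) :
    deriv (stdz K U) z = deriv U (√K * z) := by
  have hs := Real.sqrt_pos.2 hK
  have h1 : HasDerivAt (fun z => √K * z) √K z := by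
    simpa using (hasDerivAt_id z).const_mul √K
  have : HasDerivAt (stdz K U) (deriv U (√K * z) * √K / √K) z :=
    (HasDerivAt.comp (h₂ := U) z (hU.hasDerivAt _) h1).div_const _
  rw [this.deriv, mul_div_cancel_right₀ _ hs.ne']

theorem mul_stdz (hK : 0 < K) (z : ℝ) : √K * stdz K U z = U (√K * z) :=
  mul_div_cancel₀ _ (Real.sqrt_pos.2 hK).ne'

theorem gaussDiv_stdz (hU : IsTest U) (hK : 0 < K) (z : ℝ) :
    gaussDiv (stdz K U) z = √K * z / K * U (√K * z) - deriv U (√K * z) := by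
  have hs := Real.sqrt_pos.2 hK
  have hss := Real.mul_self_sqrt hK.le
  rw [gaussDiv, deriv_stdz hU hK, stdz]
  congr 1
  conv_rhs => rw [← hss]
  rw [Real.sqrt_mul_self hs.le]
  field_simp

theorem integral_stdz (hU : IsTest U) (hK : 0 < K) :
    ∫ x, U x ∂gauss K = √K * ∫ z, stdz K U z ∂stdGauss := by
  rw [integral_gauss_eq_std hK.le hU.continuous.measurable, ← integral_const_mul]
  simp_rw [mul_stdz hK]

theorem integral_id_mul_stdz (hU : IsTest U) (hK : 0 < K) :
    ∫ x, x * U x ∂gauss K = K * ∫ z, z * stdz K U z ∂stdGauss := by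
  rw [integral_gauss_eq_std hK.le hU.id_mul.continuous.measurable, ← integral_const_mul]
  refine integral_congr_ae (.of_forall fun z => ?_)
  simp only [← mul_stdz (U := U) hK]
  rw [mul_mul_mul_comm, Real.mul_self_sqrt hK.le]

theorem integral_sq_stdz (hU : IsTest U) (hK : 0 < K) :
    ∫ x, U x ^ 2 ∂gauss K = K * ∫ z, stdz K U z ^ 2 ∂stdGauss := by
  rw [integral_gauss_eq_std hK.le (hU.continuous.measurable.pow_const 2), ← integral_const_mul]
  refine integral_congr_ae (.of_forall fun z => ?_)
  simp only [← mul_stdz (U := U) hK]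
  rw [mul_pow, Real.sq_sqrt hK.le]

theorem integral_deriv_stdz (hU : IsTest U) (hK : 0 < K) :
    ∫ x, deriv U x ∂gauss K = ∫ z, deriv (stdz K U) z ∂stdGauss := by
  rw [integral_gauss_eq_std hK.le hU.deriv.continuous.measurable]
  simp_rw [deriv_stdz hU hK]

theorem integral_deriv_sq_stdz (hU : IsTest U) (hK : 0 < K) :
    ∫ x, deriv U x ^ 2 ∂gauss K = ∫ z, deriv (stdz K U) z ^ 2 ∂stdGauss := by
  rw [integral_gauss_eq_std hK.le (hU.deriv.continuous.measurable.pow_const 2)]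
  simp_rw [deriv_stdz hU hK]

/-- Integration by parts: transporting mass along `U` responds like reweighting by the Gaussian
divergence of `U`. -/
theorem response_eq (hK : 0 < K) (hU : IsTest U) (y : ℝ) :
    ∫ x, (y - x) / u * phi u (y - x) * U x ∂gauss K
      = ∫ x, phi u (y - x) * (x / K * U x - deriv U x) ∂gauss K := by
  rw [integral_gauss hK, integral_gauss hK]
  have d1 : ∀ x, HasDerivAt (fun x => phi u (y - x)) ((y - x) / u * phi u (y - x)) x := fun x => by
    have h := HasDerivAt.comp (h₂ := phi u) x (hasDerivAt_phi u (y - x))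
      ((hasDerivAt_id x).const_sub y)
    exact h.congr_deriv (by simp)
  have d2 : ∀ x, HasDerivAt (fun x => phi K x * U x)
      (-(x / K) * phi K x * U x + phi K x * deriv U x) x := fun x =>
    (hasDerivAt_phi K x).mul (hU.hasDerivAt x)
  have cK := continuous_phi K
  have cu := continuous_phi u
  have cU := hU.continuous
  have cU' := hU.deriv.continuous
  have icomp : ∀ {g h : ℝ → ℝ}, Continuous g → IsTest h → Integrable (fun x => g x * h x) :=
    fun hg hh => (hg.mul hh.continuous).integrable_of_hasCompactSupport hh.compact.mul_left
  have := integral_mul_deriv_eq_deriv_mul_of_integrable (fun x _ => d1 x) (fun x _ => d2 x)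
    ?_ ?_ ?_
  · have e1 : ∀ x, phi K x * ((y - x) / u * phi u (y - x) * U x)
      = (y - x) / u * phi u (y - x) * (phi K x * U x) := fun x => by ring
    have e2 : ∀ x, phi K x * (phi u (y - x) * (x / K * U x - deriv U x))
      = -(phi u (y - x) * (-(x / K) * phi K x * U x + phi K x * deriv U x)) := fun x => by ring
    simp_rw [e1, e2, integral_neg]
    rw [this, neg_neg]
  · refine ((icomp (g := fun x => phi u (y - x) * (-(x / K) * phi K x)) (by fun_prop) hU).add
      (icomp (g := fun x => phi u (y - x) * phi K x) (by fun_prop) hU.deriv)).congr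
      (.of_forall fun x => ?_)
    simp only [Pi.add_apply, Pi.mul_apply]
    ring
  · refine (icomp (g := fun x => (y - x) / u * phi u (y - x) * phi K x)
      (by fun_prop) hU).congr (.of_forall fun x => ?_)
    simp only [Pi.mul_apply]
    ring
  · refine (icomp (g := fun x => phi u (y - x) * phi K x)
      (by fun_prop) hU).congr (.of_forall fun x => ?_)
    simp only [Pi.mul_apply]
    ring

/-- The response of `γ_K * γ_u` relative to its density, in standardised coordinates. -/
theorem response_eq_ou (hK : 0 < K) (hu : 0 < u) (hU : IsTest U) (y : ℝ) :
    ∫ x, phi u (y - x) * (x / K * U x - deriv U x) ∂gauss K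
      = phi (K + u) y * ou (K / (K + u)) (gaussDiv (stdz K U)) (y / √(K + u)) := by
  have cU := hU.continuous
  have cU' := hU.deriv.continuous
  rw [integral_phi_sub_mul hK hu (f := fun x => x / K * U x - deriv U x) (by fun_prop)]
  congr 2
  ext z
  rw [gaussDiv_stdz hU hK]

/-- The relative response of `p * γ_u` at `p = γ_K` is an Ornstein-Uhlenbeck average of the
divergence of the field. -/
theorem densResponse_single (hK : 0 < K) (hu : 0 < u) (hU : IsTest U) (y : ℝ) :
    densResponse (gauss K) u id U y / phi (K + u) y
      = ou (K / (K + u)) (gaussDiv (stdz K U)) (y / √(K + u)) := by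
  have hp := phi_pos (v := K + u) (by positivity) y
  rw [div_eq_iff hp.ne', densResponse]
  simp only [id]
  rw [response_eq hK hU, response_eq_ou hK hu hU, mul_comm]

/-- The second summand `γ_L` acts as additional noise: it only enlarges the variance `u`. -/
theorem response_iterated (hK : 0 < K) (hL : 0 < L) (hu : 0 < u) (hU : IsTest U) (y : ℝ) :
    ∫ w, ∫ x, (y - (x + w)) / u * phi u (y - (x + w)) * U x ∂gauss K ∂gauss L
      = phi (K + L + u) y * ou (K / (K + L + u)) (gaussDiv (stdz K U)) (y / √(K + L + u)) := by
  have e1 : ∀ w x, y - (x + w) = y - w - x := fun w x => by ring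
  simp_rw [e1, response_eq hK hU]
  have cu := continuous_phi u
  have hA : IsTest fun x => x / K * U x - deriv U x :=
    (hU.contDiff_mul (contDiff_id.div_const K)).sub hU.deriv
  obtain ⟨C, hC0, hC⟩ := hA.bounded
  have cA := hA.continuous
  rw [integral_integral_swap]
  · have e2 : ∀ x, ∫ w, phi u (y - w - x) * (x / K * U x - deriv U x) ∂gauss L
        = phi (L + u) (y - x) * (x / K * U x - deriv U x) := fun x => by
      rw [integral_mul_const, ← integral_phi_sub hL hu]
      simp_rw [sub_right_comm]
    simp_rw [e2]
    rw [response_eq_ou hK (add_pos hL hu) hU, ← add_assoc]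
  · refine Integrable.of_bound (C := (√(2 * Real.pi * u))⁻¹ * C)
      (Continuous.aestronglyMeasurable ?_) (.of_forall fun p => ?_)
    · exact (cu.comp (by fun_prop : Continuous fun p : ℝ × ℝ => y - p.1 - p.2)).mul
        (cA.comp continuous_snd)
    · simp only [Function.uncurry]
      rw [norm_mul, Real.norm_of_nonneg (phi_pos hu _).le]
      exact mul_le_mul (phi_le hu _) (hC _) (norm_nonneg _) (by positivity)

/-- The relative response of `p * q * γ_u` at `(γ_K, γ_L)` is the sum of the responses to the two
fields, with correlations given by the shares of `K` and `L` in the total variance. -/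
theorem densResponse_pair (hK : 0 < K) (hL : 0 < L) (hu : 0 < u) (hU : IsTest U) (hV : IsTest V)
    (y : ℝ) :
    densResponse ((gauss K).prod (gauss L)) u (fun p => p.1 + p.2) (fun p => U p.1 + V p.2) y
        / phi (K + L + u) y
      = ou (K / (K + L + u)) (gaussDiv (stdz K U)) (y / √(K + L + u))
        + ou (L / (K + L + u)) (gaussDiv (stdz L V)) (y / √(K + L + u)) := by
  have hp := phi_pos (v := K + L + u) (by positivity) y
  obtain ⟨C, hC, hb⟩ := phi_taylor hu 0
  have cu := continuous_phi u
  have cU := hU.continuous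
  have cV := hV.continuous
  have hbd : ∀ z, |z / u * phi u z| ≤ C * (√(2 * Real.pi * (5 * u / 4)))⁻¹ := fun z =>
    ((hb z 0 (by simp)).2).trans (by gcongr; exact phi_le (by positivity) z)
  have hint : ∀ g : ℝ × ℝ → ℝ, Continuous g → (∃ D, 0 ≤ D ∧ ∀ p, |g p| ≤ D) →
      Integrable (fun p : ℝ × ℝ => (y - (p.1 + p.2)) / u * phi u (y - (p.1 + p.2)) * g p)
        ((gauss K).prod (gauss L)) := by
    rintro g hg ⟨D, hD0, hD⟩
    refine Integrable.of_bound (C := C * (√(2 * Real.pi * (5 * u / 4)))⁻¹ * D)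
      (by fun_prop : Continuous _).aestronglyMeasurable (.of_forall fun p => ?_)
    rw [norm_mul]
    exact mul_le_mul (hbd _) (hD p) (norm_nonneg _) (by positivity)
  obtain ⟨CU, hCU0, hCU⟩ := hU.bounded
  obtain ⟨CV, hCV0, hCV⟩ := hV.bounded
  have iU := hint (fun p => U p.1) (by fun_prop) ⟨CU, hCU0, fun p => hCU _⟩
  have iV := hint (fun p => V p.2) (by fun_prop) ⟨CV, hCV0, fun p => hCV _⟩
  rw [div_eq_iff hp.ne', densResponse]
  simp_rw [mul_add]
  have hsw := response_iterated (U := V) hL hK hu hV y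
  have hsw' : ∫ x, ∫ w, (y - (x + w)) / u * phi u (y - (x + w)) * V w ∂gauss L ∂gauss K
      = ∫ x, ∫ w, (y - (w + x)) / u * phi u (y - (w + x)) * V w ∂gauss L ∂gauss K :=
    integral_congr_ae (.of_forall fun x => integral_congr_ae (.of_forall fun w => by
      simp only [add_comm x]))
  rw [integral_add iU iV, integral_prod_symm _ iU, integral_prod _ iV,
    response_iterated hK hL hu hU]
  rw [hsw', hsw, add_comm L K, add_mul, mul_comm (phi _ _), mul_comm (phi _ _)]

/-- Adjointness of `gaussDiv` and differentiation. -/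
theorem integral_gaussDiv_sq {g : ℝ → ℝ} (hg : IsTest g) :
    ∫ z, gaussDiv g z ^ 2 ∂stdGauss
      = ∫ z, g z ^ 2 ∂stdGauss + ∫ z, deriv g z ^ 2 ∂stdGauss := by
  have adj : ∀ {p q : ℝ → ℝ}, IsTest p → IsTest q →
      ∫ z, q z * gaussDiv p z ∂stdGauss = ∫ z, deriv q z * p z ∂stdGauss := by
    intro p q hp hq
    have hqp := hp.contDiff_mul hq.contDiff
    have h1 : ∀ z, deriv (fun z => q z * p z) z = deriv q z * p z + q z * deriv p z := fun z =>
      ((hq.hasDerivAt z).mul (hp.hasDerivAt z)).deriv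
    have h2 := hqp.stein
    simp_rw [h1] at h2
    have i1 := (hp.contDiff_mul hq.deriv.contDiff).integrable stdGauss
    have i2 := (hp.deriv.contDiff_mul hq.contDiff).integrable stdGauss
    rw [integral_add i1 i2] at h2
    have e : ∀ z, q z * gaussDiv p z = z * (q z * p z) - q z * deriv p z := fun z => by
      rw [gaussDiv]; ring
    simp_rw [e]
    rw [integral_sub (hqp.id_mul.integrable _) i2, h2, add_sub_cancel_right]
  simp_rw [pow_two]
  rw [adj hg hg.gaussDiv]
  have e : ∀ z, deriv (gaussDiv g) z * g z = g z * g z + g z * gaussDiv (deriv g) z := fun z => by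
    rw [deriv_gaussDiv hg]; ring
  simp_rw [e]
  rw [integral_add ((hg.contDiff_mul hg.contDiff).integrable _)
    ((hg.deriv.gaussDiv.contDiff_mul hg.contDiff).integrable _), adj hg.deriv hg]

end Response

/-! ### The Hessian form -/

theorem memLp_ou_gaussDiv {g : ℝ → ℝ} (hg : IsTest g) (c : ℝ) :
    MemLp (ou c (gaussDiv g)) 2 stdGauss := by
  obtain ⟨C, _, hC⟩ := hg.gaussDiv.bounded
  exact MemLp.of_bound (continuous_ou hg.gaussDiv.continuous hC c).aestronglyMeasurable C
    (.of_forall (ou_bdd hC c))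

theorem ou_integrable {g : ℝ → ℝ} (hg : IsTest g) (c z : ℝ) :
    Integrable (fun w => g (√c * z + √(1 - c) * w)) stdGauss := by
  obtain ⟨C, _, hC⟩ := hg.bounded
  have := hg.continuous
  exact integrable_of_bdd (by fun_prop) (fun _ => hC _) _

theorem ou_add {f g : ℝ → ℝ} (hf : IsTest f) (hg : IsTest g) (c z : ℝ) :
    ou c (fun x => f x + g x) z = ou c f z + ou c g z :=
  integral_add (ou_integrable hf c z) (ou_integrable hg c z)

theorem ou_const_mul (a : ℝ) (f : ℝ → ℝ) (c z : ℝ) :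
    ou c (fun x => a * f x) z = a * ou c f z := integral_const_mul _ _

/-- The linear map sending a vector field on the line with the Gaussian law of variance `K` to
`ou c` of its divergence, in standardised coordinates: the infinitesimal change of relative
density seen after smoothing, when `c` is the fraction of the variance carried by the source. -/
def responseMap (K : ℝ) (hK : 0 < K) (c : ℝ) : VField →ₗ[ℝ] (ℝ → ℝ) where
  toFun U := ou c (gaussDiv (stdz K U))
  map_add' U V := by
    ext z
    have hU := U.isTest.stdz hK
    have hV := V.isTest.stdz hK
    rw [Pi.add_apply, ← ou_add hU.gaussDiv hV.gaussDiv]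
    congr 1
    ext x
    have e : stdz K ⇑(U + V) = fun z => stdz K U z + stdz K V z := by
      ext z; simp [stdz, add_div]
    rw [gaussDiv, e, ((hU.hasDerivAt x).fun_add (hV.hasDerivAt x)).deriv, gaussDiv, gaussDiv]
    ring
  map_smul' a U := by
    ext z
    have hU := U.isTest.stdz hK
    rw [Pi.smul_apply, RingHom.id_apply, smul_eq_mul, ← ou_const_mul]
    congr 1
    ext x
    have e : stdz K ⇑(a • U) = fun z => a * stdz K U z := by
      ext z; simp [stdz, mul_div_assoc]
    rw [gaussDiv, e, ((hU.hasDerivAt x).const_mul a).deriv, gaussDiv]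
    ring

theorem responseMap_apply (K : ℝ) (hK : 0 < K) (c : ℝ) (U : VField) :
    responseMap K hK c U = ou c (gaussDiv (stdz K U)) := rfl

theorem responseMap_memLp (K : ℝ) (hK : 0 < K) (c : ℝ) (U : VField) :
    MemLp (responseMap K hK c U) 2 stdGauss :=
  memLp_ou_gaussDiv (U.isTest.stdz hK) c

/-- The mean of a vector field, as a linear functional. -/
def meanMap (K : ℝ) : VField →ₗ[ℝ] ℝ where
  toFun U := ∫ x, U x ∂gauss K
  map_add' U V := integral_add (U.isTest.integrable _) (V.isTest.integrable _)
  map_smul' a _ := integral_const_mul a _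

/-- The `L²` inner product of the standard Gaussian law, pulled back along a linear map. -/
def l2Form {E : Type*} [AddCommGroup E] [Module ℝ E] (T : E →ₗ[ℝ] (ℝ → ℝ))
    (hT : ∀ ξ, MemLp (T ξ) 2 stdGauss) : LinearMap.BilinForm ℝ E :=
  LinearMap.mk₂ ℝ (fun ξ η => ∫ z, T ξ z * T η z ∂stdGauss)
    (fun ξ ξ' η => by
      simp only [map_add, Pi.add_apply, add_mul]
      exact integral_add ((hT ξ).integrable_mul (hT η)) ((hT ξ').integrable_mul (hT η)))
    (fun a ξ η => by
      simp only [map_smul, Pi.smul_apply, smul_eq_mul, mul_assoc]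
      exact integral_const_mul _ _)
    (fun ξ η η' => by
      simp only [map_add, Pi.add_apply, mul_add]
      exact integral_add ((hT ξ).integrable_mul (hT η)) ((hT ξ).integrable_mul (hT η')))
    (fun a ξ η => by
      simp only [map_smul, Pi.smul_apply, smul_eq_mul, mul_left_comm _ a]
      exact integral_const_mul _ _)

theorem l2Form_apply {E : Type*} [AddCommGroup E] [Module ℝ E] (T : E →ₗ[ℝ] (ℝ → ℝ))
    (hT : ∀ ξ, MemLp (T ξ) 2 stdGauss) (ξ η : E) :
    l2Form T hT ξ η = ∫ z, T ξ z * T η z ∂stdGauss := rfl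

theorem l2Form_comm {E : Type*} [AddCommGroup E] [Module ℝ E] (T : E →ₗ[ℝ] (ℝ → ℝ))
    (hT : ∀ ξ, MemLp (T ξ) 2 stdGauss) (ξ η : E) : l2Form T hT ξ η = l2Form T hT η ξ := by
  simp only [l2Form_apply, mul_comm]

/-- The response to the first field of a pair. -/
def responseFst (K : ℝ) (hK : 0 < K) (c : ℝ) : VField × VField →ₗ[ℝ] (ℝ → ℝ) :=
  (responseMap K hK c).comp (LinearMap.fst ℝ VField VField)

theorem responseFst_memLp (K : ℝ) (hK : 0 < K) (c : ℝ) (ξ : VField × VField) :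
    MemLp (responseFst K hK c ξ) 2 stdGauss := responseMap_memLp K hK c ξ.1

/-- The joint response of the law of the sum to a pair of fields. -/
def responsePair (K L : ℝ) (hK : 0 < K) (hL : 0 < L) (c c' : ℝ) :
    VField × VField →ₗ[ℝ] (ℝ → ℝ) :=
  (responseMap K hK c).comp (LinearMap.fst ℝ VField VField)
    + (responseMap L hL c').comp (LinearMap.snd ℝ VField VField)

theorem responsePair_memLp (K L : ℝ) (hK : 0 < K) (hL : 0 < L) (c c' : ℝ)
    (ξ : VField × VField) : MemLp (responsePair K L hK hL c c' ξ) 2 stdGauss :=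
  (responseMap_memLp K hK c ξ.1).add (responseMap_memLp L hL c' ξ.2)

/-- The Wasserstein Hessian of `Ψ_λ` at a stationary Gaussian pair: minus the squared relative
density perturbation of `p`, plus `1 + u` times that of `p * γ_u`, minus `u` times that of
`p * q * γ_u`, and a term that only sees the means of the two fields. -/
def hessForm (u K L : ℝ) (hK : 0 < K) (hL : 0 < L) : LinearMap.BilinForm ℝ (VField × VField) :=
  (1 + u) • l2Form (responseFst K hK (K / (K + u))) (responseFst_memLp K hK _)
    - l2Form (responseFst K hK 1) (responseFst_memLp K hK _)
    - u • l2Form (responsePair K L hK hL (K / (K + L + u)) (L / (K + L + u)))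
      (responsePair_memLp K L hK hL _ _)
    + (u / (K + L + u)) •
      ((LinearMap.mul ℝ ℝ).compl₁₂ ((meanMap K).comp (LinearMap.fst ℝ VField VField))
          ((meanMap L).comp (LinearMap.snd ℝ VField VField))
        + (LinearMap.mul ℝ ℝ).compl₁₂ ((meanMap L).comp (LinearMap.snd ℝ VField VField))
          ((meanMap K).comp (LinearMap.fst ℝ VField VField))
        + (LinearMap.mul ℝ ℝ).compl₁₂ ((meanMap L).comp (LinearMap.snd ℝ VField VField))
          ((meanMap L).comp (LinearMap.snd ℝ VField VField)))

theorem hessForm_isSymm (u K L : ℝ) (hK : 0 < K) (hL : 0 < L) :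
    (hessForm u K L hK hL).IsSymm := by
  refine ⟨fun ξ η => ?_⟩
  simp only [hessForm, LinearMap.add_apply, LinearMap.sub_apply, LinearMap.smul_apply,
    LinearMap.compl₁₂_apply, LinearMap.mul_apply_apply]
  rw [l2Form_comm (responseFst K hK 1) _ ξ η, l2Form_comm (responseFst K hK (K / (K + u))) _ ξ η,
    l2Form_comm (responsePair K L hK hL _ _) _ ξ η]
  simp only [smul_eq_mul]
  ring

theorem hessForm_self (u K L : ℝ) (hK : 0 < K) (hL : 0 < L) (U V : VField) :
    hessForm u K L hK hL (U, V) (U, V)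
      = (1 + u) * ouNorm (gaussDiv (stdz K U)) (K / (K + u)) - ouNorm (gaussDiv (stdz K U)) 1
        - u * ∫ z, (ou (K / (K + L + u)) (gaussDiv (stdz K U)) z
          + ou (L / (K + L + u)) (gaussDiv (stdz L V)) z) ^ 2 ∂stdGauss
        + u / (K + L + u) * (2 * (∫ x, U x ∂gauss K) * (∫ y, V y ∂gauss L)
          + (∫ y, V y ∂gauss L) ^ 2) := by
  simp only [hessForm, LinearMap.add_apply, LinearMap.sub_apply, LinearMap.smul_apply,
    LinearMap.compl₁₂_apply, LinearMap.mul_apply_apply, l2Form_apply, responseFst, responsePair,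
    LinearMap.comp_apply, LinearMap.fst_apply, LinearMap.snd_apply, Pi.add_apply,
    responseMap_apply, smul_eq_mul, ouNorm, pow_two]
  simp only [meanMap, LinearMap.coe_mk, AddHom.coe_mk]
  ring

/-! ### Expansion of the functional along geodesics -/

theorem gauss_conv_gauss {a b : ℝ} (ha : 0 ≤ a) (hb : 0 ≤ b) :
    (gauss a).conv (gauss b) = gauss (a + b) := by
  rw [gauss, gauss, gauss, gaussianReal_conv_gaussianReal, Real.toNNReal_add ha hb, add_zero]

theorem geodesic_zero (p : Measure ℝ) (U : VField) : geodesic p U 0 = p := by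
  simp [geodesic]

theorem diffEntropy_gauss {K : ℝ} (hK : 0 < K) :
    diffEntropy (gauss K) = Real.log (2 * Real.pi * K) / 2 + 1 / 2 := by
  have := (geodesic_entropy (U := 0) (t := 0) (by simp) hK).2
  rw [geodesic_zero] at this
  simpa using this

theorem PsiLam_gauss {u lam K L : ℝ} (hu : 0 < u) (hK : 0 < K) (hL : 0 < L) :
    PsiLam u lam (gauss K) (gauss L)
      = u * (Real.log (2 * Real.pi * (K + L + u)) / 2 + 1 / 2)
        + (Real.log (2 * Real.pi * K) / 2 + 1 / 2)
        - (1 + u) * (Real.log (2 * Real.pi * (K + u)) / 2 + 1 / 2) - lam * L := by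
  rw [PsiLam, Psi, gauss_conv_gauss hK.le hL.le, gauss_conv_gauss (by positivity) hu.le,
    gauss_conv_gauss hK.le hu.le, diffEntropy_gauss hK, diffEntropy_gauss (by positivity),
    diffEntropy_gauss (by positivity)]
  have : variance id (gauss L) = L := by
    rw [gauss, variance_id_gaussianReal, Real.coe_toNNReal _ hL.le]
  rw [this]

/-- Vanishing of the derivative over the Gaussian pairs, in closed form. -/
theorem stationary_eqs {u lam K L : ℝ} (hu : 0 < u) (hK : 0 < K) (hL : 0 < L)
    (h : HasFDerivAt (fun x : ℝ × ℝ => PsiLam u lam (gauss x.1) (gauss x.2))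
      (0 : ℝ × ℝ →L[ℝ] ℝ) (K, L)) :
    u / (K + L + u) + 1 / K - (1 + u) / (K + u) = 0 ∧ u / (K + L + u) = 2 * lam := by
  have hpi := Real.pi_pos
  have hlog : ∀ a x : ℝ, 0 < x + a →
      HasDerivAt (fun s => Real.log (2 * Real.pi * (s + a)) / 2 + 1 / 2) (1 / (2 * (x + a))) x := by
    intro a x hx
    have h1 : HasDerivAt (fun s => 2 * Real.pi * (s + a)) (2 * Real.pi) x := by
      simpa using ((hasDerivAt_id x).add_const a).const_mul (2 * Real.pi)
    refine (((h1.log (by positivity)).div_const 2).add_const _).congr_deriv ?_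
    field_simp
  constructor
  · have hc : HasDerivAt (fun s : ℝ => (s, L)) (1, 0) K :=
      (hasDerivAt_id K).prodMk (hasDerivAt_const K L)
    have h1 := HasFDerivAt.comp_hasDerivAt K h hc
    have h2 : HasDerivAt (fun s => u * (Real.log (2 * Real.pi * (s + (L + u))) / 2 + 1 / 2)
        + (Real.log (2 * Real.pi * (s + 0)) / 2 + 1 / 2)
        - (1 + u) * (Real.log (2 * Real.pi * (s + u)) / 2 + 1 / 2) - lam * L)
        (u * (1 / (2 * (K + (L + u)))) + 1 / (2 * (K + 0)) - (1 + u) * (1 / (2 * (K + u)))) K :=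
      (((((hlog (L + u) K (by positivity)).const_mul u).add (hlog 0 K (by positivity))).sub
        ((hlog u K (by positivity)).const_mul (1 + u))).sub_const _)
    have h3 := h1.congr_of_eventuallyEq (f₁ := fun s =>
        u * (Real.log (2 * Real.pi * (s + (L + u))) / 2 + 1 / 2)
        + (Real.log (2 * Real.pi * (s + 0)) / 2 + 1 / 2)
        - (1 + u) * (Real.log (2 * Real.pi * (s + u)) / 2 + 1 / 2) - lam * L) (by
      filter_upwards [lt_mem_nhds hK] with s hs
      simp only [Function.comp]
      rw [PsiLam_gauss hu hs hL, add_zero, add_assoc s])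
    have h4 := h2.unique h3
    simp only [_root_.zero_apply, add_zero, ← add_assoc] at h4
    have e : u / (K + L + u) + 1 / K - (1 + u) / (K + u)
      = 2 * (u * (1 / (2 * (K + L + u))) + 1 / (2 * K) - (1 + u) * (1 / (2 * (K + u)))) := by
      field_simp
    rw [e, h4, mul_zero]
  · have hc : HasDerivAt (fun s : ℝ => (K, s)) (0, 1) L :=
      (hasDerivAt_const L K).prodMk (hasDerivAt_id L)
    have h1 := HasFDerivAt.comp_hasDerivAt L h hc
    have h2 : HasDerivAt (fun s => u * (Real.log (2 * Real.pi * (s + (K + u))) / 2 + 1 / 2)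
        + (Real.log (2 * Real.pi * K) / 2 + 1 / 2)
        - (1 + u) * (Real.log (2 * Real.pi * (K + u)) / 2 + 1 / 2) - lam * s)
        (u * (1 / (2 * (L + (K + u)))) - lam * 1) L :=
      (((((hlog (K + u) L (by positivity)).const_mul u).add_const _).sub_const _).sub
        ((hasDerivAt_id L).const_mul lam))
    have h3 := h1.congr_of_eventuallyEq (f₁ := fun s =>
        u * (Real.log (2 * Real.pi * (s + (K + u))) / 2 + 1 / 2)
        + (Real.log (2 * Real.pi * K) / 2 + 1 / 2)
        - (1 + u) * (Real.log (2 * Real.pi * (K + u)) / 2 + 1 / 2) - lam * s) (by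
      filter_upwards [lt_mem_nhds hL] with s hs
      simp only [Function.comp]
      rw [PsiLam_gauss hu hK hs, ← add_assoc s, add_comm s K])
    have h4 := h2.unique h3
    simp only [_root_.zero_apply, mul_one] at h4
    have e : u / (K + L + u) = 2 * (u * (1 / (2 * (L + (K + u))))) := by
      rw [show L + (K + u) = K + L + u by ring]
      field_simp
    rw [e]
    linarith

section Expansion

variable {K L u : ℝ}

theorem integral_sq_gauss (hK : 0 < K) : ∫ x, x ^ 2 ∂gauss K = K := by
  rw [integral_gauss_eq_std hK.le (by fun_prop)]
  simp_rw [mul_pow, Real.sq_sqrt hK.le]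
  rw [integral_const_mul, integral_sq_std, mul_one]

/-- First and second moments along a geodesic from a Gaussian law. -/
theorem geodesicMap_moments (hK : 0 < K) (U : VField) (t : ℝ) :
    MemLp (fun x => x + t * U x) 2 (gauss K) ∧
    ∫ x, (x + t * U x) ∂gauss K = t * ∫ x, U x ∂gauss K ∧
    ∫ x, (x + t * U x) ^ 2 ∂gauss K = K + 2 * t * (K * ∫ z, z * stdz K U z ∂stdGauss)
      + t ^ 2 * (K * ∫ z, stdz K U z ^ 2 ∂stdGauss) := by
  have hU := U.isTest
  have i1 : Integrable (fun x : ℝ => x) (gauss K) := by simpa using integrable_pow_gauss 1 K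
  have i2 := hU.integrable (gauss K)
  have i3 := integrable_pow_gauss 2 K
  have i4 := hU.id_mul.integrable (gauss K)
  have i5 : Integrable (fun x => U x ^ 2) (gauss K) :=
    ((hU.contDiff_mul hU.contDiff).integrable _).congr (.of_forall fun x => (pow_two _).symm)
  refine ⟨?_, ?_, ?_⟩
  · obtain ⟨C, _, hC⟩ := U.isTest.bounded
    have h1 : MemLp id 2 (gauss K) := memLp_id_gaussianReal' 2 (by simp)
    exact h1.add ((MemLp.of_bound U.continuous.aestronglyMeasurable C (.of_forall hC)).const_mul t)
  · rw [integral_add i1 (i2.const_mul t), integral_const_mul]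
    simp
  · have e : ∀ x, (x + t * U x) ^ 2 = x ^ 2 + 2 * t * (x * U x) + t ^ 2 * U x ^ 2 := fun x => by
      ring
    simp_rw [e]
    rw [integral_add (i3.fun_add (i4.const_mul _)) (i5.const_mul _),
      integral_add i3 (i4.const_mul _), integral_const_mul, integral_const_mul,
      integral_sq_gauss hK, integral_id_mul_stdz hU hK, integral_sq_stdz hU hK]

theorem variance_geodesic (hL : 0 < L) (V : VField) (t : ℝ) :
    variance id (geodesic (gauss L) V t) = L + 2 * t * (L * ∫ z, z * stdz L V z ∂stdGauss)
      + t ^ 2 * (L * (∫ z, stdz L V z ^ 2 ∂stdGauss) - (∫ y, V y ∂gauss L) ^ 2) := by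
  obtain ⟨h1, h2, h3⟩ := geodesicMap_moments hL V t
  have hm : Measurable fun x => x + t * V x := by fun_prop
  rw [geodesic, variance_map aemeasurable_id hm.aemeasurable, Function.id_comp,
    variance_eq_sub h1]
  simp only [Pi.pow_apply, h2, h3]
  ring

theorem entropy_smoothed_expansion (hK : 0 < K) (hu : 0 < u) {M : ℝ} (hM : 0 ≤ M) :
    ∃ C, 0 < C ∧ ∀ U : VField, (∀ x, |U x| ≤ M) → ∀ t : ℝ, |t| ≤ 1 →
      |diffEntropy ((geodesic (gauss K) U t).conv (gauss u))
        - (Real.log (2 * Real.pi * (K + u)) / 2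
          + (K + 2 * t * (K * ∫ z, z * stdz K U z ∂stdGauss)
            + t ^ 2 * (K * ∫ z, stdz K U z ^ 2 ∂stdGauss) + u) / (2 * (K + u))
          - t ^ 2 / 2 * ouNorm (gaussDiv (stdz K U)) (K / (K + u)))| ≤ C * |t| ^ 3 := by
  obtain ⟨C, hC, h⟩ := entropy_expansion (Ω := ℝ) hK hu M hM
  refine ⟨C, hC, fun U hU t ht => ?_⟩
  have := h (gauss K) id U measurable_id U.continuous.measurable Measure.map_id hU t ht
  simp only [densResponse_single hK hu U.isTest, id] at this
  obtain ⟨B, _, hB⟩ := (U.isTest.stdz hK).gaussDiv.bounded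
  have hc := continuous_ou (U.isTest.stdz hK).gaussDiv.continuous hB (K / (K + u))
  have hS : 0 < K + u := by positivity
  rw [(geodesicMap_moments hK U t).2.2, integral_gauss_eq_std
    (f := fun y => ou (K / (K + u)) (gaussDiv (stdz K U)) (y / √(K + u)) ^ 2) hS.le
    (by fun_prop : Continuous _).measurable] at this
  simp only [mul_div_cancel_left₀ _ (Real.sqrt_pos.2 hS).ne'] at this
  exact this

theorem entropy_sum_expansion (hK : 0 < K) (hL : 0 < L) (hu : 0 < u) {M : ℝ} (hM : 0 ≤ M) :
    ∃ C, 0 < C ∧ ∀ U V : VField, (∀ x, |U x| ≤ M) → (∀ x, |V x| ≤ M) → ∀ t : ℝ, |t| ≤ 1 →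
      |diffEntropy (((geodesic (gauss K) U t).conv (geodesic (gauss L) V t)).conv (gauss u))
        - (Real.log (2 * Real.pi * (K + L + u)) / 2
          + ((K + 2 * t * (K * ∫ z, z * stdz K U z ∂stdGauss)
              + t ^ 2 * (K * ∫ z, stdz K U z ^ 2 ∂stdGauss))
            + 2 * (t * ∫ x, U x ∂gauss K) * (t * ∫ y, V y ∂gauss L)
            + (L + 2 * t * (L * ∫ z, z * stdz L V z ∂stdGauss)
              + t ^ 2 * (L * ∫ z, stdz L V z ^ 2 ∂stdGauss)) + u) / (2 * (K + L + u))
          - t ^ 2 / 2 * ∫ z, (ou (K / (K + L + u)) (gaussDiv (stdz K U)) z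
            + ou (L / (K + L + u)) (gaussDiv (stdz L V)) z) ^ 2 ∂stdGauss)| ≤ C * |t| ^ 3 := by
  obtain ⟨C, hC, h⟩ := entropy_expansion (Ω := ℝ × ℝ) (add_pos hK hL) hu (2 * M) (by positivity)
  refine ⟨C, hC, fun U V hU hV t ht => ?_⟩
  have hA : ((gauss K).prod (gauss L)).map (fun p : ℝ × ℝ => p.1 + p.2) = gauss (K + L) :=
    gauss_conv_gauss hK.le hL.le
  have := h ((gauss K).prod (gauss L)) (fun p => p.1 + p.2) (fun p => U p.1 + V p.2)
    (by fun_prop) (by fun_prop) hA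
    (fun p => (abs_add_le _ _).trans (by linarith [hU p.1, hV p.2])) t ht
  simp only [densResponse_pair hK hL hu U.isTest V.isTest] at this
  obtain ⟨B, _, hB⟩ := (U.isTest.stdz hK).gaussDiv.bounded
  have hc := continuous_ou (U.isTest.stdz hK).gaussDiv.continuous hB (K / (K + L + u))
  obtain ⟨B', _, hB'⟩ := (V.isTest.stdz hL).gaussDiv.bounded
  have hc' := continuous_ou (V.isTest.stdz hL).gaussDiv.continuous hB' (L / (K + L + u))
  have hS : 0 < K + L + u := by positivity
  rw [integral_gauss_eq_std (f := fun y => (ou (K / (K + L + u)) (gaussDiv (stdz K U))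
      (y / √(K + L + u)) + ou (L / (K + L + u)) (gaussDiv (stdz L V)) (y / √(K + L + u))) ^ 2)
    hS.le (by fun_prop : Continuous _).measurable] at this
  simp only [mul_div_cancel_left₀ _ (Real.sqrt_pos.2 hS).ne'] at this
  have hgeo : ((gauss K).prod (gauss L)).map
      (fun p : ℝ × ℝ => p.1 + p.2 + t * (U p.1 + V p.2))
      = (geodesic (gauss K) U t).conv (geodesic (gauss L) V t) := by
    have m1 : Measurable fun x => x + t * U x := by fun_prop
    have m2 : Measurable fun x => x + t * V x := by fun_prop
    rw [Measure.conv, geodesic, geodesic, Measure.map_prod_map _ _ m1 m2,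
      Measure.map_map (by fun_prop) (m1.prodMap m2)]
    congr 1
    ext p
    simp only [Function.comp, Prod.map]
    ring
  obtain ⟨u1, u2, u3⟩ := geodesicMap_moments hK U t
  obtain ⟨v1, v2, v3⟩ := geodesicMap_moments hL V t
  have hmom : ∫ p : ℝ × ℝ, (p.1 + p.2 + t * (U p.1 + V p.2)) ^ 2 ∂((gauss K).prod (gauss L))
      = (K + 2 * t * (K * ∫ z, z * stdz K U z ∂stdGauss)
              + t ^ 2 * (K * ∫ z, stdz K U z ^ 2 ∂stdGauss))
            + 2 * (t * ∫ x, U x ∂gauss K) * (t * ∫ y, V y ∂gauss L)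
            + (L + 2 * t * (L * ∫ z, z * stdz L V z ∂stdGauss)
              + t ^ 2 * (L * ∫ z, stdz L V z ^ 2 ∂stdGauss)) := by
    have e : ∀ p : ℝ × ℝ, (p.1 + p.2 + t * (U p.1 + V p.2)) ^ 2
        = (p.1 + t * U p.1) ^ 2 + 2 * ((p.1 + t * U p.1) * (p.2 + t * V p.2))
          + (p.2 + t * V p.2) ^ 2 := fun p => by ring
    simp_rw [e]
    have i1 : Integrable (fun p : ℝ × ℝ => (p.1 + t * U p.1) ^ 2) ((gauss K).prod (gauss L)) :=
      u1.integrable_sq.comp_fst _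
    have i2 : Integrable (fun p : ℝ × ℝ => (p.1 + t * U p.1) * (p.2 + t * V p.2))
        ((gauss K).prod (gauss L)) :=
      (u1.integrable (by norm_num)).mul_prod (v1.integrable (by norm_num))
    have i3 : Integrable (fun p : ℝ × ℝ => (p.2 + t * V p.2) ^ 2) ((gauss K).prod (gauss L)) :=
      v1.integrable_sq.comp_snd _
    rw [integral_add (i1.fun_add (i2.const_mul 2)) i3, integral_add i1 (i2.const_mul 2),
      integral_const_mul,
      integral_prod_mul (f := fun x => x + t * U x) (g := fun x => x + t * V x),
      integral_fun_fst (f := fun x => (x + t * U x) ^ 2),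
      integral_fun_snd (f := fun x => (x + t * V x) ^ 2), u2, u3, v2, v3]
    simp only [probReal_univ, one_smul]
    ring
  rw [hgeo, hmom] at this
  exact this

/-- At a stationary Gaussian pair `Ψ_λ` has vanishing Wasserstein gradient and Hessian `hessForm`;
the remainder is uniform over bounded sets of vector fields. -/
theorem PsiLam_expansion {lam : ℝ} (hK : 0 < K) (hL : 0 < L) (hu : 0 < u)
    (hs : u / (K + L + u) + 1 / K - (1 + u) / (K + u) = 0) (hs' : u / (K + L + u) = 2 * lam)
    {M : ℝ} (hM : 0 < M) :
    ∃ C t₀ : ℝ, 0 < C ∧ 0 < t₀ ∧ ∀ U V : VField, (∀ x, |U x| ≤ M) → (∀ x, |deriv U x| ≤ M) →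
      (∀ x, |V x| ≤ M) → ∀ t : ℝ, |t| ≤ t₀ →
      |PsiLam u lam (geodesic (gauss K) U t) (geodesic (gauss L) V t)
        - PsiLam u lam (gauss K) (gauss L) - t ^ 2 / 2 * hessForm u K L hK hL (U, V) (U, V)|
        ≤ C * |t| ^ 3 := by
  obtain ⟨C₁, hC₁, h₁⟩ := entropy_smoothed_expansion hK hu hM.le
  obtain ⟨C₂, hC₂, h₂⟩ := entropy_sum_expansion hK hL hu hM.le
  refine ⟨u * C₂ + 2 * M ^ 3 + (1 + u) * C₁, min 1 (1 / (2 * M)), by positivity, by positivity,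
    fun U V hU hU' hV t ht => ?_⟩
  have ht1 : |t| ≤ 1 := ht.trans (min_le_left _ _)
  have htM : |t| * M ≤ 1 / 2 := by
    have := ht.trans (min_le_right _ _)
    rw [le_div_iff₀ (by positivity)] at this
    linarith
  have b1 := h₁ U hU t ht1
  have b2 := h₂ U V hU hV t ht1
  have b3 := geodesic_entropy_expansion hK U hU' htM
  have hUz := U.isTest.stdz hK
  rw [integral_deriv_stdz U.isTest hK, integral_deriv_sq_stdz U.isTest hK, ← hUz.stein] at b3
  have hN1 : ouNorm (gaussDiv (stdz K U)) 1
      = ∫ z, stdz K U z ^ 2 ∂stdGauss + ∫ z, deriv (stdz K U) z ^ 2 ∂stdGauss := by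
    rw [ouNorm, ou_one, integral_gaussDiv_sq hUz]
  rw [PsiLam_gauss hu hK hL, hessForm_self, PsiLam, Psi, variance_geodesic hL, hN1]
  set H₂ := diffEntropy (((geodesic (gauss K) U t).conv (geodesic (gauss L) V t)).conv (gauss u))
  set H₁ := diffEntropy ((geodesic (gauss K) U t).conv (gauss u))
  set H₀ := diffEntropy (geodesic (gauss K) U t)
  set e := ∫ z, z * stdz K U z ∂stdGauss
  set e' := ∫ z, z * stdz L V z ∂stdGauss
  set q := ∫ z, stdz K U z ^ 2 ∂stdGauss
  set q' := ∫ z, stdz L V z ^ 2 ∂stdGauss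
  set d := ∫ z, deriv (stdz K U) z ^ 2 ∂stdGauss
  set a := ∫ x, U x ∂gauss K
  set b := ∫ y, V y ∂gauss L
  set N := ouNorm (gaussDiv (stdz K U)) (K / (K + u))
  set G := ∫ z, (ou (K / (K + L + u)) (gaussDiv (stdz K U)) z
            + ou (L / (K + L + u)) (gaussDiv (stdz L V)) z) ^ 2 ∂stdGauss
  have hKu : 0 < K + u := by positivity
  have hS : 0 < K + L + u := by positivity
  set ℓ₂ := Real.log (2 * Real.pi * (K + L + u))
  set ℓ₁ := Real.log (2 * Real.pi * (K + u))
  set ℓ₀ := Real.log (2 * Real.pi * K)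
  rw [abs_le] at b1 b2 b3 ⊢
  have w1 := mul_le_mul_of_nonneg_left b1.1 (by positivity : 0 ≤ 1 + u)
  have w1' := mul_le_mul_of_nonneg_left b1.2 (by positivity : 0 ≤ 1 + u)
  have w2 := mul_le_mul_of_nonneg_left b2.1 hu.le
  have w2' := mul_le_mul_of_nonneg_left b2.2 hu.le
  have hlam : lam = u / (K + L + u) / 2 := by rw [hs']; ring
  -- the first-order terms, and the `e`, `q` terms of second order, cancel by stationarity
  have hid : u * (ℓ₂ / 2 + ((K + 2 * t * (K * e) + t ^ 2 * (K * q)) + 2 * (t * a) * (t * b)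
            + (L + 2 * t * (L * e') + t ^ 2 * (L * q')) + u) / (2 * (K + L + u))
            - t ^ 2 / 2 * G)
        + (ℓ₀ / 2 + 1 / 2 + t * e - t ^ 2 / 2 * d)
        - (1 + u) * (ℓ₁ / 2 + (K + 2 * t * (K * e) + t ^ 2 * (K * q) + u) / (2 * (K + u))
          - t ^ 2 / 2 * N)
        - lam * (L + 2 * t * (L * e') + t ^ 2 * (L * q' - b ^ 2))
      = (u * (ℓ₂ / 2 + 1 / 2) + (ℓ₀ / 2 + 1 / 2) - (1 + u) * (ℓ₁ / 2 + 1 / 2) - lam * L)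
        + t ^ 2 / 2 * ((1 + u) * N - (q + d) - u * G
          + u / (K + L + u) * (2 * a * b + b ^ 2)) := by
    have hX : (K * e * t + K * q * t ^ 2 / 2)
        * (u / (K + L + u) + 1 / K - (1 + u) / (K + u)) = 0 := by rw [hs, mul_zero]
    have hK1 : K * (1 / K) = 1 := by field_simp
    rw [hlam]
    have e1 : ∀ A : ℝ, (A + u) / (2 * (K + L + u))
      = 1 / 2 + (A - K - L) * (1 / (K + L + u)) / 2 := fun A => by field_simp; ring
    have e2 : ∀ A : ℝ, (A + u) / (2 * (K + u)) = 1 / 2 + (A - K) * (1 / (K + u)) / 2 := fun A => by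
      field_simp; ring
    rw [e1, e2]
    rw [div_eq_mul_one_div u, div_eq_mul_one_div (1 + u)] at hX
    rw [div_eq_mul_one_div u]
    generalize 1 / (K + L + u) = s at *
    generalize 1 / (K + u) = r at *
    generalize 1 / K = k at *
    linear_combination hX - (e * t + q * t ^ 2 / 2) * hK1
  constructor <;> nlinarith

end Expansion

/-! ### Negativity of the Hessian form -/

section Sign

variable {K L u : ℝ}

/-- Below the threshold the form is nonpositive on variance-preserving pairs. The Hermite modes of
`gaussDiv (stdz K U)` of degree at least three are controlled by the spectral gap; the modes of
degree one and two are compared with the same modes of the response of `p * q * γ_u`. -/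
theorem hessForm_nonpos (hK : 0 < K) (hL : 0 < L) (hu : 0 < u)
    (hs : u / (K + L + u) + 1 / K - (1 + u) / (K + u) = 0)
    (hρ : (1 + u) * (K / (K + u)) ^ 3 ≤ 1) (U V : VField)
    (hV : ∫ y, y * V y ∂gauss L = 0) : hessForm u K L hK hL (U, V) (U, V) ≤ 0 := by
  have hS : 0 < K + L + u := by positivity
  have hU' := U.isTest.stdz hK
  have hV' := V.isTest.stdz hL
  have r0 : 0 ≤ K / (K + L + u) := by positivity
  have r1 : K / (K + L + u) ≤ 1 := by rw [div_le_one hS]; linarith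
  have s0 : 0 ≤ L / (K + L + u) := by positivity
  have s1 : L / (K + L + u) ≤ 1 := by rw [div_le_one hS]; linarith
  have ρ0 : 0 ≤ K / (K + u) := by positivity
  have ρ1 : K / (K + u) ≤ 1 := by rw [div_le_one (by positivity)]; linarith
  rw [integral_id_mul_stdz V.isTest hL, mul_eq_zero, or_iff_right hL.ne'] at hV
  have hN := ouNorm_gaussDiv_le hU' ρ0 ρ1
  obtain ⟨B, _, hB⟩ := hU'.gaussDiv.bounded
  obtain ⟨B', _, hB'⟩ := hV'.gaussDiv.bounded
  have cU := fun c => continuous_ou hU'.gaussDiv.continuous hB c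
  have cV := fun c => continuous_ou hV'.gaussDiv.continuous hB' c
  have bU := fun c => ou_bdd hB c
  have bV := fun c => ou_bdd hB' c
  have hN1 := bessel_hermite (cU 1) (bU 1)
  obtain ⟨p1, p2⟩ := ou_hermite_coeff hU'.gaussDiv zero_le_one le_rfl
  rw [p1, p2, integral_deriv_gaussDiv hU', integral_deriv_deriv_gaussDiv hU', Real.sqrt_one,
    one_mul, one_mul] at hN1
  have hG := bessel_hermite ((cU (K / (K + L + u))).add (cV (L / (K + L + u)))) (C := B + B')
    (fun x => (abs_add_le _ _).trans (add_le_add (bU _ x) (bV _ x)))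
  simp only [Pi.add_apply, mul_add] at hG
  have q1 : ∀ c, Integrable (fun z => z * ou c (gaussDiv (stdz K U)) z) stdGauss := fun c =>
    integrable_id_mul_bdd (cU c) (bU c)
  have q2 : ∀ c, Integrable (fun z => z * ou c (gaussDiv (stdz L V)) z) stdGauss := fun c =>
    integrable_id_mul_bdd (cV c) (bV c)
  have q3 : ∀ c, Integrable (fun z => (z ^ 2 - 1) * ou c (gaussDiv (stdz K U)) z) stdGauss :=
    fun c => ((integrable_pow_std 2).sub (integrable_const 1)).mul_bdd (c := B)
      (cU c).aestronglyMeasurable (.of_forall (bU c))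
  have q4 : ∀ c, Integrable (fun z => (z ^ 2 - 1) * ou c (gaussDiv (stdz L V)) z) stdGauss :=
    fun c => ((integrable_pow_std 2).sub (integrable_const 1)).mul_bdd (c := B')
      (cV c).aestronglyMeasurable (.of_forall (bV c))
  rw [integral_add (q1 _) (q2 _), integral_add (q3 _) (q4 _),
    (ou_hermite_coeff hU'.gaussDiv r0 r1).1, (ou_hermite_coeff hU'.gaussDiv r0 r1).2,
    (ou_hermite_coeff hV'.gaussDiv s0 s1).1, (ou_hermite_coeff hV'.gaussDiv s0 s1).2,
    integral_deriv_gaussDiv hU', integral_deriv_deriv_gaussDiv hU', integral_deriv_gaussDiv hV',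
    integral_deriv_deriv_gaussDiv hV', hV, mul_zero, mul_zero, add_zero,
    Real.sqrt_div hK.le, Real.sqrt_div hL.le] at hG
  rw [hessForm_self, integral_stdz U.isTest hK, integral_stdz V.isTest hL]
  set m := ∫ z, stdz K U z ∂stdGauss
  set m' := ∫ z, stdz L V z ∂stdGauss
  set e := ∫ z, z * stdz K U z ∂stdGauss
  set N := ouNorm (gaussDiv (stdz K U)) (K / (K + u))
  have hN1' : m ^ 2 + 2 * e ^ 2 ≤ ouNorm (gaussDiv (stdz K U)) 1 := by
    refine le_trans (le_of_eq ?_) hN1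
    ring
  set N1 := ouNorm (gaussDiv (stdz K U)) 1
  set G := ∫ z, (ou (K / (K + L + u)) (gaussDiv (stdz K U)) z
    + ou (L / (K + L + u)) (gaussDiv (stdz L V)) z) ^ 2 ∂stdGauss
  have sK := Real.sq_sqrt hK.le
  have sL := Real.sq_sqrt hL.le
  have sS := Real.sq_sqrt hS.le
  have hsS : 0 < √(K + L + u) := Real.sqrt_pos.2 hS
  have hG' : (√K * m + √L * m') ^ 2 / (K + L + u) + 2 * (K / (K + L + u)) ^ 2 * e ^ 2 ≤ G := by
    refine le_trans (le_of_eq ?_) hG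
    have : √K / √(K + L + u) * m + √L / √(K + L + u) * m'
        = (√K * m + √L * m') / √(K + L + u) := by field_simp
    rw [this, div_pow (√K * m + √L * m'), sS]
    ring
  set ρ := K / (K + u) with hρd
  set r := K / (K + L + u) with hrd
  -- stationarity, in terms of the variance fractions
  have hrρ : u * r = (1 + u) * ρ - 1 := by
    have h0 : K * (u / (K + L + u) + 1 / K - (1 + u) / (K + u)) = 0 := by rw [hs, mul_zero]
    have h1 : K * (1 / K) = 1 := by field_simp
    have h2 : K * (u / (K + L + u)) = u * r := by rw [hrd]; ring
    have h3 : K * ((1 + u) / (K + u)) = (1 + u) * ρ := by rw [hρd]; ring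
    linarith [h0, h1, h2, h3, mul_sub K (u / (K + L + u) + 1 / K) ((1 + u) / (K + u)),
      mul_add K (u / (K + L + u)) (1 / K)]
  -- the coefficient of the mode of degree two, nonpositive by stationarity alone
  have hmode2 : (1 + u) * ρ ^ 2 - 1 - u * r ^ 2 ≤ 0 := by
    have h1 : u * ((1 + u) * ρ ^ 2 - 1 - u * r ^ 2) = -((1 + u) * (1 - ρ) ^ 2) := by
      have : u * (u * r ^ 2) = (u * r) ^ 2 := by ring
      rw [mul_sub, this, hrρ]
      ring
    by_contra hcon
    push Not at hcon
    have := mul_pos hu hcon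
    rw [h1] at this
    nlinarith [sq_nonneg (1 - ρ)]
  have hlin : u / (K + L + u) * (2 * (√K * m) * (√L * m') + (√L * m') ^ 2)
      - u * ((√K * m + √L * m') ^ 2 / (K + L + u)) = -(u * r) * m ^ 2 := by
    rw [hrd]
    have : (√K * m + √L * m') ^ 2 = 2 * (√K * m) * (√L * m') + (√L * m') ^ 2 + √K ^ 2 * m ^ 2 := by
      ring
    rw [this, sK]
    ring
  -- the gap hypothesis settles the modes of degree at least three, `hmode2` that of degree two, and
  -- the modes of degree one cancel against the mean terms of the form
  have hNm := mul_le_mul_of_nonneg_left hN (by positivity : 0 ≤ 1 + u)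
  have hGm := mul_le_mul_of_nonneg_left hG' hu.le
  have hgap := mul_le_mul_of_nonneg_right hρ (sub_nonneg.2 hN1')
  have he := mul_nonneg (sub_nonneg.2 hmode2) (sq_nonneg e)
  rw [hrρ] at hlin
  clear_value m m' e N N1 G ρ r
  generalize (√K * m + √L * m') ^ 2 / (K + L + u) = A at *
  generalize u / (K + L + u) * (2 * (√K * m) * (√L * m') + (√L * m') ^ 2) = B at *
  linarith

/-! ### Positivity above the threshold -/

/-- Test functions as bundled vector fields. -/
def IsTest.toVField {f : ℝ → ℝ} (hf : IsTest f) : VField :=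
  ⟨f, hf.contDiff, hf.compact, by simp⟩

theorem IsTest.coe_toVField {f : ℝ → ℝ} (hf : IsTest f) : ⇑hf.toVField = f := rfl

/-- A fixed smooth even cutoff, equal to one near the origin. -/
def bump : ContDiffBump (0 : ℝ) := ⟨1, 2, one_pos, one_lt_two⟩

theorem isTest_bump : IsTest bump := ⟨bump.contDiff, bump.hasCompactSupport⟩

/-- The second Hermite polynomial `z² - 1`, cut off at scale `n + 1`. -/
def cutHermite (n : ℕ) (z : ℝ) : ℝ := (z ^ 2 - 1) * bump ((n + 1 : ℝ)⁻¹ * z)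

theorem isTest_cutHermite (n : ℕ) : IsTest (cutHermite n) :=
  (isTest_bump.comp_mul (by positivity : (n + 1 : ℝ)⁻¹ ≠ 0)).contDiff_mul
    ((contDiff_id.pow 2).sub contDiff_const)

theorem cutHermite_neg (n : ℕ) (z : ℝ) : cutHermite n (-z) = cutHermite n z := by
  rw [cutHermite, cutHermite, mul_neg, bump.neg, neg_sq]

theorem gaussDiv_cutHermite (n : ℕ) (z : ℝ) :
    gaussDiv (cutHermite n) z = (z ^ 3 - 3 * z) * bump ((n + 1 : ℝ)⁻¹ * z)
      - (n + 1 : ℝ)⁻¹ * ((z ^ 2 - 1) * deriv bump ((n + 1 : ℝ)⁻¹ * z)) := by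
  have h1 : HasDerivAt (fun z => (n + 1 : ℝ)⁻¹ * z) (n + 1 : ℝ)⁻¹ z := by
    simpa using (hasDerivAt_id z).const_mul (n + 1 : ℝ)⁻¹
  have h2 := HasDerivAt.comp (h₂ := bump) z (isTest_bump.hasDerivAt _) h1
  have h3 : HasDerivAt (fun z : ℝ => z ^ 2 - 1) (2 * z) z := by
    simpa using (hasDerivAt_pow 2 z).sub_const 1
  have h4 : HasDerivAt (cutHermite n) (2 * z * bump ((n + 1 : ℝ)⁻¹ * z)
      + (z ^ 2 - 1) * (deriv bump ((n + 1 : ℝ)⁻¹ * z) * (n + 1 : ℝ)⁻¹)) z := h3.mul h2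
  rw [gaussDiv, h4.deriv, cutHermite]
  ring

theorem tendsto_inv_mul (z : ℝ) :
    Tendsto (fun n : ℕ => (n + 1 : ℝ)⁻¹ * z) atTop (𝓝 0) := by
  have : Tendsto (fun n : ℕ => (n + 1 : ℝ)⁻¹) atTop (𝓝 0) := by
    simpa [one_div] using tendsto_one_div_add_atTop_nhds_zero_nat (𝕜 := ℝ)
  simpa using this.mul_const z

theorem tendsto_bump (z : ℝ) :
    Tendsto (fun n : ℕ => bump ((n + 1 : ℝ)⁻¹ * z)) atTop (𝓝 1) := by
  have h := (bump.continuous.tendsto 0).comp (tendsto_inv_mul z)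
  rwa [bump.one_of_mem_closedBall (by simp [bump])] at h

theorem exists_gaussDiv_cutHermite_bound :
    ∃ D, 0 ≤ D ∧ ∀ n z, |gaussDiv (cutHermite n) z| ≤ D * (1 + z ^ 4) := by
  obtain ⟨C, hC0, hC⟩ := isTest_bump.deriv.bounded
  refine ⟨4 + 2 * C, by positivity, fun n z => ?_⟩
  have hi : |(n + 1 : ℝ)⁻¹| ≤ 1 := by
    rw [abs_of_nonneg (by positivity)]
    exact inv_le_one_of_one_le₀ (by linarith [n.cast_nonneg (α := ℝ)])
  have hb : |bump ((n + 1 : ℝ)⁻¹ * z)| ≤ 1 := by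
    rw [abs_of_nonneg bump.nonneg]; exact bump.le_one
  have h3 : |z ^ 3 - 3 * z| ≤ 4 * (1 + z ^ 4) := by
    rw [abs_le]
    constructor <;> nlinarith [sq_nonneg (z ^ 2 - z), sq_nonneg (z ^ 2 + z), sq_nonneg (z - 1),
      sq_nonneg (z + 1), sq_nonneg (z ^ 2 - 1)]
  have h2 : |z ^ 2 - 1| ≤ 2 * (1 + z ^ 4) := by
    rw [abs_le]
    constructor <;> nlinarith [sq_nonneg (z ^ 2 - 1), sq_nonneg z, sq_nonneg (z ^ 2)]
  rw [gaussDiv_cutHermite]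
  refine (abs_sub _ _).trans ?_
  rw [abs_mul, abs_mul, abs_mul]
  have hz : 0 ≤ 1 + z ^ 4 := by positivity
  have k1 := mul_le_mul h3 hb (abs_nonneg _) (by positivity)
  have k2 := mul_le_mul hi (mul_le_mul h2 (hC ((n + 1 : ℝ)⁻¹ * z)) (abs_nonneg _) (by positivity))
    (by positivity) zero_le_one
  linarith

theorem tendsto_gaussDiv_cutHermite (z : ℝ) :
    Tendsto (fun n => gaussDiv (cutHermite n) z) atTop (𝓝 (z ^ 3 - 3 * z)) := by
  obtain ⟨C, hC0, hC⟩ := isTest_bump.deriv.bounded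
  simp_rw [gaussDiv_cutHermite]
  have h1 := (tendsto_bump z).const_mul (z ^ 3 - 3 * z)
  have h2 : Tendsto (fun n : ℕ => (n + 1 : ℝ)⁻¹
      * ((z ^ 2 - 1) * deriv bump ((n + 1 : ℝ)⁻¹ * z))) atTop (𝓝 0) := by
    have h3 := (isTest_bump.deriv.continuous.tendsto 0).comp (tendsto_inv_mul z)
    have h4 := (tendsto_inv_mul 1).mul (h3.const_mul (z ^ 2 - 1))
    simpa using h4
  simpa using h1.sub h2

theorem integral_affine_hermite {a b : ℝ} (h : a ^ 2 + b ^ 2 = 1) (z : ℝ) :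
    ∫ w, ((a * z + b * w) ^ 3 - 3 * (a * z + b * w)) ∂stdGauss = a ^ 3 * (z ^ 3 - 3 * z) := by
  have e : ∀ w, (a * z + b * w) ^ 3 - 3 * (a * z + b * w)
      = b ^ 3 * w ^ 3 + 3 * a * b ^ 2 * z * w ^ 2 + (3 * a ^ 2 * b * z ^ 2 - 3 * b) * w
        + (a ^ 3 * z ^ 3 - 3 * a * z) := fun w => by ring
  have j1 := integrable_id_std
  have j2 := integrable_pow_std 2
  have j3 := integrable_pow_std 3
  have m3 : ∫ z, z ^ 3 ∂stdGauss = 0 := by rw [integral_pow_add_two_std 1]; simp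
  simp_rw [e]
  rw [integral_add (((j3.const_mul _).fun_add (j2.const_mul _)).fun_add (j1.const_mul _))
      (integrable_const _),
    integral_add ((j3.const_mul _).fun_add (j2.const_mul _)) (j1.const_mul _),
    integral_add (j3.const_mul _) (j2.const_mul _), integral_const_mul, integral_const_mul,
    integral_const_mul, m3, integral_sq_std, integral_id_std, integral_const, probReal_univ,
    smul_eq_mul]
  have : b ^ 2 = 1 - a ^ 2 := by linarith
  rw [this]
  ring

theorem affine_quartic_bound {a b : ℝ} (h : a ^ 2 + b ^ 2 = 1) (z w : ℝ) :
    (a * z + b * w) ^ 4 ≤ 8 * (z ^ 4 + w ^ 4) := by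
  have h1 : (a * z + b * w) ^ 2 ≤ z ^ 2 + w ^ 2 := by
    nlinarith [sq_nonneg (a * w - b * z)]
  have h2 := pow_le_pow_left₀ (sq_nonneg _) h1 2
  nlinarith [sq_nonneg (z ^ 2 - w ^ 2), sq_nonneg (z ^ 2), sq_nonneg (w ^ 2)]

theorem sq_sqrt_add_sq_sqrt {c : ℝ} (h0 : 0 ≤ c) (h1 : c ≤ 1) : √c ^ 2 + √(1 - c) ^ 2 = 1 := by
  rw [Real.sq_sqrt h0, Real.sq_sqrt (sub_nonneg.2 h1)]; ring

theorem ou_cutHermite_bound {D : ℝ} (hD0 : 0 ≤ D)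
    (hD : ∀ n z, |gaussDiv (cutHermite n) z| ≤ D * (1 + z ^ 4)) {c : ℝ} (h0 : 0 ≤ c) (h1 : c ≤ 1)
    (n : ℕ) (z : ℝ) : |ou c (gaussDiv (cutHermite n)) z| ≤ D * (25 + 8 * z ^ 4) := by
  have m4 : ∫ z, z ^ 4 ∂stdGauss = 3 := by
    rw [integral_pow_add_two_std 2, integral_sq_std]; norm_num
  have hb : Integrable (fun w => D * (1 + 8 * z ^ 4 + 8 * w ^ 4)) stdGauss :=
    ((integrable_const _).add ((integrable_pow_std 4).const_mul 8)).const_mul D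
  have := norm_integral_le_of_norm_le (μ := stdGauss)
    (f := fun w => gaussDiv (cutHermite n) (√c * z + √(1 - c) * w)) hb (.of_forall fun w => by
      refine (hD n _).trans (mul_le_mul_of_nonneg_left ?_ hD0)
      linarith [affine_quartic_bound (sq_sqrt_add_sq_sqrt h0 h1) z w])
  rw [integral_const_mul, integral_add (integrable_const _) ((integrable_pow_std 4).const_mul 8),
    integral_const_mul, m4, integral_const, probReal_univ, smul_eq_mul] at this
  refine this.trans (le_of_eq ?_)
  ring

/-- In the limit of no cutoff the divergence is the third Hermite polynomial, an eigenfunction of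
`ou c` with eigenvalue `√c ^ 3`. -/
theorem tendsto_ou_cutHermite {c : ℝ} (h0 : 0 ≤ c) (h1 : c ≤ 1) (z : ℝ) :
    Tendsto (fun n => ou c (gaussDiv (cutHermite n)) z) atTop (𝓝 (√c ^ 3 * (z ^ 3 - 3 * z))) := by
  obtain ⟨D, hD0, hD⟩ := exists_gaussDiv_cutHermite_bound
  rw [← integral_affine_hermite (sq_sqrt_add_sq_sqrt h0 h1)]
  refine tendsto_integral_of_dominated_convergence
    (fun w => D * (1 + 8 * z ^ 4 + 8 * w ^ 4)) (fun n => ?_)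
    (((integrable_const _).add ((integrable_pow_std 4).const_mul 8)).const_mul D) (fun n => ?_) ?_
  · have := (isTest_cutHermite n).gaussDiv.continuous
    exact (by fun_prop : Continuous fun w =>
      gaussDiv (cutHermite n) (√c * z + √(1 - c) * w)).aestronglyMeasurable
  · refine .of_forall fun w => (hD n _).trans (mul_le_mul_of_nonneg_left ?_ hD0)
    linarith [affine_quartic_bound (sq_sqrt_add_sq_sqrt h0 h1) z w]
  · exact .of_forall fun w => tendsto_gaussDiv_cutHermite _

theorem integral_hermite_three_sq : ∫ z, (z ^ 3 - 3 * z) ^ 2 ∂stdGauss = 6 := by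
  have m2 := integral_sq_std
  have m4 : ∫ z, z ^ 4 ∂stdGauss = 3 := by rw [integral_pow_add_two_std 2, m2]; norm_num
  have m6 : ∫ z, z ^ 6 ∂stdGauss = 15 := by rw [integral_pow_add_two_std 4, m4]; norm_num
  have e : ∀ z : ℝ, (z ^ 3 - 3 * z) ^ 2 = z ^ 6 - 6 * z ^ 4 + 9 * z ^ 2 := fun z => by ring
  simp_rw [e]
  rw [integral_add (integrable_fun_sub (integrable_pow_std 6) ((integrable_pow_std 4).const_mul 6))
    ((integrable_pow_std 2).const_mul 9), integral_sub (integrable_pow_std 6)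
    ((integrable_pow_std 4).const_mul 6), integral_const_mul, integral_const_mul, m2, m4, m6]
  norm_num

theorem tendsto_integral_ou_cutHermite {c d : ℝ} (c0 : 0 ≤ c) (c1 : c ≤ 1) (d0 : 0 ≤ d)
    (d1 : d ≤ 1) (β : ℝ) :
    Tendsto (fun n => ∫ z, (ou c (gaussDiv (cutHermite n)) z
      + β * ou d (gaussDiv (cutHermite n)) z) ^ 2 ∂stdGauss) atTop
      (𝓝 (6 * (√c ^ 3 + β * √d ^ 3) ^ 2)) := by
  obtain ⟨D, hD0, hD⟩ := exists_gaussDiv_cutHermite_bound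
  have e : 6 * (√c ^ 3 + β * √d ^ 3) ^ 2 = ∫ z, (√c ^ 3 * (z ^ 3 - 3 * z)
      + β * (√d ^ 3 * (z ^ 3 - 3 * z))) ^ 2 ∂stdGauss := by
    have : ∀ z : ℝ, (√c ^ 3 * (z ^ 3 - 3 * z) + β * (√d ^ 3 * (z ^ 3 - 3 * z))) ^ 2
      = (√c ^ 3 + β * √d ^ 3) ^ 2 * (z ^ 3 - 3 * z) ^ 2 := fun z => by ring
    simp_rw [this]
    rw [integral_const_mul, integral_hermite_three_sq, mul_comm]
  rw [e]
  refine tendsto_integral_of_dominated_convergence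
    (fun z => ((1 + |β|) * D) ^ 2 * (625 + 400 * z ^ 4 + 64 * z ^ 8)) (fun n => ?_) ?_
    (fun n => ?_) (.of_forall fun z => ?_)
  · obtain ⟨C, _, hC⟩ := (isTest_cutHermite n).gaussDiv.bounded
    have k1 := continuous_ou (isTest_cutHermite n).gaussDiv.continuous hC c
    have k2 := continuous_ou (isTest_cutHermite n).gaussDiv.continuous hC d
    exact (by fun_prop : Continuous _).aestronglyMeasurable
  · exact (((integrable_const _).add ((integrable_pow_std 4).const_mul _)).add
      ((integrable_pow_std 8).const_mul _)).const_mul _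
  · refine .of_forall fun z => ?_
    have b1 := ou_cutHermite_bound hD0 hD c0 c1 n z
    have b2 := ou_cutHermite_bound hD0 hD d0 d1 n z
    have b3 : |ou c (gaussDiv (cutHermite n)) z + β * ou d (gaussDiv (cutHermite n)) z|
        ≤ (1 + |β|) * D * (25 + 8 * z ^ 4) := by
      refine (abs_add_le _ _).trans ?_
      rw [abs_mul]
      have := mul_le_mul_of_nonneg_left b2 (abs_nonneg β)
      linarith
    rw [norm_pow, Real.norm_eq_abs]
    refine (pow_le_pow_left₀ (abs_nonneg _) b3 2).trans (le_of_eq ?_)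
    ring
  · exact ((tendsto_ou_cutHermite c0 c1 z).add
      ((tendsto_ou_cutHermite d0 d1 z).const_mul β)).pow 2

theorem tendsto_integral_cutHermite :
    Tendsto (fun n => ∫ z, cutHermite n z ∂stdGauss) atTop (𝓝 0) := by
  have e : (0 : ℝ) = ∫ z, (z ^ 2 - 1) * 1 ∂stdGauss := by
    simp only [mul_one]
    rw [integral_sub (integrable_pow_std 2) (integrable_const _), integral_sq_std]
    simp
  rw [e]
  refine tendsto_integral_of_dominated_convergence (fun z => z ^ 2 + 1)
    (fun n => (isTest_cutHermite n).continuous.aestronglyMeasurable)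
    ((integrable_pow_std 2).add (integrable_const _)) (fun n => .of_forall fun z => ?_)
    (.of_forall fun z => (tendsto_bump z).const_mul _)
  rw [cutHermite, norm_mul, Real.norm_of_nonneg bump.nonneg]
  refine (mul_le_of_le_one_right (norm_nonneg _) bump.le_one).trans ?_
  refine (norm_sub_le _ _).trans ?_
  simp

theorem integral_odd_gauss {L : ℝ} {f : ℝ → ℝ} (hf : ∀ x, f (-x) = -f x) :
    ∫ x, f x ∂gauss L = 0 := by
  have h : ∫ x, f x ∂gauss L = ∫ x, f (-x) ∂gauss L := by
    have hm := gaussianReal_map_neg (μ := 0) (v := L.toNNReal)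
    rw [neg_zero] at hm
    conv_lhs => rw [gauss, ← hm]
    exact (MeasurableEquiv.neg ℝ).measurableEmbedding.integral_map f
  simp_rw [hf, integral_neg] at h
  linarith

/-- Above the threshold the form takes a positive value on the variance-preserving subspace: the
fields are truncations of Hermite polynomials of degree two, scaled so that their joint response
vanishes in the limit. -/
theorem exists_hessForm_pos (hK : 0 < K) (hL : 0 < L) (hu : 0 < u)
    (hρ : 1 < (1 + u) * (K / (K + u)) ^ 3) :
    ∃ U V : VField, ∫ y, y * V y ∂gauss L = 0 ∧ 0 < hessForm u K L hK hL (U, V) (U, V) := by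
  have hS : 0 < K + L + u := by positivity
  have r0 : 0 ≤ K / (K + L + u) := by positivity
  have r1 : K / (K + L + u) ≤ 1 := by rw [div_le_one hS]; linarith
  have s0 : 0 < L / (K + L + u) := by positivity
  have s1 : L / (K + L + u) ≤ 1 := by rw [div_le_one hS]; linarith
  have ρ0 : 0 ≤ K / (K + u) := by positivity
  have ρ1 : K / (K + u) ≤ 1 := by rw [div_le_one (by positivity)]; linarith
  -- this ratio cancels the limiting response of `p * q * γ_u`
  set θ : ℝ := -(√(K / (K + L + u)) ^ 3 / √(L / (K + L + u)) ^ 3) with hθ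
  have hθ0 : √(K / (K + L + u)) ^ 3 + θ * √(L / (K + L + u)) ^ 3 = 0 := by
    have : √(L / (K + L + u)) ≠ 0 := (Real.sqrt_pos.2 s0).ne'
    rw [hθ]
    field_simp
    ring
  have hsK := Real.sqrt_pos.2 hK
  have hsL := Real.sqrt_pos.2 hL
  have hf : ∀ (J a : ℝ), 0 < J → ∀ n, IsTest fun x => a * cutHermite n ((√J)⁻¹ * x) :=
    fun J a hJ n => ((isTest_cutHermite n).comp_mul
      (inv_pos.2 (Real.sqrt_pos.2 hJ)).ne').contDiff_mul contDiff_const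
  set U : ℕ → VField := fun n => (hf K √K hK n).toVField with hU
  set V : ℕ → VField := fun n => (hf L (√L * θ) hL n).toVField with hV
  have eU : ∀ n, stdz K (U n) = cutHermite n := fun n => by
    ext z
    simp only [stdz, hU, IsTest.coe_toVField]
    rw [inv_mul_cancel_left₀ hsK.ne', mul_div_cancel_left₀ _ hsK.ne']
  have eV : ∀ n, stdz L (V n) = fun z => θ * cutHermite n z := fun n => by
    ext z
    simp only [stdz, hV, IsTest.coe_toVField]
    rw [inv_mul_cancel_left₀ hsL.ne', mul_assoc, mul_div_cancel_left₀ _ hsL.ne']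
  have gV : ∀ n c z, ou c (gaussDiv (stdz L (V n))) z
      = θ * ou c (gaussDiv (cutHermite n)) z := fun n c z => by
    rw [← ou_const_mul]
    congr 1
    ext x
    rw [eV, gaussDiv, (((isTest_cutHermite n).hasDerivAt x).const_mul θ).deriv, gaussDiv]
    ring
  have t1 : ∀ c, 0 ≤ c → c ≤ 1 →
      Tendsto (fun n => ouNorm (gaussDiv (stdz K (U n))) c) atTop (𝓝 (6 * c ^ 3)) := by
    intro c h0 h1
    have := tendsto_integral_ou_cutHermite h0 h1 h0 h1 0
    simp only [zero_mul, add_zero] at this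
    rw [← pow_mul, mul_comm 3 2, pow_mul, Real.sq_sqrt h0] at this
    simp only [eU]
    exact this
  have t2 := tendsto_integral_ou_cutHermite r0 r1 s0.le s1 θ
  rw [hθ0] at t2
  have t3 : Tendsto (fun n => ∫ x, U n x ∂gauss K) atTop (𝓝 0) := by
    have := tendsto_integral_cutHermite.const_mul √K
    rw [mul_zero] at this
    refine this.congr fun n => ?_
    rw [integral_stdz (U n).isTest hK, eU]
  have t4 : Tendsto (fun n => ∫ y, V n y ∂gauss L) atTop (𝓝 0) := by
    have := tendsto_integral_cutHermite.const_mul (√L * θ)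
    rw [mul_zero] at this
    refine this.congr fun n => ?_
    rw [integral_stdz (V n).isTest hL, eV, integral_const_mul, mul_assoc]
  have hlim : Tendsto (fun n => hessForm u K L hK hL (U n, V n) (U n, V n)) atTop
      (𝓝 (6 * ((1 + u) * (K / (K + u)) ^ 3 - 1))) := by
    have := ((((t1 _ ρ0 ρ1).const_mul (1 + u)).sub (t1 1 zero_le_one le_rfl)).sub
      (t2.const_mul u)).add ((((t3.const_mul 2).mul t4).add (t4.pow 2)).const_mul
        (u / (K + L + u)))
    have e : (1 + u) * (6 * (K / (K + u)) ^ 3) - 6 * 1 ^ 3 - u * (6 * 0 ^ 2)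
        + u / (K + L + u) * (2 * 0 * 0 + 0 ^ 2) = 6 * ((1 + u) * (K / (K + u)) ^ 3 - 1) := by ring
    rw [e] at this
    refine this.congr fun n => ?_
    rw [hessForm_self]
    simp only [gV]
    rw [eU]
  have hpos : 0 < 6 * ((1 + u) * (K / (K + u)) ^ 3 - 1) := by linarith
  obtain ⟨n, hn⟩ := (hlim.eventually (lt_mem_nhds hpos)).exists
  refine ⟨U n, V n, integral_odd_gauss fun y => ?_, hn⟩
  simp only [hV, IsTest.coe_toVField, mul_neg, cutHermite_neg, neg_mul]

end Sign

/-! ### The threshold -/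

theorem le_threshold_iff {K u : ℝ} (hK : 0 < K) (hu : 0 < u) :
    K ≤ u / ((1 + u) ^ ((1 : ℝ) / 3) - 1) ↔ (1 + u) * (K / (K + u)) ^ 3 ≤ 1 := by
  set c := (1 + u) ^ ((1 : ℝ) / 3) with hc
  have hc3 : c ^ 3 = 1 + u := by
    rw [hc, ← Real.rpow_natCast, ← Real.rpow_mul (by linarith)]
    norm_num
  have hc1 : 1 < c := Real.one_lt_rpow (by linarith) (by norm_num)
  have hKu : 0 < K + u := by positivity
  rw [le_div_iff₀ (by linarith), ← hc3, ← mul_pow,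
    pow_le_one_iff_of_nonneg (by positivity) three_ne_zero, ← mul_div_assoc, div_le_one hKu]
  constructor <;> intro h <;> linarith

/-! ### Wasserstein distance along geodesics -/

/-- The coupling of `x` with `x + t U x` bounds the distance. -/
theorem w2_geodesic_le (p : Measure ℝ) [IsProbabilityMeasure p] (U : VField) {M : ℝ}
    (hU : ∀ x, |U x| ≤ M) (t : ℝ) : w2 (geodesic p U t) p ≤ ENNReal.ofReal (|t| * M) := by
  have hT : Measurable fun x => x + t * U x := by fun_prop
  have hF : Measurable fun x => (x + t * U x, x) := hT.prodMk measurable_id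
  have hb : ⨅ π ∈ {π : Measure (ℝ × ℝ) | π.map Prod.fst = geodesic p U t ∧ π.map Prod.snd = p},
      ∫⁻ z, edist z.1 z.2 ^ 2 ∂π ≤ ENNReal.ofReal (|t| * M) ^ 2 := by
    refine (iInf₂_le (p.map fun x => (x + t * U x, x)) ⟨?_, ?_⟩).trans ?_
    · rw [lintegral_map (f := fun z : ℝ × ℝ => edist z.1 z.2 ^ 2) (by fun_prop) hF]
      refine (lintegral_mono (g := fun _ => ENNReal.ofReal (|t| * M) ^ 2) fun x => ?_).trans ?_
      · refine pow_le_pow_left' ?_ 2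
        rw [edist_dist, Real.dist_eq, add_sub_cancel_left, abs_mul]
        exact ENNReal.ofReal_le_ofReal (mul_le_mul_of_nonneg_left (hU x) (abs_nonneg t))
      · simp
    · rw [Measure.map_map measurable_fst hF]; rfl
    · rw [Measure.map_map measurable_snd hF]; exact Measure.map_id
  refine (ENNReal.rpow_le_rpow hb (by norm_num)).trans (le_of_eq ?_)
  rw [← ENNReal.rpow_natCast, ← ENNReal.rpow_mul]
  norm_num

/-! ### Existence of the Hessian -/

/-- The gradient at a stationary Gaussian pair is zero. -/
theorem isW2Hessian_hessForm {u lam K L : ℝ} (hK : 0 < K) (hL : 0 < L) (hu : 0 < u)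
    (hs : u / (K + L + u) + 1 / K - (1 + u) / (K + u) = 0) (hs' : u / (K + L + u) = 2 * lam) :
    IsW2Hessian (PsiLam u lam) (gauss K) (gauss L) (hessForm u K L hK hL) := by
  refine ⟨hessForm_isSymm u K L hK hL, 0, 0, MemLp.zero, MemLp.zero, fun U V => ?_⟩
  obtain ⟨A, hA0, hA⟩ := U.isTest.bounded
  obtain ⟨A', hA0', hA'⟩ := U.isTest.deriv.bounded
  obtain ⟨B, hB0, hB⟩ := V.isTest.bounded
  obtain ⟨C, t₀, -, ht₀, h⟩ := PsiLam_expansion hK hL hu hs hs' (M := A + A' + B + 1)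
    (by positivity)
  have hO : (fun t : ℝ => PsiLam u lam (geodesic (gauss K) U t) (geodesic (gauss L) V t)
      - PsiLam u lam (gauss K) (gauss L) - t ^ 2 / 2 * hessForm u K L hK hL (U, V) (U, V))
      =O[𝓝 0] fun t : ℝ => t ^ 3 := by
    refine .of_bound C ?_
    filter_upwards [Metric.closedBall_mem_nhds (0 : ℝ) ht₀] with t ht
    rw [mem_closedBall_zero_iff, Real.norm_eq_abs] at ht
    rw [Real.norm_eq_abs, Real.norm_eq_abs, abs_pow]
    exact h U V (fun x => (hA x).trans (by linarith)) (fun x => (hA' x).trans (by linarith))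
      (fun x => (hB x).trans (by linarith)) t ht
  simpa using hO.trans_isLittleO (isLittleO_pow_pow (𝕜 := ℝ) (by norm_num : 2 < 3))

/-! ### Failure of local maximality -/

theorem isTest_id_mul_bump : IsTest fun y => y * bump y := isTest_bump.id_mul

theorem integral_id_mul_bump_pos {L : ℝ} (hL : 0 < L) :
    0 < ∫ y, y * isTest_id_mul_bump.toVField y ∂gauss L := by
  have hn : ∀ y, 0 ≤ y * isTest_id_mul_bump.toVField y := fun y => by
    rw [IsTest.coe_toVField, ← mul_assoc]
    exact mul_nonneg (mul_self_nonneg y) bump.nonneg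
  rw [integral_pos_iff_support_of_nonneg hn (integrable_id_mul _ _)]
  have hsub : Set.Ioo (0 : ℝ) 1 ⊆ Function.support fun y => y * isTest_id_mul_bump.toVField y := by
    intro y hy
    have h1 : bump y = 1 := bump.one_of_mem_closedBall (by
      simp only [bump, mem_closedBall_zero_iff, Real.norm_eq_abs, abs_of_pos hy.1]
      exact hy.2.le)
    simp [IsTest.coe_toVField, h1, hy.1.ne']
  refine lt_of_lt_of_le (pos_iff_ne_zero.2 fun h0 => ?_) (measure_mono hsub)
  have := gaussianReal_absolutelyContinuous' 0 (by simpa using hL : L.toNNReal ≠ 0) h0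
  simp at this

/-- The variance along a geodesic, in terms of the field itself. -/
theorem variance_geodesic_eq {L : ℝ} (hL : 0 < L) (V : VField) (t : ℝ) :
    variance id (geodesic (gauss L) V t) = L + 2 * t * ∫ y, y * V y ∂gauss L
      + t ^ 2 * (∫ y, V y ^ 2 ∂gauss L - (∫ y, V y ∂gauss L) ^ 2) := by
  rw [variance_geodesic hL, integral_id_mul_stdz V.isTest hL, integral_sq_stdz V.isTest hL]

/-- A correction of the field of order `t` contributes to the variance at order `t²`. -/
theorem variance_geodesic_corrected {L : ℝ} (hL : 0 < L) (V W : VField)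
    (hV : ∫ y, y * V y ∂gauss L = 0) (t : ℝ) :
    variance id (geodesic (gauss L) (V + t • W) t) = L + t ^ 2 * (2 * ∫ y, y * W y ∂gauss L
      + (∫ y, V y ^ 2 ∂gauss L + 2 * t * ∫ y, V y * W y ∂gauss L + t ^ 2 * ∫ y, W y ^ 2 ∂gauss L)
      - (∫ y, V y ∂gauss L + t * ∫ y, W y ∂gauss L) ^ 2) := by
  have i1 := integrable_id_mul (gauss L) V
  have i2 := integrable_id_mul (gauss L) W
  have iV : Integrable V (gauss L) := V.isTest.integrable _
  have iW : Integrable W (gauss L) := W.isTest.integrable _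
  have iVV : Integrable (fun y => V y ^ 2) (gauss L) := by
    simp_rw [pow_two]; exact (V.isTest.contDiff_mul V.contDiff).integrable _
  have iVW : Integrable (fun y => V y * W y) (gauss L) :=
    (W.isTest.contDiff_mul V.contDiff).integrable _
  have iWW : Integrable (fun y => W y ^ 2) (gauss L) := by
    simp_rw [pow_two]; exact (W.isTest.contDiff_mul W.contDiff).integrable _
  have e0 : ∀ y, (V + t • W) y = V y + t * W y := fun y => rfl
  have e1 : ∀ y, y * (V y + t * W y) = y * V y + t * (y * W y) := fun y => by ring
  have e2 : ∀ y, (V y + t * W y) ^ 2 = V y ^ 2 + 2 * t * (V y * W y) + t ^ 2 * W y ^ 2 :=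
    fun y => by ring
  rw [variance_geodesic_eq hL]
  simp_rw [e0, e2, e1]
  rw [integral_add i1 (i2.const_mul t), integral_add iV (iW.const_mul t),
    integral_add (iVV.fun_add (iVW.const_mul _)) (iWW.const_mul _),
    integral_add iVV (iVW.const_mul _), integral_const_mul, integral_const_mul,
    integral_const_mul, integral_const_mul, hV]
  ring

/-- If the Hessian form is positive somewhere on the variance-preserving subspace, the Gaussian
pair is not a local maximum under the variance constraint. The constraint is restored by a
correction of order `t` of the second field, which changes `Ψ_λ` only at order `t³`. -/
theorem not_isW2LocalMaxOn {u lam K L : ℝ} (hK : 0 < K) (hL : 0 < L) (hu : 0 < u) (hlam : 0 ≤ lam)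
    (hs : u / (K + L + u) + 1 / K - (1 + u) / (K + u) = 0) (hs' : u / (K + L + u) = 2 * lam)
    {U V : VField} (hV : ∫ y, y * V y ∂gauss L = 0)
    (hpos : 0 < hessForm u K L hK hL (U, V) (U, V)) :
    ¬ IsW2LocalMaxOn (Psi u) (feasible L) (gauss K) (gauss L) := by
  rintro ⟨ε, hε, hmax⟩
  set h := hessForm u K L hK hL (U, V) (U, V) with hh
  set V₀ : VField := isTest_id_mul_bump.toVField
  have hA := integral_id_mul_bump_pos hL
  set A := ∫ y, y * V₀ y ∂gauss L
  set v := ∫ y, V y ^ 2 ∂gauss L - (∫ y, V y ∂gauss L) ^ 2 with hv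
  -- the correction `W` is chosen so that the variance decreases, but by little compared with `h`
  set W : VField := (-(v + h / (4 * (lam + 1))) / (2 * A)) • V₀ with hWd
  have hWA : 2 * ∫ y, y * W y ∂gauss L = -(v + h / (4 * (lam + 1))) := by
    have : ∀ y, y * W y = (-(v + h / (4 * (lam + 1))) / (2 * A)) * (y * V₀ y) := fun y => by
      change y * (_ * V₀ y) = _
      ring
    simp_rw [this]
    rw [integral_const_mul]
    change 2 * (_ * A) = _
    field_simp
  obtain ⟨F, hF⟩ : ∃ F : ℝ → ℝ, F = fun t => 2 * ∫ y, y * W y ∂gauss L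
      + (∫ y, V y ^ 2 ∂gauss L + 2 * t * ∫ y, V y * W y ∂gauss L + t ^ 2 * ∫ y, W y ^ 2 ∂gauss L)
      - (∫ y, V y ∂gauss L + t * ∫ y, W y ∂gauss L) ^ 2 := ⟨_, rfl⟩
  have hF0 : F 0 = -(h / (4 * (lam + 1))) := by
    rw [hF]
    simp only [hWA, hv]
    ring
  have hFc : Continuous F := by rw [hF]; fun_prop
  obtain ⟨H, hH⟩ : ∃ H : ℝ → ℝ, H = fun t => hessForm u K L hK hL (U, V + t • W) (U, V + t • W) :=
    ⟨_, rfl⟩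
  have hH' : H = fun t => h + t * (hessForm u K L hK hL (U, V) (0, W)
      + hessForm u K L hK hL (0, W) (U, V)) + t ^ 2 * hessForm u K L hK hL (0, W) (0, W) := by
    ext t
    have : ((U, V + t • W) : VField × VField) = (U, V) + t • (0, W) := by simp
    rw [hH]
    simp only [this, map_add, map_smul, LinearMap.add_apply, LinearMap.smul_apply, smul_eq_mul,
      ← hh]
    ring
  have hH0 : H 0 = h := by rw [hH']; simp
  have hHc : Continuous H := by rw [hH']; fun_prop
  obtain ⟨M₁, hM₁, bU⟩ := U.isTest.bounded
  obtain ⟨M₂, hM₂, bU'⟩ := U.isTest.deriv.bounded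
  obtain ⟨M₃, hM₃, bV⟩ := V.isTest.bounded
  obtain ⟨M₄, hM₄, bV'⟩ := V.isTest.deriv.bounded
  obtain ⟨M₅, hM₅, bW⟩ := W.isTest.bounded
  obtain ⟨M₆, hM₆, bW'⟩ := W.isTest.deriv.bounded
  set M := M₁ + M₂ + M₃ + M₄ + M₅ + M₆ + 1 with hMd
  have hM : 0 < M := by positivity
  obtain ⟨C, t₀, -, ht₀, hC⟩ := PsiLam_expansion hK hL hu hs hs' hM
  have hlh : lam * (h / (4 * (lam + 1))) ≤ h / 4 := by
    rw [← mul_div_assoc, div_le_div_iff₀ (by positivity) (by positivity)]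
    nlinarith
  have ev1 : ∀ᶠ t in 𝓝 (0 : ℝ), 0 < H t / 2 + lam * F t - C * |t| := by
    refine ContinuousAt.eventually_lt (by fun_prop) (by fun_prop) ?_
    rw [hF0, hH0, abs_zero]
    linarith
  have ev2 : ∀ᶠ t in 𝓝 (0 : ℝ), F t < 0 := by
    refine ContinuousAt.eventually_lt (by fun_prop) (by fun_prop) ?_
    rw [hF0]
    exact neg_neg_of_pos (by positivity)
  have ev3 : ∀ᶠ t in 𝓝 (0 : ℝ), |t| < min (min t₀ 1) (min (1 / (2 * M)) (ε / (2 * M))) := by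
    refine ContinuousAt.eventually_lt (by fun_prop) (by fun_prop) ?_
    rw [abs_zero]
    positivity
  obtain ⟨t, ⟨⟨h1, h2⟩, h3⟩, ht⟩ := ((((ev1.and ev2).and ev3).filter_mono
    (nhdsWithin_le_nhds (s := {(0 : ℝ)}ᶜ))).and self_mem_nhdsWithin).exists
  rw [Set.mem_singleton_iff] at ht
  simp only [lt_min_iff] at h3
  obtain ⟨⟨h4, h5⟩, h6, h7⟩ := h3
  rw [lt_div_iff₀ (by positivity)] at h6 h7
  have bVt : ∀ x, |(V + t • W) x| ≤ M := fun x => by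
    refine (abs_add_le (V x) (t * W x)).trans ?_
    rw [abs_mul]
    have := mul_le_mul h5.le (bW x) (abs_nonneg _) zero_le_one
    linarith [bV x]
  have dVt : ∀ x, deriv (V + t • W : VField) x = deriv V x + t * deriv W x := fun x =>
    ((V.isTest.hasDerivAt x).add ((W.isTest.hasDerivAt x).const_mul t)).deriv
  have bVt' : ∀ x, |deriv (V + t • W : VField) x| ≤ M := fun x => by
    rw [dVt]
    refine (abs_add_le _ _).trans ?_
    rw [abs_mul]
    have := mul_le_mul h5.le (bW' x) (abs_nonneg _) zero_le_one
    linarith [bV' x]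
  have bU1 : ∀ x, |U x| ≤ M := fun x => (bU x).trans (by linarith)
  have bU1' : ∀ x, |deriv U x| ≤ M := fun x => (bU' x).trans (by linarith)
  have small : ∀ {f : ℝ → ℝ}, (∀ x, |f x| ≤ M) → ∀ x, |t * f x| ≤ 1 / 2 := fun hf x => by
    rw [abs_mul]
    have := mul_le_mul_of_nonneg_left (hf x) (abs_nonneg t)
    linarith
  have near : ENNReal.ofReal (|t| * M) < ENNReal.ofReal ε :=
    (ENNReal.ofReal_lt_ofReal_iff hε).2 (by nlinarith [abs_nonneg t])
  have hvar : variance id (geodesic (gauss L) (V + t • W) t) = L + t ^ 2 * F t := by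
    rw [variance_geodesic_corrected hL V W hV, hF]
  have t2 : 0 < t ^ 2 := by positivity
  have hle := hmax (geodesic (gauss K) U t) (geodesic (gauss L) (V + t • W) t)
    ⟨geodesic_isP2 (small bU1') hK, geodesic_isP2 (small bVt') hL,
      (geodesic_entropy (small bU1') hK).1, by
        change variance id (geodesic (gauss L) (V + t • W) t) ≤ L
        rw [hvar]; nlinarith⟩
    ((w2_geodesic_le _ U bU1 t).trans_lt near)
    ((w2_geodesic_le _ _ bVt t).trans_lt near)
  have hexp := (abs_le.1 (hC U (V + t • W) bU1 bU1' bVt t h4.le)).1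
  have hv0 : variance id (gauss L) = L := by
    simpa [geodesic_zero] using variance_geodesic_eq hL V 0
  have hHt : hessForm u K L hK hL (U, V + t • W) (U, V + t • W) = H t := by rw [hH]
  rw [PsiLam, PsiLam, hvar, hv0, hHt] at hexp
  have h8 : |t| ^ 3 = t ^ 2 * |t| := by rw [pow_succ, sq_abs]
  rw [h8] at hexp
  have h9 := mul_pos t2 h1
  linarith

end

end W2Flow

theorem theorem3 (u lam K L : ℝ) (hu : 0 < u) (hlam : 0 ≤ lam) (hK : 0 < K) (hL : 0 < L)
    (hstat : HasFDerivAt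
      (fun x : ℝ × ℝ => W2Flow.PsiLam u lam (W2Flow.gauss x.1) (W2Flow.gauss x.2))
      (0 : ℝ × ℝ →L[ℝ] ℝ) (K, L)) :
    (∃ H : LinearMap.BilinForm ℝ (W2Flow.VField × W2Flow.VField),
      W2Flow.IsW2Hessian (W2Flow.PsiLam u lam) (W2Flow.gauss K) (W2Flow.gauss L) H ∧
      ((∀ ξ ∈ W2Flow.variancePreserving (W2Flow.gauss L), H ξ ξ ≤ 0) ↔
        K ≤ u / ((1 + u) ^ ((1 : ℝ) / 3) - 1))) ∧
    (u / ((1 + u) ^ ((1 : ℝ) / 3) - 1) < K →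
      ¬ W2Flow.IsW2LocalMaxOn (W2Flow.Psi u) (W2Flow.feasible L)
        (W2Flow.gauss K) (W2Flow.gauss L)) := by
  obtain ⟨hs, hs'⟩ := W2Flow.stationary_eqs hu hK hL hstat
  refine ⟨⟨W2Flow.hessForm u K L hK hL, W2Flow.isW2Hessian_hessForm hK hL hu hs hs', ?_⟩,
    fun hlt => ?_⟩
  · rw [W2Flow.le_threshold_iff hK hu]
    refine ⟨fun h => ?_, fun hρ ξ hξ => W2Flow.hessForm_nonpos hK hL hu hs hρ ξ.1 ξ.2 hξ⟩
    by_contra! hρ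
    obtain ⟨U, V, hV, hpos⟩ := W2Flow.exists_hessForm_pos hK hL hu hρ
    exact (h (U, V) hV).not_gt hpos
  · rw [← not_le, W2Flow.le_threshold_iff hK hu, not_le] at hlt
    obtain ⟨U, V, hV, hpos⟩ := W2Flow.exists_hessForm_pos hK hL hu hlt
    exact W2Flow.not_isW2LocalMaxOn hK hL hu hlam hs hs' hV hpos
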